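/- **Setting.** Let $I$ be a finite set of $n\ge 2$ agents, each agent $i$ having a finite nonempty set of actions $A_i$. For every action profile $a\in\prod_i A_i$ and every agent $i$, the utility $U_i(a)$ has an arbitrary probability distribution supported in $[0,1]$, with mean $M_i(a)$. Write $(b,a_{-i})$ for the profile obtained from $a$ by replacing $a_i$ with $b$. *Parameters.* $K\ge1$ is an integer, $\delta=1/K$, $\tau_0>0$, $c_F\in(0,1)$; $F:\mathbb R\to\mathbb R$ is non-increasing, and $G:\mathbb R^2\to\mathbb R$, $(w,u)\mapsto G(w,u)$, is non-decreasing in $w$ and non-increasing in $u$. The interval $[0,1]$ is cut into the bins $v=0,\dots,K$, bin $v$ being $[v\delta,(v+1)\delta)$ for $v<K$ and $\{1\}$ for $v=K$; its lower edge is $v^-=v\delta$. *RITEL.* An agent is either discontent, or it is content, hopeful or watchful with a benchmark action $\bar a\in A_i$ and a benchmark bin $\bar v$. For $\varepsilon\in(0,1)$, one step of the Markov chain $P^\varepsilon$ on the finite set of states (one agent state per agent) is as follows. Independently, each agent chooses an action: a discontent agent chooses uniformly in $A_i$; a content agent with $\bar v<K$ plays $\bar a$ with probability $1-\varepsilon$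 and otherwise a uniformly chosen action different from $\bar a$; a content agent with $\bar v=K$, a hopeful or a watchful agent plays $\bar a$. The resulting profile $a$ is kept for $\tau=\lceil\tau_0\log(1/\varepsilon)\rceil$ rounds, and each agent $i$, independently of the others, computes the average of $\tau$ i.i.d. samples of $U_i(a)$ and observes the bin $v$ containing it. Then the agents update independently, an agent that played $a_i$ and observed $v$ as follows. - Discontent: becomes content with benchmark $(a_i,v)$ with probability $\min(\varepsilon^{F(v^-)},c_F)$, otherwise stays discontent. - Content, $a_i\ne\bar a$: if $v\ge\bar v+2$, becomes content with benchmark $(a_i,v)$ with probability $\varepsilon^{G(\bar v^-,v^-)}$ and otherwise does not change; if $v\le\bar v+1$, does not change. - Content, $a_i=\bar a$: becomes hopeful if $v\ge\bar v+2$, watchful if $v\le\bar v-2$ (same benchmark), otherwise does not change. - Hopeful: becomes content with benchmark $(\bar a,v)$ if $v\ge\bar v+2$, watchful (same benchmark) if $v\le\bar v-2$, otherwise content with the same benchmark. - Watchful: becomes hopeful (same benchmark) if $v\ge\bar v+2$, discontent if $v\le\bar v-2$, otherwise content with the same benchmark. *Stochastically stable states* are the elements of the smallest set $\mathcal S$ of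 states such that $\lim_{\varepsilon\to0}\liminf_{k\to\infty}\mathbb P(X^\varepsilon_k\in\mathcal S)=1$ for the Markov chain $(X_k^\varepsilon)_k$ with transition matrix $P^\varepsilon$ and any initial distribution. *Notions on action profiles.* $a$ is a $\rho$-equilibrium if $M_i(b,a_{-i})\le M_i(a)+\rho$ for all $i$ and $b\ne a_i$, and an equilibrium if $\rho=0$; $a$ is $\delta$-optimal if $M_i(a)\ge1-\delta$ for all $i$. Put $$\tilde W(a)=1-\sum_iF(M_i(a)),\qquad \tilde W_\pm(a)=1-\sum_iF(M_i(a)\pm\delta),$$ $$\tilde S(a)=1-\min\{G(M_i(a),M_i(b,a_{-i})) : i\in I,\ b\ne a_i,\ M_i(b,a_{-i})>M_i(a)\},$$ $$\tilde S_+(a)=1-\min\{G(M_i(a)-\delta,M_i(b,a_{-i})+\delta) : i\in I,\ b\ne a_i,\ M_i(b,a_{-i})>M_i(a)\},$$ $$\tilde S_-(a)=1-\min\{G(M_i(a)+\delta,M_i(b,a_{-i})-\delta) : i\in I,\ b\ne a_i,\ M_i(b,a_{-i})>M_i(a)+3\delta\},$$ where $\tilde S,\tilde S_+$ are defined if $a$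 is not an equilibrium and $\tilde S_-$ if $a$ is not a $3\delta$-equilibrium. **Theorem.** Assume: 1. ($3\delta$-interdependence) for every profile $a$ and every $\emptyset\ne J\subsetneq I$ there are an agent $i\notin J$ and a profile $a'$ that agrees with $a$ outside $J$ such that $|M_i(a')-M_i(a)|\ge3\delta$; 2. there are constants $F_0,G_0$ with $F_0+G_0\le1$, $0\le F(u)\le F_0/n$ for all $u\in[0,1]$, and $0\le G(w,u)<G_0$ for all $0\le w<u\le1$; 3. $2\tau_0\delta^2\ge1$. Then no agent is discontent in a stochastically stable state, and the benchmark action profile $a$ of such a state satisfies the following. - If an equilibrium exists, then $a$ is $\delta$-optimal, or $a$ is a $3\delta$-equilibrium with $\tilde W_+(a)\ge\tilde W_-(a^\star)$ for every $a^\star$ that maximizes $\tilde W$ among the equilibria. - If no equilibrium exists, then $a$ is a $3\delta$-equilibrium, or $\tilde W_+(a)-\tilde S_-(a)\ge\tilde W_-(a^\star)-\tilde S_+(a^\star)$ for every $a^\star$ that maximizes $\tilde W-\tilde S$ among all action profiles. -/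

import Mathlib

open scoped BigOperators Matrix Topology

noncomputable section

/-! ### Perturbed Markov processes and stochastically stable states -/

/-- `P(X_k ∈ S)` for the Markov chain with transition matrix `P` and initial distribution `μ`. -/
def visitProb {X : Type*} [Fintype X] [DecidableEq X] (P : Matrix X X ℝ) (μ : X → ℝ)
    (S : Set X) (k : ℕ) : ℝ :=
  ∑ y, S.indicator (μ ᵥ* P ^ k) y

/-- `lim_{ε → 0} liminf_{k → ∞} P(X_k^ε ∈ S) = 1` for every initial distribution. -/
def IsAttracting {X : Type*} [Fintype X] [DecidableEq X] (P : ℝ → Matrix X X ℝ)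
    (S : Set X) : Prop :=
  ∀ μ ∈ stdSimplex ℝ X,
    Filter.Tendsto (fun ε : ℝ => Filter.liminf (visitProb (P ε) μ S) Filter.atTop)
      (𝓝[>] 0) (𝓝 1)

/-- The stochastically stable states: the smallest attracting set
(see `isLeast_stochasticallyStable`). -/
def stochasticallyStable {X : Type*} [Fintype X] [DecidableEq X] (P : ℝ → Matrix X X ℝ) :
    Set X :=
  ⋂₀ {S | IsAttracting P S}

theorem visitProb_bounds {X : Type*} [Fintype X] [DecidableEq X] {P : Matrix X X ℝ}
    (hP : P ∈ Matrix.rowStochastic ℝ X) {μ : X → ℝ} (hμ : μ ∈ stdSimplex ℝ X) (k : ℕ) :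
    (∀ y, 0 ≤ (μ ᵥ* P ^ k) y) ∧ ∑ y, (μ ᵥ* P ^ k) y = 1 := by
  have h := pow_mem hP k
  rw [Matrix.mem_rowStochastic] at h
  refine ⟨fun y => Finset.sum_nonneg fun x _ => mul_nonneg (hμ.1 x) (h.1 x y), ?_⟩
  have h2 : (μ ᵥ* P ^ k) ⬝ᵥ 1 = μ ⬝ᵥ ((P ^ k) *ᵥ 1) := (Matrix.dotProduct_mulVec _ _ _).symm
  rw [h.2] at h2
  simpa [dotProduct, hμ.2] using h2

/-- For a family of transition matrices, `stochasticallyStable` is the smallest attracting set. -/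
theorem isLeast_stochasticallyStable {X : Type*} [Fintype X] [DecidableEq X]
    {P : ℝ → Matrix X X ℝ} (hP : ∀ᶠ ε in 𝓝[>] (0 : ℝ), P ε ∈ Matrix.rowStochastic ℝ X) :
    IsLeast {S | IsAttracting P S} (stochasticallyStable P) := by
  refine ⟨?_, fun S hS => Set.sInter_subset_of_mem hS⟩
  have key : ∀ T : Set (Set X), T.Finite → (∀ S ∈ T, IsAttracting P S) →
      IsAttracting P (⋂₀ T) := by
    intro T hT
    induction T, hT using Set.Finite.induction_on with
    | empty =>
      intro _ μ hμ
      refine (tendsto_const_nhds (x := (1 : ℝ))).congr' ?_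
      filter_upwards [hP] with ε hε
      have : visitProb (P ε) μ (⋂₀ ∅) = fun _ => 1 := by
        funext k
        simp [visitProb, (visitProb_bounds hε hμ k).2]
      rw [this]; simp
    | @insert S T _ _ ih =>
      intro h μ hμ
      have hS := h S (Set.mem_insert _ _) μ hμ
      have hT := ih (fun R hR => h R (Set.mem_insert_of_mem _ hR)) μ hμ
      rw [Set.sInter_insert]
      have hlow := (hS.add hT).sub_const 1
      norm_num at hlow
      have hb : ∀ ε, P ε ∈ Matrix.rowStochastic ℝ X → ∀ (R : Set X) k,
          0 ≤ visitProb (P ε) μ R k ∧ visitProb (P ε) μ R k ≤ 1 := by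
        intro ε hε R k
        obtain ⟨h0, h1⟩ := visitProb_bounds hε hμ k
        refine ⟨Finset.sum_nonneg fun y _ => Set.indicator_nonneg (fun y _ => h0 y) y, ?_⟩
        rw [← h1]
        exact Finset.sum_le_sum fun y _ => Set.indicator_le_self' (fun y _ => h0 y) y
      refine tendsto_of_tendsto_of_tendsto_of_le_of_le' hlow tendsto_const_nhds ?_ ?_
      · filter_upwards [hP] with ε hε
        have hB := hb ε hε
        have bd : ∀ R : Set X, Filter.IsBoundedUnder (· ≥ ·) Filter.atTop (visitProb (P ε) μ R) :=
          fun R => Filter.isBoundedUnder_of ⟨0, fun k => (hB R k).1⟩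
        have cb : ∀ R : Set X,
            Filter.IsCoboundedUnder (· ≥ ·) Filter.atTop (visitProb (P ε) μ R) :=
          fun R => (Filter.isBoundedUnder_of ⟨1, fun k => (hB R k).2⟩ :
            Filter.IsBoundedUnder (· ≤ ·) _ _).isCoboundedUnder_ge
        refine le_of_forall_lt fun c hc => ?_
        obtain ⟨d, hd⟩ : ∃ d, d = ((Filter.liminf (visitProb (P ε) μ S) Filter.atTop +
          Filter.liminf (visitProb (P ε) μ (⋂₀ T)) Filter.atTop - 1) - c) / 4 := ⟨_, rfl⟩
        have hd0 : 0 < d := by rw [hd]; linarith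
        have e1 := Filter.eventually_lt_of_lt_liminf
          (sub_lt_self (Filter.liminf (visitProb (P ε) μ S) Filter.atTop) hd0) (bd S)
        have e2 := Filter.eventually_lt_of_lt_liminf
          (sub_lt_self (Filter.liminf (visitProb (P ε) μ (⋂₀ T)) Filter.atTop) hd0) (bd _)
        refine lt_of_lt_of_le (show c < c + d by linarith) ?_
        refine Filter.le_liminf_of_le (cb _) ?_
        filter_upwards [e1, e2] with k h1 h2
        obtain ⟨h0, hsum⟩ := visitProb_bounds hε hμ k
        have : visitProb (P ε) μ S k + visitProb (P ε) μ (⋂₀ T) k ≤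
            visitProb (P ε) μ (S ∩ ⋂₀ T) k + 1 := by
          rw [← hsum]
          simp only [visitProb]
          rw [← Finset.sum_add_distrib, ← Finset.sum_add_distrib]
          refine Finset.sum_le_sum fun y _ => ?_
          have := h0 y
          by_cases a : y ∈ S <;> by_cases b : y ∈ ⋂₀ T <;>
            simp only [Set.indicator, Set.mem_inter_iff, a, b, if_true, if_false, and_true,
              and_false, and_self] <;> linarith
        linarith
      · filter_upwards [hP] with ε hε
        refine Filter.liminf_le_of_le
          (Filter.isBoundedUnder_of ⟨0, fun k => (hb ε hε _ k).1⟩) fun b hbb => ?_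
        obtain ⟨k, hk⟩ := hbb.exists
        exact hk.trans (hb ε hε _ k).2
  exact key _ (Set.toFinite _) fun S hS => hS

/-! ### Random games -/

/-- A random game: `law i a` is the distribution of the utility `U_i(a)` of agent `i` when the
action profile `a` is played; it is supported in `[0,1]` and otherwise arbitrary. -/
structure RandomGame (I : Type*) (A : I → Type*) where
  law : I → (∀ i, A i) → MeasureTheory.Measure ℝ
  isProb : ∀ i a, MeasureTheory.IsProbabilityMeasure (law i a)
  support : ∀ i a, ∀ᵐ u ∂(law i a), u ∈ Set.Icc (0 : ℝ) 1

namespace RandomGame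

variable {I : Type*} {A : I → Type*} (g : RandomGame I A)

/-- Mean utility `M_i(a)`. -/
def mean (i : I) (a : ∀ i, A i) : ℝ := ∫ u, u ∂(g.law i a)

/-- `ρ`-interdependence: any proper nonempty group `J` of agents can, from any profile, change
its own actions so that the mean utility of some agent outside `J` moves by at least `ρ`. -/
def Interdependent (ρ : ℝ) : Prop :=
  ∀ (a : ∀ i, A i) (J : Set I), J.Nonempty → J ≠ Set.univ →
    ∃ i ∉ J, ∃ a' : ∀ i, A i, (∀ j ∉ J, a' j = a j) ∧ ρ ≤ |g.mean i a' - g.mean i a|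

/-- `ρ`-equilibrium action profile; `ρ = 0` is an equilibrium. -/
def IsEquilibrium [DecidableEq I] (ρ : ℝ) (a : ∀ i, A i) : Prop :=
  ∀ (i : I) (b : A i), b ≠ a i → g.mean i (Function.update a i b) ≤ g.mean i a + ρ

/-- `δ`-optimal action profile. -/
def IsOptimal (δ : ℝ) (a : ∀ i, A i) : Prop :=
  ∀ i, 1 - δ ≤ g.mean i a

/-- `1 - ∑_i F(μ_i + s)`. With `s = 0, δ, -δ` these are the virtual welfares
`W̃`, `W̃₊`, `W̃₋` of the profile `a`. -/
def virtualWelfare [Fintype I] (F : ℝ → ℝ) (s : ℝ) (a : ∀ i, A i) : ℝ :=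
  1 - ∑ i, F (g.mean i a + s)

/-- `1 - min {G(μ_i - s, M_i(b, a_{-i}) + s) | b ≠ a_i, M_i(b, a_{-i}) > μ_i + ρ}`.
The set is finite, and it is nonempty exactly when `a` is not a `ρ`-equilibrium. With
`(s, ρ) = (0, 0), (δ, 0), (-δ, 3δ)` these are the virtual stabilities `S̃`, `S̃₊`, `S̃₋`. -/
def virtualStability [DecidableEq I] (G : ℝ → ℝ → ℝ) (s ρ : ℝ) (a : ∀ i, A i) : ℝ :=
  1 - sInf {r : ℝ | ∃ (i : I) (b : A i), b ≠ a i ∧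
    g.mean i a + ρ < g.mean i (Function.update a i b) ∧
    r = G (g.mean i a - s) (g.mean i (Function.update a i b) + s)}

end RandomGame

/-! ### The algorithm -/

/-- Parameters of the algorithm: bins have width `δ = 1 / K`, the period length is
`⌈τ₀ log (1/ε)⌉`, and `F`, `G`, `cF` control the acceptance probabilities. -/
structure RitelParams where
  K : ℕ
  K_pos : 0 < K
  τ₀ : ℝ
  τ₀_pos : 0 < τ₀
  cF : ℝ
  cF_mem : cF ∈ Set.Ioo (0 : ℝ) 1
  F : ℝ → ℝ
  F_antitone : Antitone F
  G : ℝ → ℝ → ℝ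
  G_monotone_left : ∀ u, Monotone fun w => G w u
  G_antitone_right : ∀ w, Antitone (G w)

namespace RitelParams

variable (p : RitelParams)

/-- Bin width. -/
def δ : ℝ := 1 / p.K

/-- Period length. -/
def period (ε : ℝ) : ℕ := ⌈p.τ₀ * Real.log (1 / ε)⌉₊

/-- The bins `[0,δ), …, [1-δ,1), {1}`, numbered `0, …, K`. -/
abbrev Bin : Type := Fin (p.K + 1)

/-- Lower edge of a bin. -/
def lower (v : p.Bin) : ℝ := (v : ℕ) * p.δ

/-- The bin of a utility `u ∈ [0,1]`. -/
def bin (u : ℝ) : p.Bin := ⟨min ⌊u / p.δ⌋₊ p.K, by omega⟩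

/-- The bounds on the resistance functions for a game with `n` agents. -/
def ResistanceBounds (n : ℕ) : Prop :=
  ∃ F₀ G₀ : ℝ,
    (∀ u ∈ Set.Icc (0 : ℝ) 1, 0 ≤ p.F u ∧ p.F u ≤ F₀ / n) ∧
    (∀ w u : ℝ, 0 ≤ w → w < u → u ≤ 1 → 0 ≤ p.G w u ∧ p.G w u < G₀) ∧
    F₀ + G₀ ≤ 1

end RitelParams

/-- State of one agent: a mood together with, unless the agent is discontent, a benchmark action
and a benchmark bin. -/
inductive AgentState (α : Type*) (β : Type*) where
  | discontent : AgentState α β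
  | content (a : α) (v : β) : AgentState α β
  | hopeful (a : α) (v : β) : AgentState α β
  | watchful (a : α) (v : β) : AgentState α β
  deriving DecidableEq, Fintype

namespace AgentState

/-- Benchmark action of an agent. -/
def benchmark {α β : Type*} : AgentState α β → Option α
  | discontent => none
  | content a _ => some a
  | hopeful a _ => some a
  | watchful a _ => some a

/-- Action policy: the probability that an agent in the given state plays `a`. -/
def actionProb {α : Type*} [Fintype α] [DecidableEq α] (p : RitelParams) (ε : ℝ) :
    AgentState α p.Bin → α → ℝ
  | discontent, _ => 1 / Fintype.card α
  | content b w, a =>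
      if w = Fin.last p.K then (if a = b then 1 else 0)
      else if a = b then 1 - ε else ε / (Fintype.card α - 1)
  | hopeful b _, a => if a = b then 1 else 0
  | watchful b _, a => if a = b then 1 else 0

/-- Probability of `y` when one moves to `s` with probability `q` and to `t` otherwise. -/
def choice {α : Type*} [DecidableEq α] (q : ℝ) (s t y : α) : ℝ :=
  q * (if y = s then 1 else 0) + (1 - q) * (if y = t then 1 else 0)

/-- Update policy: the probability that an agent in the given state, which played `a` and observed
the bin `v`, moves to the state `y`. -/
def updateProb {α : Type*} [DecidableEq α] (p : RitelParams) (ε : ℝ) :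
    AgentState α p.Bin → α → p.Bin → AgentState α p.Bin → ℝ
  | discontent, a, v, y =>
      choice (min (ε ^ p.F (p.lower v)) p.cF) (content a v) discontent y
  | content b w, a, v, y =>
      if a ≠ b then
        if (w : ℕ) + 2 ≤ v then
          choice (ε ^ p.G (p.lower w) (p.lower v)) (content a v) (content b w) y
        else if y = content b w then 1 else 0
      else if (w : ℕ) + 2 ≤ v then (if y = hopeful b w then 1 else 0)
      else if (v : ℕ) + 2 ≤ w then (if y = watchful b w then 1 else 0)
      else if y = content b w then 1 else 0
  | hopeful b w, a, v, y =>
      if (w : ℕ) + 2 ≤ v then (if y = content a v then 1 else 0)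
      else if (v : ℕ) + 2 ≤ w then (if y = watchful b w then 1 else 0)
      else if y = content b w then 1 else 0
  | watchful b w, _, v, y =>
      if (w : ℕ) + 2 ≤ v then (if y = hopeful b w then 1 else 0)
      else if (v : ℕ) + 2 ≤ w then (if y = discontent then 1 else 0)
      else if y = content b w then 1 else 0

end AgentState

/-- States of the algorithm. -/
abbrev RitelState {I : Type*} (A : I → Type*) (p : RitelParams) : Type _ :=
  ∀ i, AgentState (A i) p.Bin

/-- `x` is a state without discontent agent whose benchmark action profile is `a`. -/
def HasActionProfile {I : Type*} {A : I → Type*} {p : RitelParams} (x : RitelState A p)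
    (a : ∀ i, A i) : Prop :=
  ∀ i, (x i).benchmark = some (a i)

namespace RandomGame

variable {I : Type*} {A : I → Type*} (g : RandomGame I A)

/-- Probability that the average of `τ` i.i.d. samples of `U_i(a)` lies in the bin `v`. -/
def obsProb (p : RitelParams) (τ : ℕ) (i : I) (a : ∀ i, A i) (v : p.Bin) : ℝ :=
  (MeasureTheory.Measure.pi fun _ : Fin τ => g.law i a).real
    {s | p.bin ((∑ k, s k) / τ) = v}

/-- Transition matrix of the algorithm over one period. The agents choose their actions
independently, commit to them for the whole period, draw their samples independently, and
update their states independently. -/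
def ritel [Fintype I] [DecidableEq I] [∀ i, Fintype (A i)] [∀ i, DecidableEq (A i)]
    (p : RitelParams) (ε : ℝ) : Matrix (RitelState A p) (RitelState A p) ℝ :=
  fun x y => ∑ a : ∀ i, A i,
    (∏ i, (x i).actionProb p ε (a i)) *
      ∏ i, ∑ v : p.Bin, g.obsProb p (p.period ε) i a v * (x i).updateProb p ε (a i) v (y i)

end RandomGame

theorem AgentState.choice_sum {α : Type*} [Fintype α] [DecidableEq α] (q : ℝ) (s t : α) :
    ∑ y, choice q s t y = 1 := by
  simp [choice, Finset.sum_add_distrib]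

theorem AgentState.choice_nonneg {α : Type*} [DecidableEq α] {q : ℝ} (h0 : 0 ≤ q) (h1 : q ≤ 1)
    (s t y : α) : 0 ≤ choice q s t y := by
  unfold choice
  have := sub_nonneg.2 h1
  positivity

/-- For `0 < ε < 1` the matrix of the algorithm is a genuine transition matrix. -/
theorem ritel_rowStochastic {I : Type*} [Fintype I] [DecidableEq I] [Nontrivial I]
    {A : I → Type*} [∀ i, Fintype (A i)] [∀ i, DecidableEq (A i)] [∀ i, Nonempty (A i)]
    (g : RandomGame I A) (p : RitelParams)
    (hinter : g.Interdependent (3 * p.δ)) (hbounds : p.ResistanceBounds (Fintype.card I))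
    {ε : ℝ} (h0 : 0 < ε) (h1 : ε < 1) :
    g.ritel p ε ∈ Matrix.rowStochastic ℝ (RitelState A p) := by
  have := g.isProb
  have hK : (0 : ℝ) < p.K := by exact_mod_cast p.K_pos
  have hδ : 0 < p.δ := by unfold RitelParams.δ; positivity
  have hnt : ∀ i, Nontrivial (A i) := by
    intro i
    let a : ∀ i, A i := fun i => Classical.arbitrary _
    obtain ⟨j, hj⟩ := exists_ne i
    obtain ⟨k, hk, a', ha', h⟩ := hinter a {i} (Set.singleton_nonempty i)
      (fun h => hj (by simpa using (h ▸ Set.mem_univ j : j ∈ ({i} : Set I))))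
    refine ⟨a' i, a i, fun he => ?_⟩
    have : a' = a := by
      funext l
      by_cases hl : l = i
      · subst hl; exact he
      · exact ha' l hl
    subst this
    simp at h
    linarith
  have hlow : ∀ v : p.Bin, p.lower v ∈ Set.Icc (0 : ℝ) 1 := by
    intro v
    refine ⟨by unfold RitelParams.lower; positivity, ?_⟩
    have : ((v : ℕ) : ℝ) ≤ p.K := by exact_mod_cast Nat.lt_succ_iff.1 v.2
    unfold RitelParams.lower RitelParams.δ
    rw [mul_one_div, div_le_one hK]; exact this
  obtain ⟨F0, G0, hF, hG, -⟩ := hbounds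
  have act0 : ∀ i (s : AgentState (A i) p.Bin) a, 0 ≤ s.actionProb p ε a := by
    intro i s a
    have : (1 : ℝ) < Fintype.card (A i) := by exact_mod_cast Fintype.one_lt_card
    have h3 : (0 : ℝ) ≤ Fintype.card (A i) - 1 := by linarith
    have h4 : 0 ≤ 1 - ε := by linarith
    cases s <;> simp only [AgentState.actionProb] <;> (try split_ifs) <;> positivity
  have act1 : ∀ i (s : AgentState (A i) p.Bin), ∑ a, s.actionProb p ε a = 1 := by
    intro i s
    have hc : (1 : ℝ) < Fintype.card (A i) := by exact_mod_cast Fintype.one_lt_card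
    cases s with
    | discontent => simp [AgentState.actionProb]
    | content b w =>
      simp only [AgentState.actionProb]
      split_ifs with h
      · simp
      · rw [← Finset.add_sum_erase _ _ (Finset.mem_univ b)]
        rw [Finset.sum_congr rfl (g := fun _ => ε / ((Fintype.card (A i) : ℝ) - 1))
          (fun x hx => by simp [Finset.ne_of_mem_erase hx])]
        rw [Finset.sum_const, Finset.card_erase_of_mem (Finset.mem_univ b), Finset.card_univ,
          nsmul_eq_mul, Nat.cast_sub Fintype.card_pos]
        have : (Fintype.card (A i) : ℝ) - 1 ≠ 0 := by linarith
        push_cast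
        simp
        field_simp
        ring
    | hopeful b w => simp [AgentState.actionProb]
    | watchful b w => simp [AgentState.actionProb]
  have upd0 : ∀ i (s : AgentState (A i) p.Bin) a v y, 0 ≤ s.updateProb p ε a v y := by
    intro i s a v y
    cases s with
    | discontent =>
      exact AgentState.choice_nonneg (le_min (by positivity) p.cF_mem.1.le)
        ((min_le_right _ _).trans p.cF_mem.2.le) _ _ _
    | content b w =>
      simp only [AgentState.updateProb]
      split_ifs with h1' h2 <;> try positivity
      refine AgentState.choice_nonneg (by positivity) ?_ _ _ _
      refine Real.rpow_le_one h0.le h1.le (hG _ _ (hlow w).1 ?_ (hlow v).2).1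
      unfold RitelParams.lower
      have : ((w : ℕ) : ℝ) < ((v : ℕ) : ℝ) := by exact_mod_cast (by omega)
      gcongr
    | hopeful b w => simp only [AgentState.updateProb]; split_ifs <;> positivity
    | watchful b w => simp only [AgentState.updateProb]; split_ifs <;> positivity
  have upd1 : ∀ i (s : AgentState (A i) p.Bin) a v, ∑ y, s.updateProb p ε a v y = 1 := by
    intro i s a v
    cases s <;> simp only [AgentState.updateProb] <;> (try split_ifs) <;>
      simp [AgentState.choice_sum]
  have obs1 : ∀ i a, ∑ v, g.obsProb p (p.period ε) i a v = 1 := by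
    intro i a
    have hm : Measurable fun s : Fin (p.period ε) → ℝ => p.bin ((∑ k, s k) / p.period ε) := by
      have : Measurable p.bin := by
        have h1 : Measurable fun u : ℝ => ⌊u / p.δ⌋₊ :=
          Nat.measurable_floor.comp (measurable_id.div_const _)
        exact (measurable_from_top (f := fun n : ℕ => (⟨min n p.K, by omega⟩ : p.Bin))).comp h1
      exact this.comp (by fun_prop)
    have hmap := MeasureTheory.Measure.isProbabilityMeasure_map
      (μ := MeasureTheory.Measure.pi fun _ : Fin (p.period ε) => g.law i a) hm.aemeasurable
    have := MeasureTheory.sum_measureReal_singleton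
      (μ := (MeasureTheory.Measure.pi fun _ : Fin (p.period ε) => g.law i a).map
        fun s => p.bin ((∑ k, s k) / p.period ε)) (Finset.univ : Finset p.Bin)
    simp only [Finset.coe_univ, MeasureTheory.probReal_univ] at this
    rw [← this]
    refine Finset.sum_congr rfl fun v _ => ?_
    rw [MeasureTheory.map_measureReal_apply hm (MeasurableSet.singleton v)]
    rfl
  have obs0 : ∀ i a v, 0 ≤ g.obsProb p (p.period ε) i a v :=
    fun i a v => MeasureTheory.measureReal_nonneg
  rw [Matrix.mem_rowStochastic_iff_sum]
  refine ⟨fun x y => Finset.sum_nonneg fun a _ => mul_nonneg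
    (Finset.prod_nonneg fun i _ => act0 _ _ _)
    (Finset.prod_nonneg fun i _ => Finset.sum_nonneg fun v _ => mul_nonneg (obs0 _ _ _)
      (upd0 _ _ _ _ _)), fun x => ?_⟩
  simp only [RandomGame.ritel]
  rw [Finset.sum_comm]
  have : ∀ a : ∀ i, A i, ∑ y : RitelState A p, ∏ i, ∑ v : p.Bin,
      g.obsProb p (p.period ε) i a v * (x i).updateProb p ε (a i) v (y i) = 1 := by
    intro a
    rw [← Fintype.prod_sum (fun i (y : AgentState (A i) p.Bin) => ∑ v : p.Bin,
      g.obsProb p (p.period ε) i a v * (x i).updateProb p ε (a i) v y)]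
    refine Finset.prod_eq_one fun i _ => ?_
    rw [Finset.sum_comm]
    simp_rw [← Finset.mul_sum, upd1, mul_one, obs1]
  simp_rw [← Finset.mul_sum, this, mul_one]
  rw [← Fintype.prod_sum (fun i (a : A i) => (x i).actionProb p ε a)]
  exact Finset.prod_eq_one fun i _ => act1 _ _

end

/-! Fix stationary measures `ν` of the chain and compare orders of magnitude as ε → 0. A step whose
probability is of order `ε ^ r` has resistance `r`, and for a stationary measure the flow out of a
set equals the flow into it. Let D be the state in which all agents are discontent, and let the cost
of a state be the sum of `F(v⁻)` over the benchmark bins `v` of its non-discontent agents.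

Masses relative to D. Benchmark bins only go up as long as an agent is not discontent, and `F` is
non-increasing, so the cost grows only when an agent leaves discontent, and such a step pays for the
growth with its probability. By interdependence a single discontent agent drags all others into
discontent without resistance. Balance on suitable sets of states then gives mass `O(ν(D) ε ^ cost)`
for every state with a discontent agent (`mass_isBigO_of_discontent`), and flow `O(ν(D) ε ^ ∑
F(vᵢ⁻))` through the states with benchmarks `a`, `v` (`outflow_fiber_isBigO`). A state that leaves
these benchmarks at resistance `r` therefore has mass `O(ν(D) ε ^ (∑ F(vᵢ⁻) - r))`
(`mass_isBigO_of_escapes`).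

Ways to leave. One has `r = 0` if some benchmark bin is not near the mean utility; `r = 1 + G(M + δ,
M' - δ)` if a deviation raises a mean `M` to `M' > M + 3δ`; and `r = 2` if an agent is below `1 -
δ`, since its experiments disturb some other agent and two in a row change the benchmark of that
agent or make it discontent.

The mass of D. From D the profile `a` with bins adjacent to the means is entered at resistance at
most `∑ F(Mᵢ(a) - δ)`. Once there, it is left only at resistance `1 + γ⁺`: one experiment, followed
by an acceptance of resistance at least `γ` or by a second rare event. At an equilibrium `γ = 1`.
Balance yields `ν(D) = O(ε ^ (1 + γ⁺ - ∑ F(Mᵢ(a) - δ)))` (`mass_discontent_isBigO`). Combined with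
the previous bounds, a state is negligible as soon as `r < 1 + γ⁺ - ∑ F(Mᵢ(a') - δ) + ∑ F(vᵢ⁻)` for
some profile `a'`; the shifts by δ are the ones in the virtual welfares and stabilities, and `F₀ +
G₀ ≤ 1` handles the remaining states.

Two further ingredients are needed. Hoeffding's inequality and `2τ₀δ² ≥ 1` give an observation error
of δ probability at most ε, while an anticoncentration bound (`exists_le_measureReal_average`) shows
that the average falls on either side of the mean with probability bounded below, which matters when
the mean is a bin edge. Finally the chain at fixed ε need not be irreducible: for states that reach
D the mass along the chain is controlled by stationary measures, and those that do not reach D but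
can leave their benchmarks are transient because benchmark bins can only rise
(`isAttracting_of_negligible`). -/

noncomputable section

/-! ### Long-run behaviour of finite Markov chains -/

section Markov

variable {X : Type*} [Fintype X] [DecidableEq X]

/-- A stationary measure of total mass at most one. -/
structure IsSubStationary (P : Matrix X X ℝ) (ν : X → ℝ) : Prop where
  nonneg : ∀ x, 0 ≤ ν x
  sum_le : ∑ x, ν x ≤ 1
  stat : ν ᵥ* P = ν

/-- The states from which `d` can be reached. -/
def reachSet (P : Matrix X X ℝ) (d : X) : Set X := {x | ∃ k, 0 < (P ^ k) x d}

theorem pow_add_pos {P : Matrix X X ℝ} (hP : P ∈ Matrix.rowStochastic ℝ X) {x y z : X} {k m : ℕ}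
    (h1 : 0 < (P ^ k) x y) (h2 : 0 < (P ^ m) y z) : 0 < (P ^ (k + m)) x z := by
  rw [pow_add, Matrix.mul_apply]
  refine Finset.sum_pos' (fun j _ => mul_nonneg
    (Matrix.nonneg_of_mem_rowStochastic (pow_mem hP k))
    (Matrix.nonneg_of_mem_rowStochastic (pow_mem hP m))) ⟨y, Finset.mem_univ _, mul_pos h1 h2⟩

theorem mem_reachSet_self (P : Matrix X X ℝ) (d : X) : d ∈ reachSet P d := ⟨0, by simp⟩

theorem mem_reachSet_of_pow_pos {P : Matrix X X ℝ} (hP : P ∈ Matrix.rowStochastic ℝ X)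
    {d x y : X} {k : ℕ} (h : 0 < (P ^ k) x y) (hy : y ∈ reachSet P d) : x ∈ reachSet P d := by
  obtain ⟨m, hm⟩ := hy
  exact ⟨k + m, pow_add_pos hP h hm⟩

/-- The chain may leak out of `reachSet P d` but can never enter it, so the law restricted to this
set evolves autonomously. -/
theorem pow_eq_zero_of_notMem_reachSet {P : Matrix X X ℝ} (hP : P ∈ Matrix.rowStochastic ℝ X)
    {d x y : X} (hx : x ∉ reachSet P d) (hy : y ∈ reachSet P d) (k : ℕ) : (P ^ k) x y = 0 := by
  by_contra h
  exact hx (mem_reachSet_of_pow_pos hP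
    (lt_of_le_of_ne (Matrix.nonneg_of_mem_rowStochastic (pow_mem hP k)) (Ne.symm h)) hy)

/-- With a self-loop at `d`, all states that reach `d` do so in a common number of steps. -/
theorem exists_uniform_reach {P : Matrix X X ℝ} (hP : P ∈ Matrix.rowStochastic ℝ X) {d : X}
    (hd : 0 < P d d) :
    ∃ (N : ℕ) (c : ℝ), 0 < c ∧ ∀ x ∈ reachSet P d, c ≤ (P ^ N) x d := by
  classical
  have hdd : ∀ m, 0 < (P ^ m) d d := by
    intro m
    induction m with
    | zero => simp
    | succ m ih => exact pow_add_pos hP ih (by simpa using hd)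
  choose! k hk using fun x (hx : x ∈ reachSet P d) => hx
  let N := Finset.univ.sup k
  have hN : ∀ x ∈ reachSet P d, 0 < (P ^ N) x d := by
    intro x hx
    have hle : k x ≤ N := Finset.le_sup (Finset.mem_univ x)
    have := pow_add_pos hP (hk x hx) (hdd (N - k x))
    rwa [Nat.add_sub_cancel' hle] at this
  let R := Finset.univ.filter (· ∈ reachSet P d)
  have hne : R.Nonempty := ⟨d, by simp [R, mem_reachSet_self]⟩
  refine ⟨N, R.inf' hne fun x => (P ^ N) x d, ?_, fun x hx => ?_⟩
  · rw [Finset.lt_inf'_iff]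
    intro x hx
    exact hN x (by simpa [R] using hx)
  · exact Finset.inf'_le _ (by simpa [R] using hx)

/-- Contraction of signed measures under a substochastic kernel that charges the point `d`. -/
theorem sum_abs_kernel_le {R : Finset X} {Q : Matrix X X ℝ} (h0 : ∀ x y, 0 ≤ Q x y)
    (h1 : ∀ x, ∑ y, Q x y = 1) {d : X} (hdR : d ∈ R) {c : ℝ} (hc0 : 0 ≤ c)
    (hc : ∀ x ∈ R, c ≤ Q x d) (u : X → ℝ) :
    ∑ y ∈ R, |∑ x ∈ R, u x * Q x y| ≤
      (1 - c) * ∑ x ∈ R, |u x| + c * |∑ x ∈ R, u x| := by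
  have hd : |∑ x ∈ R, u x * Q x d| ≤
      ∑ x ∈ R, |u x| * (Q x d - c) + c * |∑ x ∈ R, u x| := by
    -- Every row gives at least mass `c` to `d`. This common part sees only the total mass of `u`,
    -- where cancellation is allowed, and the rest of the kernel has row sums at most `1 - c`.
    have e : ∑ x ∈ R, u x * Q x d = ∑ x ∈ R, u x * (Q x d - c) + c * ∑ x ∈ R, u x := by
      rw [Finset.mul_sum, ← Finset.sum_add_distrib]
      exact Finset.sum_congr rfl fun x _ => by ring
    rw [e]
    refine (abs_add_le _ _).trans (add_le_add ?_ ?_)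
    · refine (Finset.abs_sum_le_sum_abs _ _).trans (Finset.sum_le_sum fun x hx => ?_)
      rw [abs_mul, abs_of_nonneg (sub_nonneg.2 (hc x hx))]
    · rw [abs_mul, abs_of_nonneg hc0]
  have hy : ∀ y ∈ R.erase d, |∑ x ∈ R, u x * Q x y| ≤ ∑ x ∈ R, |u x| * Q x y := by
    intro y _
    refine (Finset.abs_sum_le_sum_abs _ _).trans (Finset.sum_le_sum fun x hx => ?_)
    rw [abs_mul, abs_of_nonneg (h0 x y)]
  rw [← Finset.add_sum_erase _ _ hdR]
  refine (add_le_add hd (Finset.sum_le_sum hy)).trans ?_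
  rw [Finset.sum_comm, Finset.mul_sum]
  have : ∑ x ∈ R, |u x| * (Q x d - c) + ∑ x ∈ R, ∑ y ∈ R.erase d, |u x| * Q x y ≤
      ∑ x ∈ R, (1 - c) * |u x| := by
    rw [← Finset.sum_add_distrib]
    refine Finset.sum_le_sum fun x hx => ?_
    rw [← Finset.mul_sum]
    have h2 : Q x d + ∑ y ∈ R.erase d, Q x y ≤ 1 := by
      rw [Finset.add_sum_erase _ (fun y => Q x y) hdR, ← h1 x]
      exact Finset.sum_le_sum_of_subset_of_nonneg (Finset.subset_univ _) fun y _ _ => h0 x y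
    nlinarith [abs_nonneg (u x)]
  linarith

/-- On the states that can reach a state with a self-loop, the law of the chain is asymptotically
stationary. -/
theorem tendsto_law_sub_law_succ {P : Matrix X X ℝ} (hP : P ∈ Matrix.rowStochastic ℝ X) {d : X}
    (hd : 0 < P d d) {μ : X → ℝ} (hμ : μ ∈ stdSimplex ℝ X) {x : X} (hx : x ∈ reachSet P d) :
    Filter.Tendsto (fun k => (μ ᵥ* P ^ k) x - (μ ᵥ* P ^ (k + 1)) x) Filter.atTop (𝓝 0) := by
  classical
  let R := Finset.univ.filter (· ∈ reachSet P d)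
  have hR : ∀ y, y ∈ R ↔ y ∈ reachSet P d := fun y => by simp [R]
  let u : ℕ → X → ℝ := fun k x => (μ ᵥ* P ^ k) x - (μ ᵥ* P ^ (k + 1)) x
  have hadd : ∀ (k m : ℕ) (y : X), (μ ᵥ* P ^ (k + m)) y = ∑ x, (μ ᵥ* P ^ k) x * (P ^ m) x y := by
    intro k m y
    rw [pow_add, ← Matrix.vecMul_vecMul]
    rfl
  have haddR : ∀ (k m : ℕ) (y : X), y ∈ R →
      (μ ᵥ* P ^ (k + m)) y = ∑ x ∈ R, (μ ᵥ* P ^ k) x * (P ^ m) x y := by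
    intro k m y hy
    rw [hadd]
    refine (Finset.sum_subset (Finset.subset_univ _) fun x _ hx => ?_).symm
    rw [pow_eq_zero_of_notMem_reachSet hP (fun h => hx ((hR x).2 h)) ((hR y).1 hy), mul_zero]
  have hu : ∀ (k m : ℕ) (y : X), y ∈ R → u (k + m) y = ∑ x ∈ R, u k x * (P ^ m) x y := by
    intro k m y hy
    simp only [u]
    rw [haddR k m y hy, show k + m + 1 = (k + 1) + m by ring, haddR (k + 1) m y hy,
      ← Finset.sum_sub_distrib]
    exact Finset.sum_congr rfl fun x _ => by ring
  let q : ℕ → ℝ := fun k => ∑ x ∈ R, (μ ᵥ* P ^ k) x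
  have hb := fun k => visitProb_bounds hP hμ k
  have h0 : ∀ m x y, 0 ≤ (P ^ m) x y := fun m x y =>
    Matrix.nonneg_of_mem_rowStochastic (pow_mem hP m)
  have h1 : ∀ m x, ∑ y, (P ^ m) x y = 1 := fun m x =>
    Matrix.sum_row_of_mem_rowStochastic (pow_mem hP m) x
  -- Mass only leaks out of `R`, so `q` converges and its increments, which are the total masses of
  -- `u k`, tend to zero.
  have hq : Antitone q := by
    refine antitone_nat_of_succ_le fun k => ?_
    simp only [q]
    rw [Finset.sum_congr rfl fun y hy => haddR k 1 y hy, Finset.sum_comm]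
    refine Finset.sum_le_sum fun x _ => ?_
    rw [← Finset.mul_sum]
    refine mul_le_of_le_one_right ((hb k).1 x) ?_
    rw [← h1 1 x]
    exact Finset.sum_le_sum_of_subset_of_nonneg (Finset.subset_univ _) fun y _ _ => h0 1 x y
  have hq0 : ∀ k, 0 ≤ q k := fun k => Finset.sum_nonneg fun x _ => (hb k).1 x
  obtain ⟨ℓ, hℓ⟩ : ∃ ℓ, Filter.Tendsto q Filter.atTop (𝓝 ℓ) :=
    ⟨_, tendsto_atTop_ciInf hq ⟨0, by rintro _ ⟨k, rfl⟩; exact hq0 k⟩⟩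
  let a : ℕ → ℝ := fun k => ∑ x ∈ R, |u k x|
  have hdR : d ∈ R := (hR d).2 (mem_reachSet_self P d)
  have ha : Antitone a := by
    refine antitone_nat_of_succ_le fun k => ?_
    have := sum_abs_kernel_le (h0 1) (h1 1) hdR le_rfl (fun x _ => h0 1 x d) (u k)
    simp only [sub_zero, one_mul, zero_mul, add_zero] at this
    simp only [a]
    rwa [Finset.sum_congr rfl fun y hy => by rw [hu k 1 y hy]]
  have ha0 : ∀ k, 0 ≤ a k := fun k => Finset.sum_nonneg fun x _ => abs_nonneg _
  obtain ⟨L, hL⟩ : ∃ L, Filter.Tendsto a Filter.atTop (𝓝 L) :=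
    ⟨_, tendsto_atTop_ciInf ha ⟨0, by rintro _ ⟨k, rfl⟩; exact ha0 k⟩⟩
  obtain ⟨N, c, hc, hN⟩ := exists_uniform_reach hP hd
  have hstep : ∀ k, a (k + N) ≤ (1 - c) * a k + c * |q k - q (k + 1)| := by
    intro k
    have := sum_abs_kernel_le (h0 N) (h1 N) hdR hc.le (fun x hx => hN x ((hR x).1 hx)) (u k)
    have e : ∑ x ∈ R, u k x = q k - q (k + 1) := by simp [u, q, Finset.sum_sub_distrib]
    rw [e] at this
    simp only [a]
    rwa [Finset.sum_congr rfl fun y hy => by rw [hu k N y hy]]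
  have hlim : Filter.Tendsto (fun k => (1 - c) * a k + c * |q k - q (k + 1)|) Filter.atTop
      (𝓝 ((1 - c) * L + c * |ℓ - ℓ|)) :=
    (hL.const_mul _).add (((hℓ.sub (hℓ.comp (Filter.tendsto_add_atTop_nat 1))).abs).const_mul _)
  -- In the limit the contraction reads `L ≤ (1 - c) * L`, which forces `L = 0`.
  have hLN : Filter.Tendsto (fun k => a (k + N)) Filter.atTop (𝓝 L) :=
    hL.comp (Filter.tendsto_add_atTop_nat N)
  have hle := le_of_tendsto_of_tendsto' hLN hlim hstep
  have hL0 : L = 0 := by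
    have h3 : 0 ≤ L := ge_of_tendsto' hL ha0
    simp only [sub_self, abs_zero, mul_zero, add_zero] at hle
    nlinarith
  rw [hL0] at hL
  refine squeeze_zero_norm (fun k => ?_) hL
  rw [Real.norm_eq_abs]
  exact Finset.single_le_sum (f := fun x => |u k x|) (fun x _ => abs_nonneg _) ((hR x).2 hx)

/-- A state that reaches `d` and keeps its mass at infinitely many times carries mass under some
stationary measure. -/
theorem exists_isSubStationary {P : Matrix X X ℝ} (hP : P ∈ Matrix.rowStochastic ℝ X) {d : X}
    (hd : 0 < P d d) {μ : X → ℝ} (hμ : μ ∈ stdSimplex ℝ X) {x : X} (hx : x ∈ reachSet P d)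
    {η : ℝ} (h : ∃ᶠ k in Filter.atTop, η ≤ (μ ᵥ* P ^ k) x) :
    ∃ ν, IsSubStationary P ν ∧ η ≤ ν x := by
  classical
  -- An ultrafilter of times at which the mass of `x` is at least `η`: by compactness the laws
  -- converge along it, at all states simultaneously.
  obtain ⟨U, hU⟩ : ∃ U : Ultrafilter ℕ,
      (U : Filter ℕ) ≤ Filter.atTop ⊓ Filter.principal {k | η ≤ (μ ᵥ* P ^ k) x} := by
    have : (Filter.atTop ⊓ Filter.principal {k | η ≤ (μ ᵥ* P ^ k) x}).NeBot :=
      Filter.frequently_mem_iff_neBot.1 h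
    exact ⟨Ultrafilter.of _, Ultrafilter.of_le _⟩
  have hU1 : (U : Filter ℕ) ≤ Filter.atTop := hU.trans inf_le_left
  have hU2 : ∀ᶠ k in (U : Filter ℕ), η ≤ (μ ᵥ* P ^ k) x :=
    (hU.trans inf_le_right) (Filter.mem_principal_self _)
  have hb := fun k => visitProb_bounds hP hμ k
  have hlim : ∀ y, ∃ r, Filter.Tendsto (fun k => (μ ᵥ* P ^ k) y) U (𝓝 r) := by
    intro y
    have hmem : ∀ k, (μ ᵥ* P ^ k) y ∈ Set.Icc (0 : ℝ) 1 := fun k =>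
      ⟨(hb k).1 y, by
        rw [← (hb k).2]
        exact Finset.single_le_sum (fun z _ => (hb k).1 z) (Finset.mem_univ y)⟩
    obtain ⟨r, -, hr⟩ := isCompact_Icc.ultrafilter_le_nhds (U.map fun k => (μ ᵥ* P ^ k) y)
      (Filter.le_principal_iff.2 (Filter.mem_map.2 (Filter.univ_mem' hmem)))
    exact ⟨r, hr⟩
  choose ν hν using hlim
  have hν0 : ∀ y, 0 ≤ ν y := fun y => ge_of_tendsto' (hν y) fun k => (hb k).1 y
  have hνsum : ∑ y, ν y = 1 := by
    have h1 := tendsto_finsetSum Finset.univ fun y _ => hν y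
    simp_rw [(hb _).2] at h1
    exact (tendsto_nhds_unique h1 tendsto_const_nhds)
  let R := Finset.univ.filter (· ∈ reachSet P d)
  have hR : ∀ y, y ∈ R ↔ y ∈ reachSet P d := fun y => by simp [R]
  have hstat : ∀ y ∈ R, ∑ z ∈ R, ν z * P z y = ν y := by
    intro y hy
    have h1 : Filter.Tendsto (fun k => (μ ᵥ* P ^ (k + 1)) y) U (𝓝 (ν y)) := by
      have h2 := (hν y).sub ((tendsto_law_sub_law_succ hP hd hμ ((hR y).1 hy)).mono_left hU1)
      simpa using h2
    have h3 : Filter.Tendsto (fun k => (μ ᵥ* P ^ (k + 1)) y) U (𝓝 (∑ z, ν z * P z y)) := by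
      have h4 := tendsto_finsetSum Finset.univ fun z _ => (hν z).mul_const (P z y)
      refine h4.congr fun k => ?_
      rw [pow_succ, ← Matrix.vecMul_vecMul]
      rfl
    rw [tendsto_nhds_unique h1 h3]
    refine Finset.sum_subset (Finset.subset_univ _) fun z _ hz => ?_
    have := pow_eq_zero_of_notMem_reachSet hP (fun h => hz ((hR z).2 h)) ((hR y).1 hy) 1
    rw [pow_one] at this
    rw [this, mul_zero]
  have h0 : ∀ x y, 0 ≤ P x y := fun x y => Matrix.nonneg_of_mem_rowStochastic hP
  have h1 : ∀ x, ∑ y, P x y = 1 := fun x => Matrix.sum_row_of_mem_rowStochastic hP x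
  -- The limit is balanced on `R`, so summing over `R` leaves nothing for the flow from `R` to its
  -- complement. Hence the restriction to `R` is stationary, possibly with total mass below one.
  have hout : ∑ y ∈ Rᶜ, ∑ z ∈ R, ν z * P z y = 0 := by
    have e1 : ∑ y, ∑ z ∈ R, ν z * P z y = ∑ z ∈ R, ν z := by
      rw [Finset.sum_comm]
      exact Finset.sum_congr rfl fun z _ => by rw [← Finset.mul_sum, h1, mul_one]
    rw [← Finset.sum_add_sum_compl R, Finset.sum_congr rfl hstat] at e1
    linarith
  refine ⟨fun y => if y ∈ R then ν y else 0, ⟨fun y => ?_, ?_, ?_⟩, ?_⟩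
  · show 0 ≤ if y ∈ R then ν y else 0
    split_ifs
    exacts [hν0 y, le_rfl]
  · rw [← hνsum]
    refine Finset.sum_le_sum fun y _ => ?_
    split_ifs
    exacts [le_rfl, hν0 y]
  · funext y
    have e : ((fun y => if y ∈ R then ν y else 0) ᵥ* P) y = ∑ z ∈ R, ν z * P z y := by
      simp [Matrix.vecMul, dotProduct, ite_mul, Finset.sum_ite_mem]
    rw [e]
    split_ifs with hy
    · exact hstat y hy
    · exact (Finset.sum_eq_zero_iff_of_nonneg fun y _ => Finset.sum_nonneg fun z _ =>
        mul_nonneg (hν0 z) (h0 z y)).1 hout y (by simpa using hy)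
  · show η ≤ if x ∈ R then ν x else 0
    rw [if_pos ((hR x).2 hx)]
    exact ge_of_tendsto (hν x) hU2

/-- If a function is non-decreasing along the transitions inside a closed set, a state of this
set from which the function can increase is transient. -/
theorem tendsto_law_zero_of_increasing {P : Matrix X X ℝ} (hP : P ∈ Matrix.rowStochastic ℝ X)
    {W : Set X} {V : X → ℝ} (hV0 : ∀ x, 0 ≤ V x)
    (hW : ∀ x ∈ W, ∀ y, 0 < P x y → y ∈ W ∧ V x ≤ V y) {μ : X → ℝ} (hμ : μ ∈ stdSimplex ℝ X)
    {x y : X} (hx : x ∈ W) {T : ℕ} (hxy : 0 < (P ^ T) x y) (hV : V x < V y) :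
    Filter.Tendsto (fun k => (μ ᵥ* P ^ k) x) Filter.atTop (𝓝 0) := by
  classical
  have h0 : ∀ m x y, 0 ≤ (P ^ m) x y := fun m x y =>
    Matrix.nonneg_of_mem_rowStochastic (pow_mem hP m)
  have h1 : ∀ m x, ∑ y, (P ^ m) x y = 1 := fun m x =>
    Matrix.sum_row_of_mem_rowStochastic (pow_mem hP m) x
  have hWm : ∀ m, ∀ x ∈ W, ∀ y, 0 < (P ^ m) x y → y ∈ W ∧ V x ≤ V y := by
    intro m
    induction m with
    | zero =>
      intro x hx y hy
      rw [pow_zero, Matrix.one_apply] at hy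
      split_ifs at hy with he
      · subst he
        exact ⟨hx, le_rfl⟩
      · exact absurd hy (lt_irrefl 0)
    | succ m ih =>
      intro x hx y hy
      rw [pow_succ, Matrix.mul_apply] at hy
      obtain ⟨z, -, hz⟩ := Finset.exists_ne_zero_of_sum_ne_zero hy.ne'
      have hz1 := lt_of_le_of_ne (h0 m x z) (Ne.symm (left_ne_zero_of_mul hz))
      have hP0 : 0 ≤ P z y := Matrix.nonneg_of_mem_rowStochastic hP
      have hz2 := lt_of_le_of_ne hP0 (Ne.symm (right_ne_zero_of_mul hz))
      obtain ⟨a1, a2⟩ := ih x hx z hz1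
      obtain ⟨b1, b2⟩ := hW z a1 y hz2
      exact ⟨b1, a2.trans b2⟩
  -- Cut off outside `W`, the function is a submartingale for the whole chain: `W` is closed, and
  -- elsewhere the value is zero.
  let VW : X → ℝ := fun z => if z ∈ W then V z else 0
  have hVW0 : ∀ z, 0 ≤ VW z := fun z => by
    simp only [VW]
    split_ifs
    exacts [hV0 z, le_rfl]
  let e : ℕ → X → ℝ := fun m z => ∑ y, (P ^ m) z y * VW y
  have he : ∀ m z, VW z ≤ e m z := by
    intro m z
    by_cases hz : z ∈ W
    · have : VW z = ∑ y, (P ^ m) z y * VW z := by rw [← Finset.sum_mul, h1, one_mul]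
      rw [this]
      refine Finset.sum_le_sum fun y _ => ?_
      rcases (h0 m z y).eq_or_lt with hy | hy
      · simp [← hy]
      · obtain ⟨a1, a2⟩ := hWm m z hz y hy
        refine mul_le_mul_of_nonneg_left ?_ (h0 m z y)
        simpa [VW, hz, a1] using a2
    · have : VW z = 0 := by simp [VW, hz]
      rw [this]
      exact Finset.sum_nonneg fun y _ => mul_nonneg (h0 m z y) (hVW0 y)
  let p := (P ^ T) x y * (V y - V x)
  have hp : 0 < p := mul_pos hxy (sub_pos.2 hV)
  have hep : VW x + p ≤ e T x := by
    have hsum : VW x = ∑ z, (P ^ T) x z * VW x := by rw [← Finset.sum_mul, h1, one_mul]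
    have hnn : ∀ z, 0 ≤ (P ^ T) x z * (VW z - VW x) := by
      intro z
      rcases (h0 T x z).eq_or_lt with hz | hz
      · simp [← hz]
      · obtain ⟨a1, a2⟩ := hWm T x hx z hz
        refine mul_nonneg (h0 T x z) ?_
        simpa [VW, hx, a1] using a2
    have h3 := Finset.single_le_sum (f := fun z => (P ^ T) x z * (VW z - VW x))
      (fun z _ => hnn z) (Finset.mem_univ y)
    have hyW := (hWm T x hx y hxy).1
    have h4 : ∑ z, (P ^ T) x z * (VW z - VW x) = e T x - VW x := by
      simp only [mul_sub, Finset.sum_sub_distrib, ← hsum, e]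
    rw [h4] at h3
    simp only [VW, hx, hyW, if_true] at h3 ⊢
    simp only [p]
    linarith
  have hb := fun k => visitProb_bounds hP hμ k
  -- The expectation is monotone and bounded, hence convergent. Each visit to `x` at time `k`
  -- contributes at least `p` to the gain over the next `T` steps, so the probability of the visit
  -- is at most `(m (k + T) - m k) / p`.
  let m : ℕ → ℝ := fun k => ∑ z, (μ ᵥ* P ^ k) z * VW z
  have hm : ∀ k n, m (k + n) = ∑ z, (μ ᵥ* P ^ k) z * e n z := by
    intro k n
    simp only [m, e, Finset.mul_sum]
    rw [Finset.sum_comm]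
    refine Finset.sum_congr rfl fun y _ => ?_
    rw [pow_add, ← Matrix.vecMul_vecMul]
    rw [show ((μ ᵥ* P ^ k) ᵥ* P ^ n) y = ∑ z, (μ ᵥ* P ^ k) z * (P ^ n) z y from rfl,
      Finset.sum_mul]
    exact Finset.sum_congr rfl fun z _ => by ring
  have hmono : Monotone m := by
    refine monotone_nat_of_le_succ fun k => ?_
    rw [hm]
    exact Finset.sum_le_sum fun z _ => mul_le_mul_of_nonneg_left (he 1 z) ((hb k).1 z)
  have hbd : ∀ k, m k ≤ ∑ z, VW z := by
    intro k
    refine Finset.sum_le_sum fun z _ => mul_le_of_le_one_left (hVW0 z) ?_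
    rw [← (hb k).2]
    exact Finset.single_le_sum (fun z _ => (hb k).1 z) (Finset.mem_univ z)
  obtain ⟨ℓ, hℓ⟩ : ∃ ℓ, Filter.Tendsto m Filter.atTop (𝓝 ℓ) :=
    ⟨_, tendsto_atTop_ciSup hmono ⟨_, by rintro _ ⟨k, rfl⟩; exact hbd k⟩⟩
  have hdiff : Filter.Tendsto (fun k => (m (k + T) - m k) / p) Filter.atTop (𝓝 0) := by
    have := ((hℓ.comp (Filter.tendsto_add_atTop_nat T)).sub hℓ).div_const p
    simpa using this
  refine squeeze_zero (fun k => (hb k).1 x) (fun k => ?_) hdiff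
  rw [le_div_iff₀ hp, hm k T]
  have h5 : m (k + T) - m k = ∑ z, (μ ᵥ* P ^ k) z * (e T z - VW z) := by
    rw [hm]
    simp only [m, mul_sub, Finset.sum_sub_distrib]
  rw [hm] at h5
  rw [h5]
  refine le_trans ?_ (Finset.single_le_sum (f := fun z => (μ ᵥ* P ^ k) z * (e T z - VW z))
    (fun z _ => mul_nonneg ((hb k).1 z) (sub_nonneg.2 (he T z))) (Finset.mem_univ x))
  exact mul_le_mul_of_nonneg_left (by linarith) ((hb k).1 x)

end Markov


/-! ### Flows of stationary measures of perturbed chains -/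

section Flow

open Asymptotics

variable {X : Type*} [Fintype X]

open Classical in
/-- The stationary flow out of the set `L`. -/
def outflow (P : ℝ → Matrix X X ℝ) (ν : ℝ → X → ℝ) (L : Set X) (ε : ℝ) : ℝ :=
  ∑ x, ∑ y, if x ∈ L ∧ y ∉ L then ν ε x * P ε x y else 0

/-- `Escapes P L r z`: from `z`, the chain leaves `L` along transitions of total resistance `r`. -/
inductive Escapes (P : ℝ → Matrix X X ℝ) (L : Set X) : ℝ → X → Prop
  -- Only the total probability of `T` has to be of order at least `ε ^ q`. It is not known which
  -- element of `T` is hit, so each one that is still in `L` must escape at the same resistance `r`.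
  | step {z : X} {q r : ℝ} (T : Set X) (hr : 0 ≤ r)
      (hT : (fun ε : ℝ => ε ^ q) =O[𝓝[>] 0] fun ε => ∑ y, T.indicator (P ε z) y)
      (h : ∀ y ∈ T, y ∈ L → Escapes P L r y) : Escapes P L (q + r) z

variable {P : ℝ → Matrix X X ℝ} {ν : ℝ → X → ℝ}

theorem Escapes.of_exit {L T : Set X} {z : X} {q : ℝ}
    (hT : (fun ε : ℝ => ε ^ q) =O[𝓝[>] 0] fun ε => ∑ y, T.indicator (P ε z) y)
    (h : ∀ y ∈ T, y ∉ L) : Escapes P L q z := by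
  have := Escapes.step (r := 0) T le_rfl hT fun y hy hyL => absurd hyL (h y hy)
  rwa [add_zero] at this

theorem Escapes.of_free_step {L T : Set X} {z : X} {r : ℝ} (hr : 0 ≤ r)
    (hT : (fun _ : ℝ => (1 : ℝ)) =O[𝓝[>] 0] fun ε => ∑ y, T.indicator (P ε z) y)
    (h : ∀ y ∈ T, y ∈ L → Escapes P L r y) : Escapes P L r z := by
  have := Escapes.step (q := 0) T hr (by simpa using hT) h
  rwa [zero_add] at this

theorem isBigO_of_eventually_le {f g : ℝ → ℝ} (h0 : ∀ᶠ ε in 𝓝[>] (0 : ℝ), 0 ≤ f ε)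
    (h : ∀ᶠ ε in 𝓝[>] (0 : ℝ), f ε ≤ g ε) : f =O[𝓝[>] 0] g := by
  refine IsBigO.of_bound 1 ?_
  filter_upwards [h0, h] with ε h1 h2
  rw [one_mul, Real.norm_of_nonneg h1, Real.norm_of_nonneg (h1.trans h2)]
  exact h2

theorem eventually_mem_Ioo : ∀ᶠ ε : ℝ in 𝓝[>] 0, 0 < ε ∧ ε < 1 := Ioo_mem_nhdsGT one_pos

theorem one_isBigO_of_le {f : ℝ → ℝ} {c : ℝ} (hc : 0 < c) (h : ∀ᶠ ε in 𝓝[>] (0 : ℝ), c ≤ f ε) :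
    (fun _ : ℝ => (1 : ℝ)) =O[𝓝[>] 0] f := by
  refine IsBigO.of_bound c⁻¹ ?_
  filter_upwards [h] with ε hε
  rw [norm_one, Real.norm_of_nonneg (hc.le.trans hε), inv_mul_eq_div, le_div_iff₀ hc, one_mul]
  exact hε

theorem rpow_isBigO_rpow {s t : ℝ} (h : t ≤ s) :
    (fun ε : ℝ => ε ^ s) =O[𝓝[>] 0] fun ε : ℝ => ε ^ t := by
  have h1 : ∀ᶠ ε : ℝ in 𝓝[>] 0, ε ∈ Set.Ioo (0 : ℝ) 1 := Ioo_mem_nhdsGT one_pos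
  refine isBigO_of_eventually_le ?_ ?_
  · filter_upwards [h1] with ε hε using (Real.rpow_pos_of_pos hε.1 _).le
  · filter_upwards [h1] with ε hε using Real.rpow_le_rpow_of_exponent_ge hε.1 hε.2.le h

theorem outflow_isBigO {L : Set X} {w : ℝ → ℝ}
    (h : ∀ x ∈ L, ∀ y ∉ L, (fun ε => ν ε x * P ε x y) =O[𝓝[>] 0] w) :
    outflow P ν L =O[𝓝[>] 0] w := by
  classical
  unfold outflow
  refine IsBigO.fun_sum fun x _ => IsBigO.fun_sum fun y _ => ?_
  by_cases hxy : x ∈ L ∧ y ∉ L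
  · simpa only [hxy, not_false_eq_true, and_self, if_true] using h x hxy.1 y hxy.2
  · simpa only [hxy, if_false] using isBigO_zero _ _

variable [DecidableEq X]

theorem stationary_mul_le {P : Matrix X X ℝ} {ν : X → ℝ} (hP : P ∈ Matrix.rowStochastic ℝ X)
    (hν : IsSubStationary P ν) (x y : X) : ν x * P x y ≤ ν y := by
  have h : ν y = ∑ z, ν z * P z y := by
    conv_lhs => rw [← hν.stat]
    rfl
  rw [h]
  exact Finset.single_le_sum (f := fun z => ν z * P z y)
    (fun z _ => mul_nonneg (hν.nonneg z) (Matrix.nonneg_of_mem_rowStochastic hP))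
    (Finset.mem_univ x)

theorem flow_isBigO_target (hP : ∀ᶠ ε in 𝓝[>] (0 : ℝ), P ε ∈ Matrix.rowStochastic ℝ X)
    (hν : ∀ᶠ ε in 𝓝[>] (0 : ℝ), IsSubStationary (P ε) (ν ε)) (x y : X) :
    (fun ε => ν ε x * P ε x y) =O[𝓝[>] 0] fun ε => ν ε y := by
  refine isBigO_of_eventually_le ?_ ?_
  · filter_upwards [hP, hν] with ε h1 h2
    exact mul_nonneg (h2.nonneg x) (Matrix.nonneg_of_mem_rowStochastic h1)
  · filter_upwards [hP, hν] with ε h1 h2 using stationary_mul_le h1 h2 x y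

theorem flow_isBigO_outflow (hP : ∀ᶠ ε in 𝓝[>] (0 : ℝ), P ε ∈ Matrix.rowStochastic ℝ X)
    (hν : ∀ᶠ ε in 𝓝[>] (0 : ℝ), IsSubStationary (P ε) (ν ε)) {L : Set X} {x y : X}
    (hx : x ∈ L) (hy : y ∉ L) :
    (fun ε => ν ε x * P ε x y) =O[𝓝[>] 0] outflow P ν L := by
  classical
  refine isBigO_of_eventually_le ?_ ?_
  · filter_upwards [hP, hν] with ε h1 h2
    exact mul_nonneg (h2.nonneg x) (Matrix.nonneg_of_mem_rowStochastic h1)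
  · filter_upwards [hP, hν] with ε h1 h2
    have hnn : ∀ a b, 0 ≤ if a ∈ L ∧ b ∉ L then ν ε a * P ε a b else 0 := by
      intro a b
      split_ifs
      · exact mul_nonneg (h2.nonneg a) (Matrix.nonneg_of_mem_rowStochastic h1)
      · exact le_rfl
    have e1 := Finset.single_le_sum
      (f := fun a => ∑ b, if a ∈ L ∧ b ∉ L then ν ε a * P ε a b else 0)
      (fun a _ => Finset.sum_nonneg fun b _ => hnn a b) (Finset.mem_univ x)
    have e2 := Finset.single_le_sum (f := fun b => if x ∈ L ∧ b ∉ L then ν ε x * P ε x b else 0)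
      (fun b _ => hnn x b) (Finset.mem_univ y)
    simp only [hx, hy, not_false_eq_true, and_self, if_true] at e2
    exact e2.trans (by simpa only [outflow, hx, true_and] using e1)

open Classical in
/-- For a stationary measure the flows out of and into a set agree. -/
theorem outflow_eq_sum_inflow {ε : ℝ} (hP : P ε ∈ Matrix.rowStochastic ℝ X)
    (hν : IsSubStationary (P ε) (ν ε)) (L : Set X) :
    outflow P ν L ε = ∑ x, ∑ y, if x ∉ L ∧ y ∈ L then ν ε x * P ε x y else 0 := by
  have h1 : ∀ x, ∑ y, P ε x y = 1 := fun x => Matrix.sum_row_of_mem_rowStochastic hP x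
  have hs : ∀ y, ∑ x, ν ε x * P ε x y = ν ε y := fun y => congrFun hν.stat y
  have e1 : ∑ x, ∑ y, (if x ∈ L then ν ε x * P ε x y else 0) = ∑ x, if x ∈ L then ν ε x else 0 := by
    refine Finset.sum_congr rfl fun x _ => ?_
    split_ifs
    · rw [← Finset.mul_sum, h1, mul_one]
    · simp
  have e2 : ∑ x, ∑ y, (if y ∈ L then ν ε x * P ε x y else 0) = ∑ y, if y ∈ L then ν ε y else 0 := by
    rw [Finset.sum_comm]
    refine Finset.sum_congr rfl fun y _ => ?_
    split_ifs
    · exact hs y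
    · simp
  have e3 : ∑ x, ∑ y, (if x ∈ L then ν ε x * P ε x y else 0) +
      ∑ x, ∑ y, (if x ∉ L ∧ y ∈ L then ν ε x * P ε x y else 0) =
      ∑ x, ∑ y, (if y ∈ L then ν ε x * P ε x y else 0) + outflow P ν L ε := by
    unfold outflow
    rw [← Finset.sum_add_distrib, ← Finset.sum_add_distrib]
    refine Finset.sum_congr rfl fun x _ => ?_
    rw [← Finset.sum_add_distrib, ← Finset.sum_add_distrib]
    refine Finset.sum_congr rfl fun y _ => ?_
    by_cases hx : x ∈ L <;> by_cases hy : y ∈ L <;> simp [hx, hy]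
  linarith

/-- A set is left as often as it is entered. The bounds on masses below come from choosing a set
whose entrances are easier to control than its exits. -/
theorem outflow_isBigO_of_inflow (hP : ∀ᶠ ε in 𝓝[>] (0 : ℝ), P ε ∈ Matrix.rowStochastic ℝ X)
    (hν : ∀ᶠ ε in 𝓝[>] (0 : ℝ), IsSubStationary (P ε) (ν ε)) {L : Set X} {w : ℝ → ℝ}
    (h : ∀ x ∉ L, ∀ y ∈ L, (fun ε => ν ε x * P ε x y) =O[𝓝[>] 0] w) :
    outflow P ν L =O[𝓝[>] 0] w := by
  classical
  have e : outflow P ν L =ᶠ[𝓝[>] 0]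
      fun ε => ∑ x, ∑ y, if x ∉ L ∧ y ∈ L then ν ε x * P ε x y else 0 := by
    filter_upwards [hP, hν] with ε h1 h2 using outflow_eq_sum_inflow h1 h2 L
  refine e.trans_isBigO ?_
  refine IsBigO.fun_sum fun x _ => IsBigO.fun_sum fun y _ => ?_
  by_cases hxy : x ∉ L ∧ y ∈ L
  · simpa only [hxy, not_false_eq_true, and_self, if_true] using h x hxy.1 y hxy.2
  · simpa only [hxy, if_false] using isBigO_zero _ _

theorem eventually_exists_pos_of_isBigO (hP : ∀ᶠ ε in 𝓝[>] (0 : ℝ), P ε ∈ Matrix.rowStochastic ℝ X)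
    {z : X} {T : Set X} {q : ℝ}
    (hT : (fun ε : ℝ => ε ^ q) =O[𝓝[>] 0] fun ε => ∑ y, T.indicator (P ε z) y) :
    ∀ᶠ ε in 𝓝[>] (0 : ℝ), ∃ y ∈ T, 0 < P ε z y := by
  obtain ⟨c, hc⟩ := hT.bound
  filter_upwards [hc, hP, self_mem_nhdsWithin] with ε h1 h2 h3
  by_contra! hcon
  have hz : ∑ y, T.indicator (P ε z) y = 0 := by
    refine Finset.sum_eq_zero fun y _ => ?_
    by_cases hy : y ∈ T
    · rw [Set.indicator_of_mem hy]
      exact le_antisymm (hcon y hy) (Matrix.nonneg_of_mem_rowStochastic h2)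
    · exact Set.indicator_of_notMem hy _
  rw [hz, norm_zero, mul_zero, norm_le_zero_iff] at h1
  exact (Real.rpow_pos_of_pos h3 q).ne' h1

/-- The qualitative content of an escape at a fixed small ε. It is needed for reachability and
transience, where orders of magnitude play no role. -/
theorem Escapes.exists_path (hP : ∀ᶠ ε in 𝓝[>] (0 : ℝ), P ε ∈ Matrix.rowStochastic ℝ X)
    {L : Set X} {r : ℝ} {z : X} (h : Escapes P L r z) (hz : z ∈ L) :
    ∀ᶠ ε in 𝓝[>] (0 : ℝ), ∃ k, ∃ z' ∈ L, ∃ y ∉ L, 0 < (P ε ^ k) z z' ∧ 0 < P ε z' y := by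
  induction h with
  | @step z q r T hr hT h ih =>
    have hall : ∀ᶠ ε in 𝓝[>] (0 : ℝ), ∀ y, y ∈ T → y ∈ L →
        ∃ k, ∃ z' ∈ L, ∃ y' ∉ L, 0 < (P ε ^ k) y z' ∧ 0 < P ε z' y' := by
      refine Filter.eventually_all.2 fun y => ?_
      by_cases hy : y ∈ T ∧ y ∈ L
      · filter_upwards [ih y hy.1 hy.2 hy.2] with ε hε _ _ using hε
      · exact Filter.Eventually.of_forall fun ε h1 h2 => absurd ⟨h1, h2⟩ hy
    filter_upwards [hall, hP, eventually_exists_pos_of_isBigO hP hT] with ε h1 h2 h3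
    obtain ⟨y, hyT, hy⟩ := h3
    by_cases hyL : y ∈ L
    · obtain ⟨k, z', hz', y', hy', hk, hzy⟩ := h1 y hyT hyL
      exact ⟨1 + k, z', hz', y', hy', pow_add_pos h2 (by simpa using hy) hk, hzy⟩
    · exact ⟨0, z, hz, y, hyL, by simp, hy⟩

/-- A state that leaves `L` at resistance `r` has mass at most the outflow of `L` over `ε ^ r`. -/
theorem Escapes.mul_rpow_isBigO (hP : ∀ᶠ ε in 𝓝[>] (0 : ℝ), P ε ∈ Matrix.rowStochastic ℝ X)
    (hν : ∀ᶠ ε in 𝓝[>] (0 : ℝ), IsSubStationary (P ε) (ν ε))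
    {L : Set X} {r : ℝ} {z : X} (h : Escapes P L r z) (hz : z ∈ L) :
    (fun ε => ν ε z * ε ^ r) =O[𝓝[>] 0] outflow P ν L := by
  induction h with
  | @step z q r T hr hT h ih =>
    have hr1 : (fun ε : ℝ => ε ^ r) =O[𝓝[>] 0] fun _ => (1 : ℝ) := by
      simpa using rpow_isBigO_rpow (s := r) (t := 0) hr
    have e : (fun ε : ℝ => ν ε z * ε ^ (q + r)) =ᶠ[𝓝[>] 0]
        fun ε => ν ε z * ε ^ q * ε ^ r := by
      filter_upwards [self_mem_nhdsWithin] with ε hε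
      rw [Real.rpow_add hε, mul_assoc]
    refine e.trans_isBigO ?_
    have h1 : (fun ε : ℝ => ν ε z * ε ^ q * ε ^ r) =O[𝓝[>] 0]
        fun ε => ∑ y, T.indicator (fun y => ν ε z * P ε z y * ε ^ r) y := by
      refine (((isBigO_refl (fun ε => ν ε z) _).mul hT).mul (isBigO_refl _ _)).congr_right
        fun ε => ?_
      rw [Finset.mul_sum, Finset.sum_mul]
      refine Finset.sum_congr rfl fun y _ => ?_
      by_cases hy : y ∈ T <;> simp [hy]
    refine h1.trans (IsBigO.fun_sum fun y _ => ?_)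
    by_cases hy : y ∈ T
    · simp only [Set.indicator_of_mem hy]
      -- If `y` is still in `L`, stationarity gives `ν z * P z y ≤ ν y` and the induction applies to
      -- `y`. Otherwise this flow is part of the outflow, and `ε ^ r` is bounded.
      by_cases hyL : y ∈ L
      · exact ((flow_isBigO_target hP hν z y).mul (isBigO_refl _ _)).trans (ih y hy hyL hyL)
      · simpa using (flow_isBigO_outflow hP hν hz hyL).mul hr1
    · simpa only [Set.indicator_of_notMem hy] using isBigO_zero _ _

end Flow


/-! ### Concentration and anticoncentration of sample averages -/

section Averages

open MeasureTheory ProbabilityTheory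

/-- A centred sub-Gaussian variable whose variance is comparable to its sub-Gaussian parameter is
nonnegative with probability bounded below. -/
theorem HasSubgaussianMGF.le_measureReal_nonneg {Ω : Type*} [MeasurableSpace Ω] {μ : Measure Ω}
    [IsProbabilityMeasure μ] {Z : Ω → ℝ} {c : NNReal} {n s : ℝ} (hn : 0 < n)
    (hc : (c : ℝ) = n / 4) (hZ : HasSubgaussianMGF Z c μ) (h1 : ∫ ω, Z ω ∂μ = 0)
    (h2 : ∫ ω, Z ω ^ 2 ∂μ = n * s) (hs : 0 < s) :
    s ^ 2 / 768 ≤ μ.real {ω | 0 ≤ Z ω} := by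
  set t : ℝ := 1 / √n with ht
  have ht2 : t ^ 2 = 1 / n := by rw [ht, div_pow, Real.sq_sqrt hn.le, one_pow]
  have hexp : ∀ r : ℝ, r ^ 2 = 1 / n → ∫ ω, Real.exp (r * Z ω) ∂μ ≤ 2 := by
    intro r hr
    refine (hZ.mgf_le r).trans ?_
    rw [hc, hr]
    have e : n / 4 * (1 / n) / 2 = 1 / 8 := by field_simp; norm_num
    rw [e]
    have := Real.exp_one_lt_d9
    have h8 : Real.exp (1 / 8) ^ 8 = Real.exp 1 := by
      rw [← Real.exp_nat_mul]; norm_num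
    by_contra! hlt
    have : (2 : ℝ) ^ 8 < Real.exp (1 / 8) ^ 8 := by gcongr
    rw [h8] at this
    linarith
  have hpt : ∀ z : ℝ, z ^ 4 ≤ 24 * n ^ 2 * (Real.exp (t * z) + Real.exp (-t * z)) := by
    intro z
    have h3 := Real.pow_div_factorial_le_exp (x := |t * z|) (abs_nonneg _) 4
    have h4 : Real.exp |t * z| ≤ Real.exp (t * z) + Real.exp (-t * z) := by
      rcases abs_cases (t * z) with ⟨h, _⟩ | ⟨h, _⟩ <;> rw [h]
      · linarith [Real.exp_pos (-t * z)]
      · rw [← neg_mul]; linarith [Real.exp_pos (t * z)]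
    have h5 : |t * z| ^ 4 = z ^ 4 / n ^ 2 := by
      rw [show (4 : ℕ) = 2 * 2 from rfl, pow_mul, sq_abs, mul_pow, ht2]
      field_simp
    rw [h5, show ((4 : ℕ).factorial : ℝ) = 24 by norm_num [Nat.factorial], div_div,
      div_le_iff₀ (by positivity)] at h3
    have : 0 < n ^ 2 := by positivity
    nlinarith
  have hi1 : Integrable (fun ω => Real.exp (t * Z ω) + Real.exp (-t * Z ω)) μ :=
    (hZ.integrable_exp_mul t).add (hZ.integrable_exp_mul (-t))
  have hi4 : Integrable (fun ω => Z ω ^ 4) μ := by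
    refine (hi1.const_mul (24 * n ^ 2)).mono' (hZ.aestronglyMeasurable.pow 4)
      (Filter.Eventually.of_forall fun ω => ?_)
    rw [Real.norm_of_nonneg (by positivity)]
    exact hpt _
  have h4 : ∫ ω, Z ω ^ 4 ∂μ ≤ 96 * n ^ 2 := by
    refine (integral_mono hi4 (hi1.const_mul (24 * n ^ 2)) fun ω => hpt _).trans ?_
    rw [integral_const_mul, integral_add (hZ.integrable_exp_mul t) (hZ.integrable_exp_mul (-t))]
    have a1 := hexp t ht2
    have a2 := hexp (-t) (by rw [neg_sq, ht2])
    have : 0 < n ^ 2 := by positivity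
    nlinarith
  have hi2 : Integrable (fun ω => Z ω ^ 2) μ := by
    have := (hZ.memLp 2).integrable_sq
    simpa using this
  -- The scaling `b ^ 2 = 1 / (Q * n)` turns the gain from the variance into `s / Q` and the loss
  -- from the fourth moment into at most `96 / Q ^ 2`. This choice of `Q` maximizes the difference,
  -- with value `s ^ 2 / 384`.
  set Q : ℝ := 192 / s with hQ
  have hQ0 : 0 < Q := by positivity
  set b : ℝ := 1 / √(Q * n) with hb
  have hb2 : b ^ 2 = 1 / (Q * n) := by
    rw [hb, div_pow, Real.sq_sqrt (by positivity), one_pow]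
  -- A polynomial minorant of twice the indicator of the nonnegative half-line. Its linear term has
  -- mean zero, so its expectation involves only the second and fourth moments.
  have hpoly : ∀ y : ℝ, y + y ^ 2 - y ^ 4 ≤ 2 * (if 0 ≤ y then 1 else 0) := by
    intro y
    split_ifs with hy
    · rcases le_total y 1 with h | h
      · nlinarith [sq_nonneg (y ^ 2 - 1 / 2)]
      · nlinarith [sq_nonneg (y ^ 2 - 1)]
    · push Not at hy
      rcases le_total (-1) y with h | h
      · nlinarith [sq_nonneg (y ^ 2)]
      · nlinarith [sq_nonneg (y ^ 2 - 1)]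
  have hmeas : NullMeasurableSet {ω | 0 ≤ Z ω} μ :=
    nullMeasurableSet_le aemeasurable_const hZ.aemeasurable
  have hkey : ∫ ω, (b * Z ω + (b * Z ω) ^ 2 - (b * Z ω) ^ 4) ∂μ ≤ 2 * μ.real {ω | 0 ≤ Z ω} := by
    have hb0 : 0 < b := by positivity
    have e : 2 * μ.real {ω | 0 ≤ Z ω} =
        ∫ ω, 2 * {ω | 0 ≤ Z ω}.indicator (fun _ => (1 : ℝ)) ω ∂μ := by
      rw [integral_const_mul, integral_indicator₀ hmeas]
      simp
    rw [e]
    refine integral_mono ?_ ?_ fun ω => ?_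
    · simp_rw [mul_pow]
      exact ((hZ.integrable.const_mul b).add (hi2.const_mul _)).sub (hi4.const_mul _)
    · exact ((integrable_const 1).indicator₀ hmeas).const_mul 2
    · refine (hpoly (b * Z ω)).trans (le_of_eq ?_)
      simp [Set.indicator, mul_nonneg_iff_of_pos_left hb0]
  have hval : ∫ ω, (b * Z ω + (b * Z ω) ^ 2 - (b * Z ω) ^ 4) ∂μ =
      b * 0 + b ^ 2 * (n * s) - b ^ 4 * ∫ ω, Z ω ^ 4 ∂μ := by
    simp_rw [mul_pow]
    have hA : Integrable (fun ω => b * Z ω + b ^ 2 * Z ω ^ 2) μ :=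
      (hZ.integrable.const_mul b).add (hi2.const_mul _)
    rw [integral_sub hA (hi4.const_mul _),
      integral_add (hZ.integrable.const_mul b) (hi2.const_mul _), integral_const_mul,
      integral_const_mul, integral_const_mul, h1, h2]
  rw [hval] at hkey
  have hb4 : b ^ 4 = 1 / (Q * n) ^ 2 := by
    rw [show (4 : ℕ) = 2 * 2 from rfl, pow_mul, hb2, div_pow, one_pow]
  have h6 : b ^ 4 * ∫ ω, Z ω ^ 4 ∂μ ≤ 96 / Q ^ 2 := by
    refine (mul_le_mul_of_nonneg_left h4 (by positivity)).trans (le_of_eq ?_)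
    rw [hb4]
    field_simp
  have h7 : b ^ 2 * (n * s) = s / Q := by rw [hb2]; field_simp
  have h8 : s / Q - 96 / Q ^ 2 = s ^ 2 / 384 := by rw [hQ]; field_simp; norm_num
  rw [h7] at hkey
  linarith

variable {ρ : Measure ℝ} [IsProbabilityMeasure ρ]

/-- Hoeffding's lemma for each coordinate of the product measure, and additivity of the sub-Gaussian
parameter under independence. -/
theorem hasSubgaussianMGF_sum_centred (hρ : ∀ᵐ u ∂ρ, u ∈ Set.Icc (0 : ℝ) 1) (τ : ℕ) :
    HasSubgaussianMGF (fun s : Fin τ → ℝ => ∑ k, (s k - ∫ u, u ∂ρ))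
      (∑ _k : Fin τ, (‖(1 : ℝ) - 0‖₊ / 2) ^ 2) (Measure.pi fun _ : Fin τ => ρ) := by
  have h0 := hasSubgaussianMGF_of_mem_Icc (X := fun u : ℝ => u) (μ := ρ) aemeasurable_id hρ
  refine HasSubgaussianMGF.sum_of_iIndepFun (X := fun (k : Fin τ) (s : Fin τ → ℝ) =>
    s k - ∫ u, u ∂ρ) ?_ fun k _ => ?_
  · exact iIndepFun_pi (X := fun (_ : Fin τ) (u : ℝ) => u - ∫ u, u ∂ρ)
      fun k => (measurable_id.sub_const _).aemeasurable
  · have hmp := measurePreserving_eval (fun _ : Fin τ => ρ) k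
    rw [← hmp.map_eq] at h0
    have := HasSubgaussianMGF.of_map hmp.measurable.aemeasurable h0
    rwa [hmp.map_eq] at this

theorem coe_sum_hoeffding_parameter (τ : ℕ) :
    ((∑ _k : Fin τ, (‖(1 : ℝ) - 0‖₊ / 2) ^ 2 : NNReal) : ℝ) = τ / 4 := by
  simp
  ring

theorem measureReal_average_ge (hρ : ∀ᵐ u ∂ρ, u ∈ Set.Icc (0 : ℝ) 1) {τ : ℕ} (hτ : 0 < τ)
    {t : ℝ} (ht : 0 ≤ t) :
    (Measure.pi fun _ : Fin τ => ρ).real {s | ∫ u, u ∂ρ + t ≤ (∑ k, s k) / τ} ≤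
      Real.exp (-2 * τ * t ^ 2) := by
  have hτ' : (0 : ℝ) < τ := by exact_mod_cast hτ
  have h := (hasSubgaussianMGF_sum_centred hρ τ).measure_ge_le (ε := τ * t) (by positivity)
  rw [coe_sum_hoeffding_parameter] at h
  have e : -(τ * t) ^ 2 / (2 * (τ / 4)) = -2 * τ * t ^ 2 := by field_simp; norm_num
  rw [e] at h
  refine le_trans (le_of_eq ?_) h
  congr 1
  ext s
  simp only [Set.mem_ofPred_eq, Finset.sum_sub_distrib, Finset.sum_const, Finset.card_univ,
    Fintype.card_fin, nsmul_eq_mul]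
  rw [le_div_iff₀ hτ']
  constructor <;> intro h <;> linarith

theorem measureReal_average_le (hρ : ∀ᵐ u ∂ρ, u ∈ Set.Icc (0 : ℝ) 1) {τ : ℕ} (hτ : 0 < τ)
    {t : ℝ} (ht : 0 ≤ t) :
    (Measure.pi fun _ : Fin τ => ρ).real {s | (∑ k, s k) / τ ≤ ∫ u, u ∂ρ - t} ≤
      Real.exp (-2 * τ * t ^ 2) := by
  have hτ' : (0 : ℝ) < τ := by exact_mod_cast hτ
  have h := (hasSubgaussianMGF_sum_centred hρ τ).neg.measure_ge_le (ε := τ * t) (by positivity)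
  rw [coe_sum_hoeffding_parameter] at h
  have e : -(τ * t) ^ 2 / (2 * (τ / 4)) = -2 * τ * t ^ 2 := by field_simp; norm_num
  rw [e] at h
  refine le_trans (le_of_eq ?_) h
  congr 1
  ext s
  simp only [Set.mem_ofPred_eq, Finset.sum_sub_distrib, Finset.sum_const, Finset.card_univ,
    Fintype.card_fin, nsmul_eq_mul, Pi.neg_apply]
  rw [div_le_iff₀ hτ']
  constructor <;> intro h <;> linarith

/-- The average of i.i.d. samples in `[0,1]` is at least (at most) the mean with a probability
bounded below uniformly in the number of samples. -/
theorem exists_le_measureReal_average (hρ : ∀ᵐ u ∂ρ, u ∈ Set.Icc (0 : ℝ) 1) :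
    ∃ c : ℝ, 0 < c ∧ ∀ τ : ℕ, 0 < τ →
      c ≤ (Measure.pi fun _ : Fin τ => ρ).real {s | ∫ u, u ∂ρ ≤ (∑ k, s k) / τ} ∧
      c ≤ (Measure.pi fun _ : Fin τ => ρ).real {s | (∑ k, s k) / τ ≤ ∫ u, u ∂ρ} := by
  set M := ∫ u, u ∂ρ with hM
  have hL2 : MemLp (fun u : ℝ => u) 2 ρ := memLp_of_bounded hρ aestronglyMeasurable_id 2
  have hev1 : ∀ {τ : ℕ}, 0 < τ → {s : Fin τ → ℝ | M ≤ (∑ k, s k) / τ} =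
      {s | 0 ≤ ∑ k, (s k - M)} := by
    intro τ hτ
    have hτ' : (0 : ℝ) < τ := by exact_mod_cast hτ
    ext s
    simp only [Set.mem_ofPred_eq, Finset.sum_sub_distrib, Finset.sum_const, Finset.card_univ,
      Fintype.card_fin, nsmul_eq_mul]
    rw [le_div_iff₀ hτ']
    constructor <;> intro h <;> linarith
  have hev2 : ∀ {τ : ℕ}, 0 < τ → {s : Fin τ → ℝ | (∑ k, s k) / τ ≤ M} =
      {s | 0 ≤ (-fun s : Fin τ → ℝ => ∑ k, (s k - M)) s} := by
    intro τ hτ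
    have hτ' : (0 : ℝ) < τ := by exact_mod_cast hτ
    ext s
    simp only [Set.mem_ofPred_eq, Finset.sum_sub_distrib, Finset.sum_const, Finset.card_univ,
      Fintype.card_fin, nsmul_eq_mul, Pi.neg_apply]
    rw [div_le_iff₀ hτ']
    constructor <;> intro h <;> linarith
  have hL2' : MemLp (fun u : ℝ => u - M) 2 ρ := hL2.sub (memLp_const M)
  have hint : Integrable (fun u : ℝ => u - M) ρ := hL2'.integrable (by norm_num)
  have hcent : ∫ u, (u - M) ∂ρ = 0 := by
    rw [integral_sub (hL2.integrable (by norm_num)) (integrable_const _)]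
    simp [hM]
  have hmean : ∀ τ : ℕ, ∫ s, ∑ k, (s k - M) ∂(Measure.pi fun _ : Fin τ => ρ) = 0 := by
    intro τ
    rw [integral_finsetSum _ fun k _ =>
      integrable_comp_eval (μ := fun _ : Fin τ => ρ) (f := fun u : ℝ => u - M) hint]
    refine Finset.sum_eq_zero fun k _ => ?_
    rw [integral_comp_eval (μ := fun _ : Fin τ => ρ) (f := fun u : ℝ => u - M)
      hint.aestronglyMeasurable, hcent]
  set V := variance (fun u : ℝ => u - M) ρ with hV
  have hvar : ∀ τ : ℕ, ∫ s, (∑ k, (s k - M)) ^ 2 ∂(Measure.pi fun _ : Fin τ => ρ) = τ * V := by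
    intro τ
    have h1 := variance_sum_pi (μ := fun _ : Fin τ => ρ) (X := fun _ (u : ℝ) => u - M)
      fun _ => hL2'
    rw [show (∑ i : Fin τ, fun ω : Fin τ → ℝ => ω i - M) = fun ω => ∑ k, (ω k - M) by
      ext; simp] at h1
    rw [variance_of_integral_eq_zero _ (hmean τ)] at h1
    · simpa using h1
    · exact (Finset.measurable_fun_sum _ fun k _ => (measurable_pi_apply k).sub_const _).aemeasurable
  -- With zero variance all samples equal the mean almost surely. Otherwise the variance `τ * V` of
  -- the sum is comparable to its sub-Gaussian parameter `τ / 4`, uniformly in `τ`.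
  rcases (variance_nonneg (fun u : ℝ => u - M) ρ).eq_or_lt with h0 | h0
  · refine ⟨1, one_pos, fun τ hτ => ?_⟩
    have hae : ∀ᵐ u ∂ρ, u = M := by
      have h0' : ∫ u, (u - M) ^ 2 ∂ρ = 0 := by
        rw [variance_of_integral_eq_zero hint.aemeasurable hcent] at h0
        exact h0.symm
      rw [integral_eq_zero_iff_of_nonneg (fun u => sq_nonneg _) hL2'.integrable_sq] at h0'
      filter_upwards [h0'] with u hu
      have : (u - M) ^ 2 = 0 := hu
      nlinarith [sq_eq_zero_iff.1 this]
    have hall : ∀ᵐ s ∂(Measure.pi fun _ : Fin τ => ρ), ∀ k, s k = M := by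
      rw [ae_all_iff]
      intro k
      exact (measurePreserving_eval (fun _ : Fin τ => ρ) k).quasiMeasurePreserving.ae hae
    have hτ' : (τ : ℝ) ≠ 0 := by exact_mod_cast hτ.ne'
    have hone : ∀ S : Set (Fin τ → ℝ), (∀ s, (∀ k, s k = M) → s ∈ S) →
        1 ≤ (Measure.pi fun _ : Fin τ => ρ).real S := by
      intro S hS
      have : S ∈ ae (Measure.pi fun _ : Fin τ => ρ) := hall.mono fun s hs => hS s hs
      rw [measureReal_congr (Filter.eventuallyEq_univ.2 this), probReal_univ]
    have havg : ∀ s : Fin τ → ℝ, (∀ k, s k = M) → (∑ k, s k) / τ = M := by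
      intro s hs
      simp [hs, hτ']
    exact ⟨hone _ fun s hs => (havg s hs).ge, hone _ fun s hs => (havg s hs).le⟩
  · refine ⟨V ^ 2 / 768, by positivity, fun τ hτ => ?_⟩
    have hτ' : (0 : ℝ) < τ := by exact_mod_cast hτ
    have hsub := hasSubgaussianMGF_sum_centred hρ τ
    refine ⟨?_, ?_⟩
    · rw [hev1 hτ]
      exact HasSubgaussianMGF.le_measureReal_nonneg hτ' (coe_sum_hoeffding_parameter τ) hsub
        (hmean τ) (hvar τ) h0
    · rw [hev2 hτ]
      refine HasSubgaussianMGF.le_measureReal_nonneg hτ' (coe_sum_hoeffding_parameter τ) hsub.neg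
        ?_ ?_ h0
      · simp only [Pi.neg_apply, integral_neg]
        rw [hmean, neg_zero]
      · simp only [Pi.neg_apply, neg_sq]
        exact hvar τ

end Averages


/-! ### Observed bins -/

namespace RitelParams

variable (p : RitelParams)

theorem δ_pos : 0 < p.δ := by
  have : (0 : ℝ) < p.K := by exact_mod_cast p.K_pos
  unfold δ
  positivity

theorem K_mul_δ : (p.K : ℝ) * p.δ = 1 := by
  have : (0 : ℝ) < p.K := by exact_mod_cast p.K_pos
  unfold δ
  field_simp

theorem lower_mem (v : p.Bin) : p.lower v ∈ Set.Icc (0 : ℝ) 1 := by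
  have hδ := p.δ_pos
  refine ⟨by unfold lower; positivity, ?_⟩
  rw [← p.K_mul_δ]
  have : ((v : ℕ) : ℝ) ≤ p.K := by exact_mod_cast Nat.lt_succ_iff.1 v.2
  unfold lower
  gcongr

theorem lower_lt_lower {v w : p.Bin} (h : (v : ℕ) < w) : p.lower v < p.lower w := by
  have hδ := p.δ_pos
  have : ((v : ℕ) : ℝ) < (w : ℕ) := by exact_mod_cast h
  unfold lower
  gcongr

theorem lower_add_le {v w : p.Bin} {m : ℕ} (h : (v : ℕ) + m ≤ w) :
    p.lower v + m * p.δ ≤ p.lower w := by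
  have hδ := p.δ_pos
  have : ((v : ℕ) : ℝ) + m ≤ (w : ℕ) := by exact_mod_cast h
  unfold lower
  nlinarith

theorem add_lt_of_lower_lt {v w : p.Bin} {m : ℕ} (h : p.lower v + m * p.δ < p.lower w) :
    (v : ℕ) + m < w := by
  have hδ := p.δ_pos
  unfold lower at h
  have : ((v : ℕ) : ℝ) + m < (w : ℕ) := by
    by_contra! hc
    nlinarith
  exact_mod_cast this

theorem bin_mono {u u' : ℝ} (h : u ≤ u') : p.bin u ≤ p.bin u' := by
  have hδ := p.δ_pos
  rw [Fin.le_def]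
  exact min_le_min_right _ (Nat.floor_mono (by gcongr))

theorem lower_bin_le {u : ℝ} (hu : 0 ≤ u) : p.lower (p.bin u) ≤ u := by
  have hδ := p.δ_pos
  have h1 : (((p.bin u : p.Bin) : ℕ) : ℝ) ≤ u / p.δ :=
    le_trans (by exact_mod_cast min_le_left _ _) (Nat.floor_le (by positivity))
  unfold lower
  rwa [← le_div_iff₀ hδ]

/-- A negative `u` has natural floor zero and falls into the bottom bin, whose lower edge is not
positive. Thus no sign condition on `u` is needed. -/
theorem lower_le_of_bin_eq {u : ℝ} {v : p.Bin} (h : p.bin u = v) (hv : 0 < p.lower v) :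
    p.lower v ≤ u := by
  have hδ := p.δ_pos
  rcases le_or_gt 0 u with hu | hu
  · rw [← h]; exact p.lower_bin_le hu
  · exfalso
    have h1 : ⌊u / p.δ⌋₊ = 0 := Nat.floor_of_nonpos (div_nonpos_of_nonpos_of_nonneg hu.le hδ.le)
    rw [← h] at hv
    simp [lower, bin, h1] at hv

theorem lt_of_bin_eq {u : ℝ} {v : p.Bin} (h : p.bin u = v) (hv : (v : ℕ) < p.K) :
    u < p.lower v + p.δ := by
  have hδ := p.δ_pos
  have h1 : (v : ℕ) = ⌊u / p.δ⌋₊ := by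
    have h2 : min ⌊u / p.δ⌋₊ p.K = (v : ℕ) := congrArg Fin.val h
    omega
  have h3 := Nat.lt_floor_add_one (u / p.δ)
  rw [← h1, div_lt_iff₀ hδ] at h3
  unfold lower
  linarith

theorem val_lt_of_lower_lt_one {v : p.Bin} (h : p.lower v < 1) : (v : ℕ) < p.K := by
  have hδ := p.δ_pos
  rw [← p.K_mul_δ] at h
  unfold lower at h
  have : ((v : ℕ) : ℝ) < p.K := lt_of_mul_lt_mul_right h hδ.le
  exact_mod_cast this

theorem period_pos {ε : ℝ} (h0 : 0 < ε) (h1 : ε < 1) : 0 < p.period ε :=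
  Nat.ceil_pos.2 (mul_pos p.τ₀_pos (Real.log_pos (by rw [lt_div_iff₀ h0]; linarith)))

theorem tendsto_period : Filter.Tendsto p.period (𝓝[>] 0) Filter.atTop := by
  have h1 : Filter.Tendsto (fun ε : ℝ => p.τ₀ * Real.log (1 / ε)) (𝓝[>] 0) Filter.atTop := by
    refine Filter.Tendsto.const_mul_atTop p.τ₀_pos ?_
    simp only [one_div]
    exact Real.tendsto_log_atTop.comp tendsto_inv_nhdsGT_zero
  exact tendsto_nat_ceil_atTop.comp h1

/-- Under the noise condition a deviation by `δ` has the probability of an experiment. -/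
theorem exp_period_le (hnoise : 1 ≤ 2 * p.τ₀ * p.δ ^ 2) {ε : ℝ} (h0 : 0 < ε) (h1 : ε < 1) :
    Real.exp (-2 * p.period ε * p.δ ^ 2) ≤ ε := by
  have hlog : 0 < Real.log (1 / ε) := Real.log_pos (by rw [lt_div_iff₀ h0]; linarith)
  have h2 : p.τ₀ * Real.log (1 / ε) ≤ p.period ε := Nat.le_ceil _
  have h3 : Real.log (1 / ε) ≤ 2 * p.period ε * p.δ ^ 2 := by
    have : 0 ≤ p.δ ^ 2 := sq_nonneg _
    nlinarith
  calc _ ≤ Real.exp (-Real.log (1 / ε)) := Real.exp_le_exp.2 (by linarith)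
    _ = ε := by rw [Real.exp_neg, Real.exp_log (by positivity)]; simp

end RitelParams

/-! ### Distribution of the observed bins -/

namespace RandomGame

open Asymptotics MeasureTheory

variable {I : Type*} {A : I → Type*} (g : RandomGame I A) (p : RitelParams)

theorem mean_mem (i : I) (a : ∀ i, A i) : g.mean i a ∈ Set.Icc (0 : ℝ) 1 := by
  have := g.isProb i a
  have hi : Integrable (fun u : ℝ => u) (g.law i a) :=
    (memLp_of_bounded (g.support i a) aestronglyMeasurable_id 1).integrable le_rfl
  refine ⟨integral_nonneg_of_ae ((g.support i a).mono fun u hu => hu.1), ?_⟩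
  calc g.mean i a ≤ ∫ _, (1 : ℝ) ∂(g.law i a) :=
        integral_mono_ae hi (integrable_const _) ((g.support i a).mono fun u hu => hu.2)
    _ = 1 := by simp

theorem measurable_bin_average (τ : ℕ) :
    Measurable fun s : Fin τ → ℝ => p.bin ((∑ k, s k) / τ) := by
  have : Measurable p.bin := by
    have h1 : Measurable fun u : ℝ => ⌊u / p.δ⌋₊ :=
      Nat.measurable_floor.comp (measurable_id.div_const _)
    exact (measurable_from_top (f := fun n : ℕ => (⟨min n p.K, by omega⟩ : p.Bin))).comp h1
  exact this.comp (by fun_prop)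

/-- Probability that the observed bin lies in `V`. -/
def obsSetProb (τ : ℕ) (i : I) (a : ∀ i, A i) (V : Set p.Bin) : ℝ :=
  (Measure.pi fun _ : Fin τ => g.law i a).real {s | p.bin ((∑ k, s k) / τ) ∈ V}

theorem sum_indicator_obsProb (τ : ℕ) (i : I) (a : ∀ i, A i) (V : Set p.Bin) :
    ∑ v, V.indicator (g.obsProb p τ i a) v = g.obsSetProb p τ i a V := by
  classical
  have := g.isProb i a
  have hm := measurable_bin_average p τ
  have h := MeasureTheory.sum_measureReal_singleton
    (μ := (Measure.pi fun _ : Fin τ => g.law i a).map fun s => p.bin ((∑ k, s k) / τ))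
    (Finset.univ.filter (· ∈ V))
  rw [map_measureReal_apply hm (Finset.measurableSet _)] at h
  have e : (fun s : Fin τ → ℝ => p.bin ((∑ k, s k) / τ)) ⁻¹' ↑(Finset.univ.filter (· ∈ V)) =
      {s | p.bin ((∑ k, s k) / τ) ∈ V} := by
    ext s
    simp
  rw [e] at h
  rw [obsSetProb, ← h, Finset.sum_filter]
  refine Finset.sum_congr rfl fun v _ => ?_
  rw [map_measureReal_apply hm (MeasurableSet.singleton v)]
  rfl

theorem obsProb_nonneg (τ : ℕ) (i : I) (a : ∀ i, A i) (v : p.Bin) : 0 ≤ g.obsProb p τ i a v :=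
  measureReal_nonneg

theorem obsSetProb_nonneg (τ : ℕ) (i : I) (a : ∀ i, A i) (V : Set p.Bin) :
    0 ≤ g.obsSetProb p τ i a V :=
  measureReal_nonneg

theorem obsSetProb_univ (τ : ℕ) (i : I) (a : ∀ i, A i) : g.obsSetProb p τ i a Set.univ = 1 := by
  have := g.isProb i a
  simp [obsSetProb]

theorem sum_obsProb (τ : ℕ) (i : I) (a : ∀ i, A i) : ∑ v, g.obsProb p τ i a v = 1 := by
  simpa [obsSetProb_univ] using g.sum_indicator_obsProb p τ i a Set.univ

theorem obsProb_le_one (τ : ℕ) (i : I) (a : ∀ i, A i) (v : p.Bin) : g.obsProb p τ i a v ≤ 1 := by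
  rw [← g.sum_obsProb p τ i a]
  exact Finset.single_le_sum (fun v _ => g.obsProb_nonneg p τ i a v) (Finset.mem_univ v)

theorem obsSetProb_mono (τ : ℕ) (i : I) (a : ∀ i, A i) {V W : Set p.Bin} (h : V ⊆ W) :
    g.obsSetProb p τ i a V ≤ g.obsSetProb p τ i a W := by
  have := g.isProb i a
  exact measureReal_mono fun s hs => h hs

theorem obsSetProb_union_le (τ : ℕ) (i : I) (a : ∀ i, A i) (V W : Set p.Bin) :
    g.obsSetProb p τ i a (V ∪ W) ≤ g.obsSetProb p τ i a V + g.obsSetProb p τ i a W :=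
  measureReal_union_le _ _

theorem obsProb_le_obsSetProb (τ : ℕ) (i : I) (a : ∀ i, A i) {V : Set p.Bin} {v : p.Bin}
    (h : v ∈ V) : g.obsProb p τ i a v ≤ g.obsSetProb p τ i a V := by
  rw [← sum_indicator_obsProb]
  have := Finset.single_le_sum (f := V.indicator (g.obsProb p τ i a))
    (fun v _ => Set.indicator_nonneg (fun v _ => g.obsProb_nonneg p τ i a v) v) (Finset.mem_univ v)
  rwa [Set.indicator_of_mem h] at this

theorem obsSetProb_high_le {τ : ℕ} (hτ : 0 < τ) (i : I) (a : ∀ i, A i) {t : ℝ} (ht : 0 < t) :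
    g.obsSetProb p τ i a {v | g.mean i a + t ≤ p.lower v} ≤ Real.exp (-2 * τ * t ^ 2) := by
  have := g.isProb i a
  refine le_trans (measureReal_mono fun s hs => ?_)
    (measureReal_average_ge (g.support i a) hτ ht.le)
  have hs' : g.mean i a + t ≤ p.lower (p.bin ((∑ k, s k) / τ)) := hs
  refine hs'.trans (p.lower_le_of_bin_eq rfl ?_)
  linarith [(g.mean_mem i a).1]

theorem obsSetProb_low_le {τ : ℕ} (hτ : 0 < τ) (i : I) (a : ∀ i, A i) {t : ℝ} (ht : 0 < t) :
    g.obsSetProb p τ i a {v | p.lower v + p.δ ≤ g.mean i a - t} ≤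
      Real.exp (-2 * τ * t ^ 2) := by
  have := g.isProb i a
  refine le_trans (measureReal_mono fun s hs => ?_)
    (measureReal_average_le (g.support i a) hτ ht.le)
  have hs' : p.lower (p.bin ((∑ k, s k) / τ)) + p.δ ≤ g.mean i a - t := hs
  refine le_trans (p.lt_of_bin_eq rfl (p.val_lt_of_lower_lt_one ?_)).le hs'
  linarith [(g.mean_mem i a).2, p.δ_pos]

/-- Anticoncentration transported by the monotone map `p.bin`. Concentration alone would not do: if
the mean is a bin edge, it does not tell on which side the average falls. -/
theorem exists_le_obsSetProb (i : I) (a : ∀ i, A i) :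
    ∃ c : ℝ, 0 < c ∧ ∀ τ : ℕ, 0 < τ →
      c ≤ g.obsSetProb p τ i a {v | p.bin (g.mean i a) ≤ v} ∧
      c ≤ g.obsSetProb p τ i a {v | v ≤ p.bin (g.mean i a)} := by
  have := g.isProb i a
  obtain ⟨c, hc, h⟩ := exists_le_measureReal_average (g.support i a)
  exact ⟨c, hc, fun τ hτ => ⟨(h τ hτ).1.trans (measureReal_mono fun s hs => p.bin_mono hs),
    (h τ hτ).2.trans (measureReal_mono fun s hs => p.bin_mono hs)⟩⟩

theorem one_isBigO_obsSetProb_ge (i : I) (a : ∀ i, A i) {V : Set p.Bin}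
    (hV : ∀ v, p.bin (g.mean i a) ≤ v → v ∈ V) :
    (fun _ : ℝ => (1 : ℝ)) =O[𝓝[>] 0] fun ε => g.obsSetProb p (p.period ε) i a V := by
  obtain ⟨c, hc, h⟩ := g.exists_le_obsSetProb p i a
  refine one_isBigO_of_le hc ?_
  filter_upwards [eventually_mem_Ioo] with ε hε
  exact (h _ (p.period_pos hε.1 hε.2)).1.trans (g.obsSetProb_mono p _ i a hV)

theorem one_isBigO_obsSetProb_le (i : I) (a : ∀ i, A i) {V : Set p.Bin}
    (hV : ∀ v, v ≤ p.bin (g.mean i a) → v ∈ V) :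
    (fun _ : ℝ => (1 : ℝ)) =O[𝓝[>] 0] fun ε => g.obsSetProb p (p.period ε) i a V := by
  obtain ⟨c, hc, h⟩ := g.exists_le_obsSetProb p i a
  refine one_isBigO_of_le hc ?_
  filter_upwards [eventually_mem_Ioo] with ε hε
  exact (h _ (p.period_pos hε.1 hε.2)).2.trans (g.obsSetProb_mono p _ i a hV)

variable {p}

theorem obsSetProb_high_le_eps (hnoise : 1 ≤ 2 * p.τ₀ * p.δ ^ 2) (i : I) (a : ∀ i, A i)
    {V : Set p.Bin} (hV : ∀ v ∈ V, g.mean i a + p.δ ≤ p.lower v) {ε : ℝ} (h0 : 0 < ε)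
    (h1 : ε < 1) : g.obsSetProb p (p.period ε) i a V ≤ ε :=
  (g.obsSetProb_mono p _ i a hV).trans
    ((g.obsSetProb_high_le p (p.period_pos h0 h1) i a p.δ_pos).trans (p.exp_period_le hnoise h0 h1))

theorem obsSetProb_low_le_eps (hnoise : 1 ≤ 2 * p.τ₀ * p.δ ^ 2) (i : I) (a : ∀ i, A i)
    {V : Set p.Bin} (hV : ∀ v ∈ V, p.lower v + p.δ ≤ g.mean i a - p.δ) {ε : ℝ} (h0 : 0 < ε)
    (h1 : ε < 1) : g.obsSetProb p (p.period ε) i a V ≤ ε :=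
  (g.obsSetProb_mono p _ i a hV).trans
    ((g.obsSetProb_low_le p (p.period_pos h0 h1) i a p.δ_pos).trans (p.exp_period_le hnoise h0 h1))

/-- The bins whose closure contains the mean utility. -/
def GoodBin (g : RandomGame I A) (p : RitelParams) (i : I) (a : ∀ i, A i) (v : p.Bin) : Prop :=
  p.lower v ≤ g.mean i a ∧ g.mean i a ≤ p.lower v + p.δ

/-- The bins that an agent regards as close to its benchmark bin `w`. -/
def nearBins (p : RitelParams) (w : p.Bin) : Set p.Bin :=
  {v | ¬ (w : ℕ) + 2 ≤ v ∧ ¬ (v : ℕ) + 2 ≤ w}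

/-- A bin two steps away from a good bin is at distance at least δ from the mean, an error of
probability at most ε by the noise condition. This is why the moods react only to differences of two
bins. -/
theorem obsSetProb_compl_near_le (hnoise : 1 ≤ 2 * p.τ₀ * p.δ ^ 2) {i : I} {a : ∀ i, A i}
    {w : p.Bin} (hw : g.GoodBin p i a w) {ε : ℝ} (h0 : 0 < ε) (h1 : ε < 1) :
    g.obsSetProb p (p.period ε) i a (nearBins p w)ᶜ ≤ 2 * ε := by
  have hsub : (nearBins p w)ᶜ ⊆ {v | (w : ℕ) + 2 ≤ v} ∪ {v | (v : ℕ) + 2 ≤ w} := by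
    intro v hv
    simp only [nearBins, Set.mem_compl_iff, Set.mem_ofPred_eq, Set.mem_union] at hv ⊢
    omega
  refine (g.obsSetProb_mono p _ i a hsub).trans ((g.obsSetProb_union_le p _ i a _ _).trans ?_)
  rw [two_mul]
  refine add_le_add (g.obsSetProb_high_le_eps hnoise i a ?_ h0 h1)
    (g.obsSetProb_low_le_eps hnoise i a ?_ h0 h1)
  · intro v hv
    have := p.lower_add_le (m := 2) hv
    push_cast at this
    linarith [hw.2]
  · intro v hv
    have := p.lower_add_le (m := 2) hv
    push_cast at this
    linarith [hw.1]

theorem one_isBigO_obsSetProb_near (hnoise : 1 ≤ 2 * p.τ₀ * p.δ ^ 2) {i : I} {a : ∀ i, A i}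
    {w : p.Bin} (hw : p.bin (g.mean i a) ∈ nearBins p w) :
    (fun _ : ℝ => (1 : ℝ)) =O[𝓝[>] 0]
      fun ε => g.obsSetProb p (p.period ε) i a (nearBins p w) := by
  obtain ⟨c, hc, h⟩ := g.exists_le_obsSetProb p i a
  refine one_isBigO_of_le (half_pos hc) ?_
  have hM := g.mean_mem i a
  have hlow := p.lower_bin_le hM.1
  have hsmall : ∀ᶠ ε : ℝ in 𝓝[>] 0, ε < c / 2 := by
    filter_upwards [Ioo_mem_nhdsGT (half_pos hc)] with ε hε using hε.2
  set m := p.bin (g.mean i a) with hm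
  simp only [nearBins, Set.mem_ofPred_eq] at hw
  filter_upwards [eventually_mem_Ioo, hsmall] with ε hε hs
  have hp := h _ (p.period_pos hε.1 hε.2)
  -- The side of the mean that points towards `w` has probability at least `c`. On that side the two
  -- bins next to the mean are near `w`, and a bin further away costs an error of at least δ, so `c
  -- - ε` remains.
  rcases le_or_gt (m : ℕ) w with hle | hlt
  · have hsub : {v | m ≤ v} ⊆ nearBins p w ∪ {v | (m : ℕ) + 2 ≤ v} := by
      intro v hv
      simp only [nearBins, Set.mem_ofPred_eq, Set.mem_union, Fin.le_def] at hv ⊢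
      omega
    have h2 : g.obsSetProb p (p.period ε) i a {v | (m : ℕ) + 2 ≤ v} ≤ ε := by
      refine g.obsSetProb_high_le_eps hnoise i a (fun v hv => ?_) hε.1 hε.2
      have hv' : (m : ℕ) + 2 ≤ v := hv
      have := p.lower_add_le (m := 2) hv'
      have := p.lt_of_bin_eq hm.symm (by have := v.2; omega)
      push_cast at *
      linarith
    have := (g.obsSetProb_mono p (p.period ε) i a hsub).trans (g.obsSetProb_union_le p _ i a _ _)
    linarith
  · have hsub : {v | v ≤ m} ⊆ nearBins p w ∪ {v | (v : ℕ) + 2 ≤ m} := by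
      intro v hv
      simp only [nearBins, Set.mem_ofPred_eq, Set.mem_union, Fin.le_def] at hv ⊢
      omega
    have h2 : g.obsSetProb p (p.period ε) i a {v | (v : ℕ) + 2 ≤ m} ≤ ε := by
      refine g.obsSetProb_low_le_eps hnoise i a (fun v hv => ?_) hε.1 hε.2
      have hv' : (v : ℕ) + 2 ≤ m := hv
      have := p.lower_add_le (m := 2) hv'
      push_cast at *
      linarith
    have := (g.obsSetProb_mono p (p.period ε) i a hsub).trans (g.obsSetProb_union_le p _ i a _ _)
    linarith

/-- Asymptotically only good bins are observed. -/
theorem one_isBigO_obsSetProb_good (i : I) (a : ∀ i, A i) :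
    (fun _ : ℝ => (1 : ℝ)) =O[𝓝[>] 0]
      fun ε => g.obsSetProb p (p.period ε) i a {v | g.GoodBin p i a v} := by
  have htend : ∀ t : ℝ, 0 < t →
      Filter.Tendsto (fun ε => Real.exp (-2 * p.period ε * t ^ 2)) (𝓝[>] 0) (𝓝 0) := by
    intro t ht
    refine Real.tendsto_exp_atBot.comp ?_
    have h1 : Filter.Tendsto (fun ε => (p.period ε : ℝ)) (𝓝[>] 0) Filter.atTop :=
      tendsto_natCast_atTop_atTop.comp p.tendsto_period
    have := h1.const_mul_atTop_of_neg (r := -2 * t ^ 2) (by nlinarith [sq_pos_of_pos ht])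
    refine this.congr fun ε => by ring
  have hbad : ∀ v, ¬ g.GoodBin p i a v →
      Filter.Tendsto (fun ε => g.obsProb p (p.period ε) i a v) (𝓝[>] 0) (𝓝 0) := by
    intro v hv
    unfold GoodBin at hv
    by_cases h1 : p.lower v ≤ g.mean i a
    · have ht : 0 < g.mean i a - (p.lower v + p.δ) := by
        by_contra! hc
        exact hv ⟨h1, by linarith⟩
      refine tendsto_of_tendsto_of_tendsto_of_le_of_le' tendsto_const_nhds (htend _ ht)
        (Filter.Eventually.of_forall fun ε => g.obsProb_nonneg p _ i a v) ?_
      filter_upwards [eventually_mem_Ioo] with ε hε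
      refine (g.obsProb_le_obsSetProb p _ i a ?_).trans
        (g.obsSetProb_low_le p (p.period_pos hε.1 hε.2) i a ht)
      simp
    · have ht : 0 < p.lower v - g.mean i a := by linarith
      refine tendsto_of_tendsto_of_tendsto_of_le_of_le' tendsto_const_nhds (htend _ ht)
        (Filter.Eventually.of_forall fun ε => g.obsProb_nonneg p _ i a v) ?_
      filter_upwards [eventually_mem_Ioo] with ε hε
      refine (g.obsProb_le_obsSetProb p _ i a ?_).trans
        (g.obsSetProb_high_le p (p.period_pos hε.1 hε.2) i a ht)
      simp
  have hsum : Filter.Tendsto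
      (fun ε => 1 - ∑ v, {v | ¬ g.GoodBin p i a v}.indicator (g.obsProb p (p.period ε) i a) v)
      (𝓝[>] 0) (𝓝 (1 - ∑ _v : p.Bin, 0)) := by
    refine tendsto_const_nhds.sub (tendsto_finsetSum _ fun v _ => ?_)
    by_cases hv : ¬ g.GoodBin p i a v
    · simpa [Set.indicator, hv] using hbad v hv
    · simp [Set.indicator, hv]
  simp only [Finset.sum_const_zero, sub_zero] at hsum
  refine one_isBigO_of_le (c := 1 / 2) (by norm_num) ?_
  filter_upwards [hsum.eventually (eventually_gt_nhds (show (1 / 2 : ℝ) < 1 by norm_num))] with ε hε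
  refine hε.le.trans (le_of_eq ?_)
  rw [← sum_indicator_obsProb, ← g.sum_obsProb p (p.period ε) i a, ← Finset.sum_sub_distrib]
  refine Finset.sum_congr rfl fun v _ => ?_
  by_cases hv : g.GoodBin p i a v <;> simp [Set.indicator, hv]

end RandomGame


/-! ### One step of the algorithm -/

open Asymptotics

namespace AgentState

variable {α : Type*}

/-- Benchmark action and bin of an agent. -/
def bench {β : Type*} : AgentState α β → Option (α × β)
  | discontent => none
  | content a v => some (a, v)
  | hopeful a v => some (a, v)
  | watchful a v => some (a, v)

theorem benchmark_eq {β : Type*} (s : AgentState α β) : s.benchmark = s.bench.map Prod.fst := by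
  cases s <;> rfl

theorem bench_eq_none {β : Type*} {s : AgentState α β} : s.bench = none ↔ s = discontent := by
  cases s <;> simp [bench]

/-- Resistance of leaving discontent for the given state. -/
def cost (p : RitelParams) (s : AgentState α p.Bin) : ℝ :=
  s.bench.elim 0 fun b => p.F (p.lower b.2)

/-- The number of the benchmark bin. -/
def level {p : RitelParams} (s : AgentState α p.Bin) : ℕ :=
  s.bench.elim 0 fun b => (b.2 : ℕ)

variable {p : RitelParams}

theorem cost_nonneg (hF : ∀ v, 0 ≤ p.F (p.lower v)) (s : AgentState α p.Bin) : 0 ≤ s.cost p := by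
  cases s <;> simp [cost, bench, hF]

section Action

variable [Fintype α] [DecidableEq α] [Nontrivial α]

theorem actionProb_nonneg {ε : ℝ} (h0 : 0 < ε) (h1 : ε < 1) (s : AgentState α p.Bin) (a : α) :
    0 ≤ s.actionProb p ε a := by
  have : (1 : ℝ) < Fintype.card α := by exact_mod_cast Fintype.one_lt_card
  have h3 : (0 : ℝ) ≤ Fintype.card α - 1 := by linarith
  have h4 : 0 ≤ 1 - ε := by linarith
  cases s <;> simp only [actionProb] <;> (try split_ifs) <;> positivity

theorem actionProb_le_one {ε : ℝ} (h0 : 0 < ε) (h1 : ε < 1) (s : AgentState α p.Bin) (a : α) :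
    s.actionProb p ε a ≤ 1 := by
  have hc : (2 : ℝ) ≤ Fintype.card α := by exact_mod_cast Fintype.one_lt_card
  cases s <;> simp only [actionProb] <;> (try split_ifs) <;> try norm_num
  · exact inv_le_one_of_one_le₀ (by linarith)
  · exact h0.le
  · rw [div_le_one (by linarith)]
    linarith

theorem actionProb_isBigO_one (s : AgentState α p.Bin) (a : α) :
    (fun ε => s.actionProb p ε a) =O[𝓝[>] 0] fun _ : ℝ => (1 : ℝ) := by
  refine isBigO_of_eventually_le ?_ ?_
  · filter_upwards [eventually_mem_Ioo] with ε hε using actionProb_nonneg hε.1 hε.2 s a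
  · filter_upwards [eventually_mem_Ioo] with ε hε using actionProb_le_one hε.1 hε.2 s a

theorem actionProb_isBigO_eps {s : AgentState α p.Bin} {a b : α} (hb : s.benchmark = some b)
    (hab : a ≠ b) : (fun ε => s.actionProb p ε a) =O[𝓝[>] 0] fun ε : ℝ => ε := by
  have hc : (2 : ℝ) ≤ Fintype.card α := by exact_mod_cast Fintype.one_lt_card
  refine isBigO_of_eventually_le ?_ ?_
  · filter_upwards [eventually_mem_Ioo] with ε hε using actionProb_nonneg hε.1 hε.2 s a
  · filter_upwards [eventually_mem_Ioo] with ε hε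
    have h3 : ε / ((Fintype.card α : ℝ) - 1) ≤ ε := div_le_self hε.1.le (by linarith)
    cases s with
    | discontent => simp [benchmark] at hb
    | content b' w =>
      obtain rfl : b' = b := by simpa [benchmark] using hb
      simp only [actionProb, hab, if_false]
      split_ifs
      exacts [hε.1.le, h3]
    | hopeful b' w =>
      obtain rfl : b' = b := by simpa [benchmark] using hb
      simpa [actionProb, hab] using hε.1.le
    | watchful b' w =>
      obtain rfl : b' = b := by simpa [benchmark] using hb
      simpa [actionProb, hab] using hε.1.le

theorem one_isBigO_actionProb {s : AgentState α p.Bin} {a : α}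
    (h : ∀ b, s.benchmark = some b → a = b) :
    (fun _ : ℝ => (1 : ℝ)) =O[𝓝[>] 0] fun ε => s.actionProb p ε a := by
  have hhalf : ∀ᶠ ε : ℝ in 𝓝[>] 0, ε ∈ Set.Ioo (0 : ℝ) (1 / 2) := Ioo_mem_nhdsGT (by norm_num)
  have hc : (0 : ℝ) < Fintype.card α := by exact_mod_cast Fintype.card_pos
  cases s with
  | discontent =>
    exact one_isBigO_of_le (c := 1 / Fintype.card α) (by positivity)
      (Filter.Eventually.of_forall fun ε => le_rfl)
  | content b w =>
    obtain rfl := h b rfl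
    refine one_isBigO_of_le (c := 1 / 2) (by norm_num) ?_
    filter_upwards [hhalf] with ε hε
    simp only [actionProb, if_true]
    split_ifs
    · norm_num
    · linarith [hε.2]
  | hopeful b w =>
    obtain rfl := h b rfl
    simpa [actionProb] using isBigO_refl (fun _ : ℝ => (1 : ℝ)) (𝓝[>] (0 : ℝ))
  | watchful b w =>
    obtain rfl := h b rfl
    simpa [actionProb] using isBigO_refl (fun _ : ℝ => (1 : ℝ)) (𝓝[>] (0 : ℝ))

theorem eps_isBigO_actionProb {b : α} {w : p.Bin} (hw : (w : ℕ) < p.K) {a : α} (hab : a ≠ b) :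
    (fun ε : ℝ => ε) =O[𝓝[>] 0] fun ε => (content b w).actionProb p ε a := by
  have hc : (2 : ℝ) ≤ Fintype.card α := by exact_mod_cast Fintype.one_lt_card
  have hw' : w ≠ Fin.last p.K := fun h => by simp [h] at hw
  simp only [actionProb, hw', hab, if_false]
  have : (fun ε : ℝ => ε) = fun ε => ((Fintype.card α : ℝ) - 1) * (ε / (Fintype.card α - 1)) := by
    funext ε
    have : (Fintype.card α : ℝ) - 1 ≠ 0 := by linarith
    field_simp
  conv_lhs => rw [this]
  exact isBigO_const_mul_self _ _ _

end Action

section Update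

variable [DecidableEq α]

theorem updateProb_nonneg (hG : ∀ w v : p.Bin, (w : ℕ) < v → 0 ≤ p.G (p.lower w) (p.lower v))
    {ε : ℝ} (h0 : 0 < ε) (h1 : ε < 1) (s : AgentState α p.Bin) (a : α) (v : p.Bin)
    (y : AgentState α p.Bin) : 0 ≤ s.updateProb p ε a v y := by
  cases s with
  | discontent =>
    exact choice_nonneg (le_min (by positivity) p.cF_mem.1.le)
      ((min_le_right _ _).trans p.cF_mem.2.le) _ _ _
  | content b w =>
    simp only [updateProb]
    split_ifs with h1' h2 <;> try positivity
    exact choice_nonneg (by positivity)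
      (Real.rpow_le_one h0.le h1.le (hG _ _ (by omega))) _ _ _
  | hopeful b w => simp only [updateProb]; split_ifs <;> positivity
  | watchful b w => simp only [updateProb]; split_ifs <;> positivity

theorem sum_updateProb [Fintype α] (ε : ℝ) (s : AgentState α p.Bin) (a : α) (v : p.Bin) :
    ∑ y, s.updateProb p ε a v y = 1 := by
  cases s <;> simp only [updateProb] <;> (try split_ifs) <;> simp [choice_sum]

theorem choice_ne_zero {q : ℝ} {s t y : AgentState α p.Bin} (h : choice q s t y ≠ 0) :
    y = s ∨ y = t := by
  by_contra! hc
  exact h (by simp [choice, hc.1, hc.2])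

/-- Benchmarks only move upwards, unless the agent is or becomes discontent. -/
theorem bench_of_updateProb_ne_zero {ε : ℝ} {s y : AgentState α p.Bin} {a b : α} {v w : p.Bin}
    (hs : s.bench = some (b, w)) (h : s.updateProb p ε a v y ≠ 0) :
    y = discontent ∨ y.bench = some (b, w) ∨ ∃ b' w', y.bench = some (b', w') ∧ (w : ℕ) < w' := by
  cases s with
  | discontent => simp [bench] at hs
  | content b' w' =>
    obtain ⟨rfl, rfl⟩ : b' = b ∧ w' = w := by simpa [bench] using hs
    simp only [updateProb] at h
    split_ifs at h with h1 h2 h3 h4 h5 h6 h7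
    · rcases choice_ne_zero h with rfl | rfl
      · exact Or.inr (Or.inr ⟨a, v, rfl, by omega⟩)
      · exact Or.inr (Or.inl rfl)
    all_goals first
      | exact absurd rfl h
      | (subst_vars; exact Or.inr (Or.inl rfl))
  | hopeful b' w' =>
    obtain ⟨rfl, rfl⟩ : b' = b ∧ w' = w := by simpa [bench] using hs
    simp only [updateProb] at h
    split_ifs at h with h1 h2 h3 h4
    · subst h2
      exact Or.inr (Or.inr ⟨a, v, rfl, by omega⟩)
    all_goals first
      | exact absurd rfl h
      | (subst_vars; exact Or.inr (Or.inl rfl))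
  | watchful b' w' =>
    obtain ⟨rfl, rfl⟩ : b' = b ∧ w' = w := by simpa [bench] using hs
    simp only [updateProb] at h
    split_ifs at h with h1 h2 h3 h4
    all_goals first
      | exact absurd rfl h
      | (subst_vars; exact Or.inr (Or.inl rfl))
      | exact Or.inl ‹_›

/-- An agent that plays its benchmark action keeps it or becomes discontent. -/
theorem benchmark_of_updateProb_ne_zero {ε : ℝ} {s y : AgentState α p.Bin} {b : α} {v : p.Bin}
    (hs : s.benchmark = some b) (h : s.updateProb p ε b v y ≠ 0) :
    y = discontent ∨ y.benchmark = some b := by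
  cases s with
  | discontent => simp [benchmark] at hs
  | content b' w' =>
    obtain rfl : b' = b := by simpa [benchmark] using hs
    simp only [updateProb, ne_eq, not_true_eq_false, if_false] at h
    split_ifs at h with h1 h2 h3 h4 h5
    all_goals first
      | exact absurd rfl h
      | (subst_vars; exact Or.inr rfl)
  | hopeful b' w' =>
    obtain rfl : b' = b := by simpa [benchmark] using hs
    simp only [updateProb] at h
    split_ifs at h with h1 h2 h3 h4
    all_goals first
      | exact absurd rfl h
      | (subst_vars; exact Or.inr rfl)
  | watchful b' w' =>
    obtain rfl : b' = b := by simpa [benchmark] using hs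
    simp only [updateProb] at h
    split_ifs at h with h1 h2 h3 h4
    all_goals first
      | exact absurd rfl h
      | (subst_vars; exact Or.inr rfl)
      | exact Or.inl ‹_›

/-- An observation near the benchmark bin makes an agent that plays its benchmark content. -/
theorem updateProb_near {ε : ℝ} {s y : AgentState α p.Bin} {b : α} {v w : p.Bin}
    (hs : s.bench = some (b, w)) (hv : v ∈ RandomGame.nearBins p w)
    (h : s.updateProb p ε b v y ≠ 0) : y = content b w := by
  have h1 : ¬ (w : ℕ) + 2 ≤ v := hv.1
  have h2 : ¬ (v : ℕ) + 2 ≤ w := hv.2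
  cases s with
  | discontent => simp [bench] at hs
  | content b' w' | hopeful b' w' | watchful b' w' =>
    obtain ⟨rfl, rfl⟩ : b' = b ∧ w' = w := by simpa [bench] using hs
    simpa [updateProb, h1, h2] using h

/-- Resistance of the transition of one agent that is due to leaving discontent. -/
def entryCost (p : RitelParams) (s y : AgentState α p.Bin) : ℝ :=
  if s = discontent then y.cost p else 0

theorem updateProb_le_rpow_entryCost
    (hG : ∀ w v : p.Bin, (w : ℕ) < v → 0 ≤ p.G (p.lower w) (p.lower v)) [Fintype α]
    {ε : ℝ} (h0 : 0 < ε) (h1 : ε < 1) (s : AgentState α p.Bin) (a : α) (v : p.Bin)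
    (y : AgentState α p.Bin) : s.updateProb p ε a v y ≤ ε ^ entryCost p s y := by
  have hle : s.updateProb p ε a v y ≤ 1 := by
    rw [← sum_updateProb ε s a v]
    exact Finset.single_le_sum (fun y _ => updateProb_nonneg hG h0 h1 s a v y) (Finset.mem_univ y)
  cases s with
  | discontent =>
    cases y with
    | content a' v' =>
      simp only [entryCost, if_true, updateProb, choice, cost, bench, Option.elim, content.injEq,
        reduceCtorEq, if_false, mul_zero, add_zero]
      split_ifs with h
      · rw [mul_one, h.2]
        exact min_le_left _ _
      · rw [mul_zero]
        positivity
    | discontent => simpa [entryCost, cost, bench] using hle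
    | hopeful a' v' =>
      simp only [updateProb, choice, reduceCtorEq, if_false, mul_zero, add_zero]
      positivity
    | watchful a' v' =>
      simp only [updateProb, choice, reduceCtorEq, if_false, mul_zero, add_zero]
      positivity
  | content b w => simpa [entryCost] using hle
  | hopeful b w => simpa [entryCost] using hle
  | watchful b w => simpa [entryCost] using hle

/-- For an agent that is not discontent the benchmark bin stays or rises, and `F` is non-increasing;
becoming discontent sets the cost to zero. Only leaving discontent can raise the cost. -/
theorem cost_le_of_updateProb_ne_zero (hF : ∀ v, 0 ≤ p.F (p.lower v)) {ε : ℝ}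
    {s y : AgentState α p.Bin} {a : α} {v : p.Bin} (h : s.updateProb p ε a v y ≠ 0) :
    y.cost p ≤ s.cost p + entryCost p s y := by
  cases hs : s.bench with
  | none =>
    rw [bench_eq_none.1 hs]
    simp [entryCost, cost, bench]
  | some b =>
    obtain ⟨b, w⟩ := b
    have hne : s ≠ discontent := fun h => by simp [h, bench] at hs
    simp only [entryCost, hne, if_false, add_zero]
    rcases bench_of_updateProb_ne_zero hs h with h | h | ⟨b', w', h, hw⟩
    · rw [h]
      exact cost_nonneg hF s
    · simp [cost, hs, h]
    · simp only [cost, hs, h, Option.elim]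
      exact p.F_antitone (p.lower_lt_lower hw).le

end Update

end AgentState

/-! ### Transition probabilities of one agent and of the whole state -/

namespace RandomGame

open Asymptotics AgentState

variable {I : Type*} {A : I → Type*} [∀ i, Fintype (A i)] [∀ i, DecidableEq (A i)]
  (g : RandomGame I A) (p : RitelParams)

/-- Probability that agent `i`, in state `s`, moves into `T` when the profile `a` is played. -/
def agentStep (ε : ℝ) (i : I) (s : AgentState (A i) p.Bin) (a : ∀ i, A i)
    (T : Set (AgentState (A i) p.Bin)) : ℝ :=
  ∑ v, g.obsProb p (p.period ε) i a v * ∑ y, T.indicator (s.updateProb p ε (a i) v) y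

variable {g p}

theorem agentStep_univ (ε : ℝ) (i : I) (s : AgentState (A i) p.Bin) (a : ∀ i, A i) :
    g.agentStep p ε i s a Set.univ = 1 := by
  simp [agentStep, sum_updateProb, sum_obsProb]

section OneAgent

variable (hG : ∀ w v : p.Bin, (w : ℕ) < v → 0 ≤ p.G (p.lower w) (p.lower v))
  {ε : ℝ} (h0 : 0 < ε) (h1 : ε < 1)

include hG h0 h1

theorem sum_indicator_updateProb_nonneg {i : I} (s : AgentState (A i) p.Bin) (a : A i) (v : p.Bin)
    (T : Set (AgentState (A i) p.Bin)) : 0 ≤ ∑ y, T.indicator (s.updateProb p ε a v) y :=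
  Finset.sum_nonneg fun y _ => Set.indicator_nonneg (fun y _ => updateProb_nonneg hG h0 h1 s a v y) y

theorem agentStep_nonneg (i : I) (s : AgentState (A i) p.Bin) (a : ∀ i, A i)
    (T : Set (AgentState (A i) p.Bin)) : 0 ≤ g.agentStep p ε i s a T :=
  Finset.sum_nonneg fun v _ => mul_nonneg (g.obsProb_nonneg p _ i a v)
    (sum_indicator_updateProb_nonneg hG h0 h1 s (a i) v T)

theorem agentStep_mono {i : I} (s : AgentState (A i) p.Bin) (a : ∀ i, A i)
    {T T' : Set (AgentState (A i) p.Bin)} (h : T ⊆ T') :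
    g.agentStep p ε i s a T ≤ g.agentStep p ε i s a T' :=
  Finset.sum_le_sum fun v _ => mul_le_mul_of_nonneg_left
    (Finset.sum_le_sum fun y _ => Set.indicator_le_indicator_of_subset h
      (fun y => updateProb_nonneg hG h0 h1 s (a i) v y) y) (g.obsProb_nonneg p _ i a v)

theorem agentStep_le_one (i : I) (s : AgentState (A i) p.Bin) (a : ∀ i, A i)
    (T : Set (AgentState (A i) p.Bin)) : g.agentStep p ε i s a T ≤ 1 := by
  rw [← agentStep_univ (g := g) ε i s a]
  exact agentStep_mono hG h0 h1 s a (Set.subset_univ T)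

theorem mul_obsSetProb_le_agentStep {i : I} {s : AgentState (A i) p.Bin} {a : ∀ i, A i}
    {T : Set (AgentState (A i) p.Bin)} {V : Set p.Bin} {q : ℝ}
    (h : ∀ v ∈ V, q ≤ ∑ y, T.indicator (s.updateProb p ε (a i) v) y) :
    q * g.obsSetProb p (p.period ε) i a V ≤ g.agentStep p ε i s a T := by
  rw [← sum_indicator_obsProb, Finset.mul_sum]
  refine Finset.sum_le_sum fun v _ => ?_
  by_cases hv : v ∈ V
  · rw [Set.indicator_of_mem hv, mul_comm]
    exact mul_le_mul_of_nonneg_left (h v hv) (g.obsProb_nonneg p _ i a v)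
  · rw [Set.indicator_of_notMem hv, mul_zero]
    exact mul_nonneg (g.obsProb_nonneg p _ i a v)
      (sum_indicator_updateProb_nonneg hG h0 h1 s (a i) v T)

theorem obsSetProb_le_agentStep {i : I} {s : AgentState (A i) p.Bin} {a : ∀ i, A i}
    {T : Set (AgentState (A i) p.Bin)} {V : Set p.Bin}
    (h : ∀ v ∈ V, ∀ y, s.updateProb p ε (a i) v y ≠ 0 → y ∈ T) :
    g.obsSetProb p (p.period ε) i a V ≤ g.agentStep p ε i s a T := by
  rw [← one_mul (g.obsSetProb p (p.period ε) i a V)]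
  refine mul_obsSetProb_le_agentStep hG h0 h1 fun v hv => le_of_eq ?_
  rw [← sum_updateProb ε s (a i) v]
  refine Finset.sum_congr rfl fun y _ => ?_
  by_cases hy : y ∈ T
  · rw [Set.indicator_of_mem hy]
  · rw [Set.indicator_of_notMem hy]
    by_contra hne
    exact hy (h v hv y hne)

theorem agentStep_le_obsSetProb {i : I} {s : AgentState (A i) p.Bin} {a : ∀ i, A i}
    {T : Set (AgentState (A i) p.Bin)} {V : Set p.Bin}
    (h : ∀ v ∉ V, ∀ y ∈ T, s.updateProb p ε (a i) v y = 0) :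
    g.agentStep p ε i s a T ≤ g.obsSetProb p (p.period ε) i a V := by
  rw [← sum_indicator_obsProb]
  refine Finset.sum_le_sum fun v _ => ?_
  by_cases hv : v ∈ V
  · rw [Set.indicator_of_mem hv]
    refine mul_le_of_le_one_right (g.obsProb_nonneg p _ i a v) ?_
    rw [← sum_updateProb ε s (a i) v]
    exact Finset.sum_le_sum fun y _ =>
      Set.indicator_le_self' (fun y _ => updateProb_nonneg hG h0 h1 s (a i) v y) y
  · rw [Set.indicator_of_notMem hv, Finset.sum_eq_zero fun y _ => ?_, mul_zero]
    by_cases hy : y ∈ T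
    · rw [Set.indicator_of_mem hy, h v hv y hy]
    · exact Set.indicator_of_notMem hy _

end OneAgent

section Asymptotic

variable (hG : ∀ w v : p.Bin, (w : ℕ) < v → 0 ≤ p.G (p.lower w) (p.lower v))

include hG

theorem one_isBigO_agentStep_of_obs {i : I} {s : AgentState (A i) p.Bin} {a : ∀ i, A i}
    {T : Set (AgentState (A i) p.Bin)} {V : Set p.Bin}
    (hV : (fun _ : ℝ => (1 : ℝ)) =O[𝓝[>] 0] fun ε => g.obsSetProb p (p.period ε) i a V)
    (h : ∀ ε, ∀ v ∈ V, ∀ y, s.updateProb p ε (a i) v y ≠ 0 → y ∈ T) :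
    (fun _ : ℝ => (1 : ℝ)) =O[𝓝[>] 0] fun ε => g.agentStep p ε i s a T := by
  refine hV.trans (isBigO_of_eventually_le
    (Filter.Eventually.of_forall fun ε => g.obsSetProb_nonneg p _ i a V) ?_)
  filter_upwards [eventually_mem_Ioo] with ε hε
  exact obsSetProb_le_agentStep hG hε.1 hε.2 (h ε)

theorem one_isBigO_agentStep_of_forall {i : I} {s : AgentState (A i) p.Bin} {a : ∀ i, A i}
    {T : Set (AgentState (A i) p.Bin)}
    (h : ∀ ε, ∀ v y, s.updateProb p ε (a i) v y ≠ 0 → y ∈ T) :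
    (fun _ : ℝ => (1 : ℝ)) =O[𝓝[>] 0] fun ε => g.agentStep p ε i s a T := by
  refine one_isBigO_agentStep_of_obs hG (V := Set.univ) ?_ fun ε v _ y => h ε v y
  simp_rw [obsSetProb_univ]
  exact isBigO_refl _ _

/-- The cap `cF < 1` on the acceptance probability lets a discontent agent wait for the others
without resistance, even where `F` vanishes. -/
theorem one_isBigO_agentStep_discontent {i : I} {a : ∀ i, A i}
    {T : Set (AgentState (A i) p.Bin)} (h : discontent ∈ T) :
    (fun _ : ℝ => (1 : ℝ)) =O[𝓝[>] 0] fun ε => g.agentStep p ε i discontent a T := by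
  have hc : 0 < 1 - p.cF := by linarith [p.cF_mem.2]
  refine one_isBigO_of_le hc ?_
  filter_upwards [eventually_mem_Ioo] with ε hε
  have := mul_obsSetProb_le_agentStep (g := g) hG hε.1 hε.2 (i := i) (s := discontent) (a := a)
    (T := T) (V := Set.univ) (q := 1 - p.cF) fun v _ => ?_
  · rwa [obsSetProb_univ, mul_one] at this
  · have h2 := Finset.single_le_sum (f := T.indicator (updateProb p ε discontent (a i) v))
      (fun y _ => Set.indicator_nonneg (fun y _ => updateProb_nonneg hG hε.1 hε.2 _ (a i) v y) y)
      (Finset.mem_univ discontent)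
    rw [Set.indicator_of_mem h] at h2
    refine le_trans ?_ h2
    simp only [updateProb, choice, reduceCtorEq, if_false, if_true, mul_zero, zero_add, mul_one]
    linarith [min_le_right (ε ^ p.F (p.lower v)) p.cF]

theorem agentStep_isBigO_one {i : I} (s : AgentState (A i) p.Bin) (a : ∀ i, A i)
    (T : Set (AgentState (A i) p.Bin)) :
    (fun ε => g.agentStep p ε i s a T) =O[𝓝[>] 0] fun _ : ℝ => (1 : ℝ) := by
  refine isBigO_of_eventually_le ?_ ?_
  · filter_upwards [eventually_mem_Ioo] with ε hε using agentStep_nonneg hG hε.1 hε.2 i s a T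
  · filter_upwards [eventually_mem_Ioo] with ε hε using agentStep_le_one hG hε.1 hε.2 i s a T

end Asymptotic

variable [Fintype I]

theorem prod_actionProb_isBigO_one [∀ i, Nontrivial (A i)] (x : RitelState A p) (a : ∀ i, A i) :
    (fun ε => ∏ i, (x i).actionProb p ε (a i)) =O[𝓝[>] 0] fun _ : ℝ => (1 : ℝ) := by
  have := IsBigO.finsetProd (s := Finset.univ) fun i _ => actionProb_isBigO_one (x i) (a i)
  simpa using this

variable [DecidableEq I]

/-- Probability of moving into a product of sets of agent states. -/
theorem sum_indicator_ritel_pi (ε : ℝ) (x : RitelState A p)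
    (T : ∀ i, Set (AgentState (A i) p.Bin)) :
    ∑ y, {y : RitelState A p | ∀ i, y i ∈ T i}.indicator (g.ritel p ε x) y =
      ∑ a : ∀ i, A i, (∏ i, (x i).actionProb p ε (a i)) *
        ∏ i, g.agentStep p ε i (x i) a (T i) := by
  classical
  have e : ∀ y, {y : RitelState A p | ∀ i, y i ∈ T i}.indicator (g.ritel p ε x) y =
      ∑ a : ∀ i, A i, (∏ i, (x i).actionProb p ε (a i)) * ∏ i, (T i).indicator (fun s => ∑ v : p.Bin,
        g.obsProb p (p.period ε) i a v * (x i).updateProb p ε (a i) v s) (y i) := by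
    intro y
    by_cases hy : ∀ i, y i ∈ T i
    · rw [Set.indicator_of_mem (by exact hy)]
      refine Finset.sum_congr rfl fun a _ => ?_
      congr 1
      exact Finset.prod_congr rfl fun i _ => by rw [Set.indicator_of_mem (hy i)]
    · rw [Set.indicator_of_notMem (by exact hy)]
      push Not at hy
      obtain ⟨i, hi⟩ := hy
      refine (Finset.sum_eq_zero fun a _ => ?_).symm
      exact mul_eq_zero_of_right _
        (Finset.prod_eq_zero (Finset.mem_univ i) (Set.indicator_of_notMem hi _))
  simp_rw [e]
  rw [Finset.sum_comm]
  refine Finset.sum_congr rfl fun a _ => ?_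
  rw [← Finset.mul_sum, ← Fintype.prod_sum (fun i (s : AgentState (A i) p.Bin) =>
    (T i).indicator (fun s => ∑ v : p.Bin,
        g.obsProb p (p.period ε) i a v * (x i).updateProb p ε (a i) v s) s)]
  congr 1
  refine Finset.prod_congr rfl fun i _ => ?_
  simp only [agentStep, Finset.mul_sum]
  rw [Finset.sum_comm]
  refine Finset.sum_congr rfl fun s _ => ?_
  by_cases hs : s ∈ T i <;> simp [hs]

/-- Probability that one agent moves into a given set. -/
theorem sum_indicator_ritel_coord (ε : ℝ) (x : RitelState A p) (i : I)
    (T : Set (AgentState (A i) p.Bin)) :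
    ∑ y, {y : RitelState A p | y i ∈ T}.indicator (g.ritel p ε x) y =
      ∑ a : ∀ i, A i, (∏ i, (x i).actionProb p ε (a i)) * g.agentStep p ε i (x i) a T := by
  have h := sum_indicator_ritel_pi (g := g) ε x (Function.update (fun _ => Set.univ) i T)
  have e : {y : RitelState A p | ∀ j, y j ∈ Function.update
      (fun j => (Set.univ : Set (AgentState (A j) p.Bin))) i T j} = {y | y i ∈ T} := by
    ext y
    simp only [Set.mem_ofPred_eq]
    constructor
    · intro hy
      simpa using hy i
    · intro hy j
      by_cases hj : j = i
      · subst hj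
        simpa using hy
      · simp [Function.update_of_ne hj]
  rw [e] at h
  rw [h]
  refine Finset.sum_congr rfl fun a _ => ?_
  congr 1
  rw [Finset.prod_eq_single i]
  · simp
  · intro j _ hj
    rw [Function.update_of_ne hj, agentStep_univ]
  · simp

variable [∀ i, Nontrivial (A i)]
  (hG : ∀ w v : p.Bin, (w : ℕ) < v → 0 ≤ p.G (p.lower w) (p.lower v))

include hG

/-- Lower bound for the probability of a product event, through a fixed action profile. -/
theorem rpow_isBigO_ritel_pi {x : RitelState A p} (a : ∀ i, A i)
    (T : ∀ i, Set (AgentState (A i) p.Bin)) (r q : I → ℝ)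
    (hr : ∀ i, (fun ε : ℝ => ε ^ r i) =O[𝓝[>] 0] fun ε => (x i).actionProb p ε (a i))
    (hq : ∀ i, (fun ε : ℝ => ε ^ q i) =O[𝓝[>] 0] fun ε => g.agentStep p ε i (x i) a (T i)) :
    (fun ε : ℝ => ε ^ (∑ i, (r i + q i))) =O[𝓝[>] 0]
      fun ε => ∑ y, {y : RitelState A p | ∀ i, y i ∈ T i}.indicator (g.ritel p ε x) y := by
  have e : (fun ε : ℝ => ε ^ (∑ i, (r i + q i))) =ᶠ[𝓝[>] 0]
      fun ε => (∏ i, ε ^ r i) * ∏ i, ε ^ q i := by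
    filter_upwards [self_mem_nhdsWithin] with ε hε
    have hε' : (0 : ℝ) < ε := hε
    rw [Finset.sum_add_distrib, Real.rpow_add hε', Real.rpow_sum_of_pos hε',
      Real.rpow_sum_of_pos hε']
  refine e.trans_isBigO (((IsBigO.finsetProd fun i _ => hr i).mul
    (IsBigO.finsetProd fun i _ => hq i)).trans ?_)
  have hpos : ∀ ε : ℝ, 0 < ε → ε < 1 → ∀ a : ∀ i, A i,
      0 ≤ (∏ i, (x i).actionProb p ε (a i)) * ∏ i, g.agentStep p ε i (x i) a (T i) :=
    fun ε h0 h1 a => mul_nonneg (Finset.prod_nonneg fun i _ => actionProb_nonneg h0 h1 _ _)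
      (Finset.prod_nonneg fun i _ => agentStep_nonneg hG h0 h1 i _ a _)
  refine isBigO_of_eventually_le ?_ ?_
  · filter_upwards [eventually_mem_Ioo] with ε hε using hpos ε hε.1 hε.2 a
  · filter_upwards [eventually_mem_Ioo] with ε hε
    rw [sum_indicator_ritel_pi]
    exact Finset.single_le_sum (f := fun a : ∀ i, A i => (∏ i, (x i).actionProb p ε (a i)) *
      ∏ i, g.agentStep p ε i (x i) a (T i)) (fun a _ => hpos ε hε.1 hε.2 a) (Finset.mem_univ a)

/-- Lower bound for the probability of a product event without resistance. -/
theorem one_isBigO_ritel_pi {x : RitelState A p} (a : ∀ i, A i)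
    (T : ∀ i, Set (AgentState (A i) p.Bin))
    (hr : ∀ i b, (x i).benchmark = some b → a i = b)
    (hq : ∀ i, (fun _ : ℝ => (1 : ℝ)) =O[𝓝[>] 0] fun ε => g.agentStep p ε i (x i) a (T i)) :
    (fun _ : ℝ => (1 : ℝ)) =O[𝓝[>] 0]
      fun ε => ∑ y, {y : RitelState A p | ∀ i, y i ∈ T i}.indicator (g.ritel p ε x) y := by
  have := rpow_isBigO_ritel_pi hG (x := x) a T (fun _ => 0) (fun _ => 0)
    (fun i => by simpa using one_isBigO_actionProb (p := p) (hr i)) (fun i => by simpa using hq i)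
  simpa using this

end RandomGame

/-! ### Leaving a set of states -/

namespace AgentState

variable {α : Type*} {p : RitelParams}

/-- Number of periods an agent needs to become discontent when low bins (at most `l`) and high
bins (at least `l + 3`) can be forced on it. -/
def stage (l : ℕ) : AgentState α p.Bin → ℕ
  | discontent => 0
  | content _ w => if l + 2 ≤ w then 2 else 4
  | hopeful _ w => if l + 2 ≤ w then 2 else 3
  | watchful _ w => if l + 2 ≤ w then 1 else 4

/-- From a benchmark bin at least `l + 2` the low bins lead through watchful to discontent. From a
lower one the high bins lead through hopeful to a new benchmark bin at least `l + 3`, and so to the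
first case. The gap of three bins ensures that one of the two observations is always far from the
benchmark. -/
theorem stage_decreases [DecidableEq α] {ε : ℝ} {s y : AgentState α p.Bin} {b : α} {v : p.Bin}
    {l : ℕ} (hs : s.benchmark = some b) (hlow : l + 2 ≤ s.level → (v : ℕ) ≤ l)
    (hhigh : ¬ l + 2 ≤ s.level → l + 3 ≤ v) (h : s.updateProb p ε b v y ≠ 0) :
    y = discontent ∨ (y.benchmark = some b ∧ y.stage l < s.stage l) := by
  cases s with
  | discontent => simp [benchmark] at hs
  | content b' w | hopeful b' w | watchful b' w =>
    obtain rfl : b' = b := by simpa [benchmark] using hs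
    simp only [level, bench, Option.elim] at hlow hhigh
    simp only [updateProb, ne_eq, not_true_eq_false, if_false] at h
    by_cases hw : l + 2 ≤ (w : ℕ)
    · have hv := hlow hw
      have h1 : ¬ (w : ℕ) + 2 ≤ v := by omega
      have h2 : (v : ℕ) + 2 ≤ w := by omega
      simp only [h1, h2, if_false, if_true, ite_eq_right_iff, one_ne_zero, imp_false,
        not_not] at h
      subst h
      simp [stage, hw, benchmark]
    · have hv := hhigh hw
      have h1 : (w : ℕ) + 2 ≤ v := by omega
      simp only [h1, if_true, ite_eq_right_iff, one_ne_zero, imp_false, not_not] at h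
      subst h
      have h3 : l + 2 ≤ (v : ℕ) := by omega
      simp [stage, hw, h3, benchmark]

end AgentState

namespace RandomGame

open Asymptotics AgentState

/-- The states without discontent agent and with the benchmarks `a`, `v`. -/
def fiber {I : Type*} {A : I → Type*} {p : RitelParams} (a : ∀ i, A i) (v : I → p.Bin) :
    Set (RitelState A p) :=
  {x | ∀ i, (x i).bench = some (a i, v i)}

theorem fiber_benchmark {I : Type*} {A : I → Type*} {p : RitelParams} {a : ∀ i, A i}
    {v : I → p.Bin} {x : RitelState A p} (hx : x ∈ fiber a v) (i : I) :
    (x i).benchmark = some (a i) := by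
  rw [benchmark_eq, hx i]
  rfl

variable {I : Type*} {A : I → Type*} [∀ i, Fintype (A i)] [∀ i, DecidableEq (A i)]
  {g : RandomGame I A} {p : RitelParams}

theorem lt_lower_bin_add {u : ℝ} (hu : u ≤ 1) : u < p.lower (p.bin u) + p.δ := by
  rcases (Nat.lt_succ_iff.1 (p.bin u).2).lt_or_eq with h | h
  · exact p.lt_of_bin_eq rfl h
  · have : p.lower (p.bin u) = 1 := by rw [RitelParams.lower, h, p.K_mul_δ]
    linarith [p.δ_pos]

/-- The source of the shift by δ in `F(Mᵢ + δ)` and in the first argument of `G`: a benchmark bin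
that is not left freely overestimates the mean by at most δ. -/
theorem lower_le_of_near {u : ℝ} (hu : 0 ≤ u) {w : p.Bin} (hw : p.bin u ∈ nearBins p w) :
    p.lower w ≤ u + p.δ := by
  have h1 : (w : ℕ) < p.bin u + 2 := not_le.1 hw.2
  have h2 : ((w : ℕ) : ℝ) ≤ ((p.bin u : p.Bin) : ℕ) + 1 := by exact_mod_cast (by omega)
  have h3 := p.lower_bin_le hu
  unfold RitelParams.lower at *
  nlinarith [p.δ_pos]

theorem lt_of_near {u : ℝ} (hu : u ≤ 1) {w : p.Bin} (hw : p.bin u ∈ nearBins p w) :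
    u < p.lower w + 2 * p.δ := by
  have h1 : ((p.bin u : p.Bin) : ℕ) < w + 2 := not_le.1 hw.1
  have h2 : (((p.bin u : p.Bin) : ℕ) : ℝ) ≤ (w : ℕ) + 1 := by exact_mod_cast (by omega)
  have h3 := lt_lower_bin_add (p := p) hu
  unfold RitelParams.lower at *
  nlinarith [p.δ_pos]

variable [Fintype I] [DecidableEq I] [∀ i, Nontrivial (A i)]
  (hG : ∀ w v : p.Bin, (w : ℕ) < v → 0 ≤ p.G (p.lower w) (p.lower v))

include hG

/-- By interdependence, a state with a discontent agent leads to the state in which all agents are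
discontent, without resistance. -/
theorem escapes_of_discontent (hinter : g.Interdependent (3 * p.δ)) {L : Set (RitelState A p)}
    (hL : (fun _ => discontent) ∉ L) {x : RitelState A p} (hx : ∃ i, x i = discontent)
    (hxL : x ∈ L) : Escapes (g.ritel p) L 0 x := by
  classical
  obtain ⟨n, hn⟩ : ∃ n, (Finset.univ.filter fun i => x i ≠ discontent).card = n := ⟨_, rfl⟩
  -- Induction on the number of agents that are not discontent.
  induction n using Nat.strong_induction_on generalizing x with
  | _ n ih =>
  let β : ∀ i, Option (A i) := fun i => (x i).benchmark
  have hβ : ∀ i, β i = none ↔ x i = discontent := fun i => by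
    simp [β, benchmark_eq, bench_eq_none]
  -- The discontent agents serve as the group `J`. The other agents play their benchmarks, so both
  -- profiles are played without resistance, and switching between them moves the mean of agent `i`
  -- by three bin widths.
  obtain ⟨i, hi, aL, aH, haL, haH, hgap⟩ : ∃ i, x i ≠ discontent ∧ ∃ aL aH : ∀ i, A i,
      (∀ j b, β j = some b → aL j = b) ∧ (∀ j b, β j = some b → aH j = b) ∧
      g.mean i aL + 3 * p.δ ≤ g.mean i aH := by
    let a : ∀ i, A i := fun i => (β i).getD (Classical.arbitrary _)
    have ha : ∀ j b, β j = some b → a j = b := fun j b h => by simp [a, h]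
    obtain ⟨i, hi, a', ha', h⟩ := hinter a {i | x i = discontent} hx (fun h => hL (by
      have : x = fun _ => discontent :=
        funext fun i => (h ▸ Set.mem_univ i : i ∈ {i | x i = discontent})
      rwa [← this]))
    have ha'' : ∀ j b, β j = some b → a' j = b := fun j b h => by
      rw [ha' j (fun hj => by rw [(hβ j).2 hj] at h; simp at h), ha j b h]
    refine ⟨i, hi, ?_⟩
    rcases abs_cases (g.mean i a' - g.mean i a) with ⟨he, _⟩ | ⟨he, _⟩
    · exact ⟨a, a', ha, ha'', by linarith⟩
    · exact ⟨a', a, ha'', ha, by linarith⟩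
  obtain ⟨b, hb⟩ : ∃ b, β i = some b := Option.ne_none_iff_exists'.1 fun h => hi ((hβ i).1 h)
  set l : ℕ := ((p.bin (g.mean i aL) : p.Bin) : ℕ) with hl
  have hlh : l + 3 ≤ p.bin (g.mean i aH) := by
    have h1 := p.lower_bin_le (g.mean_mem i aL).1
    have h2 := lt_lower_bin_add (p := p) (g.mean_mem i aH).2
    have h3 : p.lower (p.bin (g.mean i aL)) + (2 : ℕ) * p.δ < p.lower (p.bin (g.mean i aH)) := by
      push_cast; linarith
    have := p.add_lt_of_lower_lt h3
    omega
  -- The benchmark bin of `i` may change on the way, so the inner induction runs on its stage and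
  -- keeps only the benchmark actions fixed. If some other agent becomes discontent meanwhile, the
  -- outer induction takes over.
  suffices hmain : ∀ k, ∀ y : RitelState A p, (∀ j, (y j).benchmark = β j) →
      (y i).stage l ≤ k → y ∈ L → Escapes (g.ritel p) L 0 y from
    hmain _ x (fun j => rfl) le_rfl hxL
  intro k
  induction k with
  | zero =>
    intro y hy hst _
    exfalso
    have h1 := hy i
    rw [hb] at h1
    cases hyi : y i <;> rw [hyi] at h1 hst <;> simp only [stage] at hst
    · simp [benchmark] at h1
    all_goals (split_ifs at hst <;> omega)
  | succ k ihk =>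
    intro y hy hst hyL
    have hyd : ∀ j, y j = discontent ↔ x j = discontent := fun j => by
      rw [← hβ, ← hy j]; simp [benchmark_eq, bench_eq_none]
    let T : ∀ j, Set (AgentState (A j) p.Bin) := fun j =>
      {s | s = discontent ∨ (s.benchmark = β j ∧ (j = i → s.stage l < (y j).stage l))}
    have hT : ∃ a : ∀ j, A j, (∀ j b, β j = some b → a j = b) ∧
        (fun _ : ℝ => (1 : ℝ)) =O[𝓝[>] 0] fun ε => g.agentStep p ε i (y i) a (T i) := by
      by_cases hw : l + 2 ≤ (y i).level
      · refine ⟨aL, haL, one_isBigO_agentStep_of_obs hG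
          (g.one_isBigO_obsSetProb_le p i aL fun v hv => hv) fun ε v hv z hz => ?_⟩
        rw [haL i b hb] at hz
        rcases stage_decreases ((hy i).trans hb) (fun _ => hv) (fun h => absurd hw h) hz with h | h
        · exact Or.inl h
        · exact Or.inr ⟨h.1.trans hb.symm, fun _ => h.2⟩
      · refine ⟨aH, haH, one_isBigO_agentStep_of_obs hG
          (g.one_isBigO_obsSetProb_ge p i aH fun v hv => hv) fun ε v hv z hz => ?_⟩
        rw [haH i b hb] at hz
        have hv' : ((p.bin (g.mean i aH) : p.Bin) : ℕ) ≤ v := hv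
        rcases stage_decreases ((hy i).trans hb) (fun h => absurd h hw) (fun _ => by omega) hz
          with h | h
        · exact Or.inl h
        · exact Or.inr ⟨h.1.trans hb.symm, fun _ => h.2⟩
    obtain ⟨a, ha, hTi⟩ := hT
    refine Escapes.of_free_step le_rfl (one_isBigO_ritel_pi hG a T
      (fun j b h => ha j b ((hy j).symm.trans h)) fun j => ?_) ?_
    · by_cases hji : j = i
      · subst hji
        exact hTi
      · cases hj : β j with
        | none =>
          rw [(hyd j).2 ((hβ j).1 hj)]
          exact one_isBigO_agentStep_discontent hG (Or.inl rfl)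
        | some c =>
          refine one_isBigO_agentStep_of_forall hG fun ε v z hz => ?_
          rw [ha j c hj] at hz
          rcases benchmark_of_updateProb_ne_zero ((hy j).trans hj) hz with h | h
          · exact Or.inl h
          · exact Or.inr ⟨h.trans hj.symm, fun h => absurd h hji⟩
    · intro z hz hzL
      have hz' : ∀ j, z j ∈ T j := hz
      by_cases hall : ∀ j, (z j).benchmark = β j
      · refine ihk z hall ?_ hzL
        rcases hz' i with h | h
        · have := hall i
          rw [h, hb] at this
          simp [benchmark] at this
        · have := h.2 rfl
          omega
      · push Not at hall
        obtain ⟨j, hj⟩ := hall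
        have hzx : ∀ m, x m = discontent → z m = discontent := by
          intro m hm
          rcases hz' m with h | h
          · exact h
          · rw [(hβ m).2 hm, benchmark_eq, Option.map_eq_none_iff, bench_eq_none] at h
            exact h.1
        have hzj : z j = discontent := (hz' j).resolve_right fun h => hj h.1
        have hxj : x j ≠ discontent := fun h => hj (by rw [hzj, (hβ j).2 h]; rfl)
        refine ih _ ?_ ⟨hx.choose, hzx _ hx.choose_spec⟩ hzL rfl
        rw [← hn]
        refine Finset.card_lt_card ⟨fun m hm => ?_, fun hsub => ?_⟩
        · simp only [Finset.mem_filter, Finset.mem_univ, true_and] at hm ⊢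
          exact fun h => hm (hzx m h)
        · have := hsub (Finset.mem_filter.2 ⟨Finset.mem_univ j, hxj⟩)
          simp [hzj] at this

/-- If a benchmark bin is far from the mean utility, the benchmarks change without resistance. -/
theorem escapes_of_not_near {a : ∀ i, A i} {v : I → p.Bin} {i : I}
    (hi : p.bin (g.mean i a) ∉ nearBins p (v i)) {x : RitelState A p} (hx : x ∈ fiber a v) :
    Escapes (g.ritel p) (fiber a v) 0 x := by
  classical
  -- Two observations in `V` suffice: the first puts agent `i` into the mood `s₀`, hopeful for high
  -- and watchful for low bins, unless its benchmark is already lost, and the second ends the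
  -- benchmark.
  have hmain : ∀ (s₀ : AgentState (A i) p.Bin) (V : Set p.Bin),
      ((fun _ : ℝ => (1 : ℝ)) =O[𝓝[>] 0] fun ε => g.obsSetProb p (p.period ε) i a V) →
      (∀ ε, ∀ w ∈ V, ∀ y, s₀.updateProb p ε (a i) w y ≠ 0 → y.bench ≠ some (a i, v i)) →
      (∀ s : AgentState (A i) p.Bin, s.bench = some (a i, v i) → ∀ ε, ∀ w ∈ V, ∀ y,
        s.updateProb p ε (a i) w y ≠ 0 → y = s₀ ∨ y.bench ≠ some (a i, v i)) →
      Escapes (g.ritel p) (fiber a v) 0 x := by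
    intro s₀ V hV h1 h2
    have hstep : ∀ y ∈ fiber a v, y i = s₀ → Escapes (g.ritel p) (fiber a v) 0 y := by
      intro y hy hyi
      refine Escapes.of_free_step le_rfl (one_isBigO_ritel_pi hG a (Function.update
        (fun _ => Set.univ) i {s | s.bench ≠ some (a i, v i)}) (fun j b h => ?_) fun j => ?_) ?_
      · rw [fiber_benchmark hy j] at h
        exact Option.some.inj h
      · by_cases hj : j = i
        · subst hj
          rw [Function.update_self, hyi]
          exact one_isBigO_agentStep_of_obs hG hV h1
        · rw [Function.update_of_ne hj]
          exact one_isBigO_agentStep_of_forall hG fun _ _ _ _ => Set.mem_univ _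
      · intro z hz hzF
        have := hz i
        rw [Function.update_self] at this
        exact absurd (hzF i) this
    refine Escapes.of_free_step le_rfl (one_isBigO_ritel_pi hG a (Function.update
      (fun _ => Set.univ) i {s | s = s₀ ∨ s.bench ≠ some (a i, v i)}) (fun j b h => ?_)
      fun j => ?_) ?_
    · rw [fiber_benchmark hx j] at h
      exact Option.some.inj h
    · by_cases hj : j = i
      · subst hj
        rw [Function.update_self]
        exact one_isBigO_agentStep_of_obs hG hV (h2 _ (hx j))
      · rw [Function.update_of_ne hj]
        exact one_isBigO_agentStep_of_forall hG fun _ _ _ _ => Set.mem_univ _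
    · intro z hz hzF
      have := hz i
      rw [Function.update_self] at this
      rcases this with h | h
      · exact hstep z hzF h
      · exact absurd (hzF i) h
  have hcase : (v i : ℕ) + 2 ≤ p.bin (g.mean i a) ∨
      ((p.bin (g.mean i a) : p.Bin) : ℕ) + 2 ≤ v i := by
    by_contra! h
    exact hi ⟨by omega, by omega⟩
  rcases hcase with h | h
  · refine hmain (hopeful (a i) (v i)) {w | (v i : ℕ) + 2 ≤ w}
      (g.one_isBigO_obsSetProb_ge p i a fun w hw => ?_) (fun ε w hw y hy => ?_)
      (fun s hs ε w hw y hy => ?_)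
    · exact h.trans hw
    · have hw' : (v i : ℕ) + 2 ≤ w := hw
      simp only [updateProb, hw', if_true, ne_eq, ite_eq_right_iff, one_ne_zero, imp_false,
        not_not] at hy
      subst hy
      simp only [bench, ne_eq, Option.some.injEq, Prod.mk.injEq, true_and]
      intro he
      rw [he] at hw'
      omega
    · have hw' : (v i : ℕ) + 2 ≤ w := hw
      cases s with
      | discontent => simp [bench] at hs
      | content b' w' | hopeful b' w' | watchful b' w' =>
        obtain ⟨rfl, rfl⟩ : b' = a i ∧ w' = v i := by simpa [bench] using hs
        simp only [updateProb, hw', if_true, if_false, ne_eq, ite_eq_right_iff, one_ne_zero,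
          imp_false, not_not, not_true_eq_false] at hy
        subst hy
        first
          | exact Or.inl rfl
          | (right
             simp only [bench, ne_eq, Option.some.injEq, Prod.mk.injEq, true_and]
             intro he
             rw [he] at hw'
             omega)
  · refine hmain (watchful (a i) (v i)) {w | (w : ℕ) + 2 ≤ v i}
      (g.one_isBigO_obsSetProb_le p i a fun w hw => ?_) (fun ε w hw y hy => ?_)
      (fun s hs ε w hw y hy => ?_)
    · have hw' : (w : ℕ) ≤ p.bin (g.mean i a) := hw
      show (w : ℕ) + 2 ≤ v i
      omega
    · have hw' : (w : ℕ) + 2 ≤ v i := hw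
      have hw'' : ¬ (v i : ℕ) + 2 ≤ w := by omega
      simp only [updateProb, hw', hw'', if_true, if_false, ne_eq, ite_eq_right_iff, one_ne_zero,
        imp_false, not_not] at hy
      subst hy
      simp [bench]
    · have hw' : (w : ℕ) + 2 ≤ v i := hw
      have hw'' : ¬ (v i : ℕ) + 2 ≤ w := by omega
      cases s with
      | discontent => simp [bench] at hs
      | content b' w' | hopeful b' w' | watchful b' w' =>
        obtain ⟨rfl, rfl⟩ : b' = a i ∧ w' = v i := by simpa [bench] using hs
        simp only [updateProb, hw', hw'', if_true, if_false, ne_eq, ite_eq_right_iff, one_ne_zero,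
          imp_false, not_not, not_true_eq_false] at hy
        subst hy
        simp [bench]

end RandomGame

/-! ### Leaving benchmarks by experiments -/

namespace RandomGame

open Asymptotics AgentState

/-- The state in which all agents are content with the benchmarks `a`, `v`. -/
def contentState {I : Type*} {A : I → Type*} {p : RitelParams} (a : ∀ i, A i) (v : I → p.Bin) :
    RitelState A p := fun i => content (a i) (v i)

variable {I : Type*} {A : I → Type*} [∀ i, Fintype (A i)] [∀ i, DecidableEq (A i)]
  {g : RandomGame I A} {p : RitelParams} [Fintype I] [DecidableEq I] [∀ i, Nontrivial (A i)]
  (hG : ∀ w v : p.Bin, (w : ℕ) < v → 0 ≤ p.G (p.lower w) (p.lower v))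

include hG

/-- If all benchmark bins are near the mean utilities, all agents become content without
resistance. -/
theorem escapes_of_escapes_contentState (hnoise : 1 ≤ 2 * p.τ₀ * p.δ ^ 2) {a : ∀ i, A i}
    {v : I → p.Bin} (hnear : ∀ i, p.bin (g.mean i a) ∈ nearBins p (v i)) {r : ℝ} (hr : 0 ≤ r)
    (h : Escapes (g.ritel p) (fiber a v) r (contentState a v)) {x : RitelState A p}
    (hx : x ∈ fiber a v) : Escapes (g.ritel p) (fiber a v) r x := by
  refine Escapes.of_free_step hr (one_isBigO_ritel_pi hG a (fun i => {content (a i) (v i)})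
    (fun j b h => ?_) fun i => ?_) ?_
  · rw [fiber_benchmark hx j] at h
    exact Option.some.inj h
  · exact one_isBigO_agentStep_of_obs hG (g.one_isBigO_obsSetProb_near hnoise (hnear i))
      fun ε w hw y hy => updateProb_near (hx i) hw hy
  · intro y hy _
    have : y = contentState a v := funext fun i => hy i
    rwa [this]

omit [∀ i, Fintype (A i)] [∀ i, DecidableEq (A i)] [∀ i, Nontrivial (A i)] hG in
theorem sum_ite_add_ite_zero (i : I) (q : ℝ) :
    ∑ j : I, ((if j = i then (1 : ℝ) else 0) + if j = i then q else 0) = 1 + q := by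
  simp [Finset.sum_add_distrib]

omit [Fintype I] hG in
/-- Playing the profile in which agent `i` experiments with `b` costs one experiment. -/
theorem rpow_isBigO_actionProb_experiment {a : ∀ i, A i} {v : I → p.Bin} {x : RitelState A p}
    (hx : x ∈ fiber a v) {i : I} (hxi : x i = content (a i) (v i)) (hvi : (v i : ℕ) < p.K)
    {b : A i} (hb : b ≠ a i) (j : I) :
    (fun ε : ℝ => ε ^ (if j = i then (1 : ℝ) else 0)) =O[𝓝[>] 0]
      fun ε => (x j).actionProb p ε (Function.update a i b j) := by
  by_cases hj : j = i
  · subst hj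
    simp only [if_true, Function.update_self, hxi, Real.rpow_one]
    exact eps_isBigO_actionProb hvi hb
  · simp only [hj, if_false, Function.update_of_ne hj, Real.rpow_zero]
    refine one_isBigO_actionProb fun c hc => ?_
    rw [fiber_benchmark hx j] at hc
    exact Option.some.inj hc

/-- Leaving a profile by an experiment that improves the utility by more than `3δ`. -/
theorem escapes_contentState_of_improvement {a : ∀ i, A i} {v : I → p.Bin} {i : I}
    (hnear : p.bin (g.mean i a) ∈ nearBins p (v i)) {b : A i} (hb : b ≠ a i)
    (himp : g.mean i a + 3 * p.δ < g.mean i (Function.update a i b)) :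
    Escapes (g.ritel p) (fiber a v)
      (1 + p.G (g.mean i a + p.δ) (g.mean i (Function.update a i b) - p.δ)) (contentState a v) := by
  have hδ := p.δ_pos
  set a' := Function.update a i b with ha'
  have hM := g.mean_mem i a
  have hM' := g.mean_mem i a'
  have hv := lower_le_of_near hM.1 hnear
  -- An agent with benchmark bin `K` never experiments, so this has to be excluded; an improvement
  -- by more than 3δ leaves enough room below one.
  have hvK : (v i : ℕ) < p.K := p.val_lt_of_lower_lt_one (by linarith [hM'.2])
  have hhigh : ∀ w : p.Bin, p.bin (g.mean i a') ≤ w →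
      g.mean i a' - p.δ ≤ p.lower w ∧ (v i : ℕ) + 2 ≤ w := by
    intro w hw
    have h1 : p.lower (p.bin (g.mean i a')) ≤ p.lower w := by
      have h2 : ((p.bin (g.mean i a') : p.Bin) : ℕ) + 0 ≤ w := hw
      simpa using p.lower_add_le h2
    have h3 := lt_lower_bin_add (p := p) hM'.2
    refine ⟨by linarith, ?_⟩
    refine p.add_lt_of_lower_lt (m := 1) ?_
    push_cast
    linarith
  set q := p.G (g.mean i a + p.δ) (g.mean i a' - p.δ) with hq
  rw [← sum_ite_add_ite_zero i q]
  refine Escapes.of_exit (rpow_isBigO_ritel_pi hG a' (Function.update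
    (fun _ => Set.univ) i {s | s.bench ≠ some (a i, v i)}) _ _
    (rpow_isBigO_actionProb_experiment (fun i => rfl) rfl hvK hb) fun j => ?_) ?_
  · by_cases hj : j = i
    · subst hj
      simp only [if_true, Function.update_self]
      have hobs := g.one_isBigO_obsSetProb_ge p j a' (V := {w | p.bin (g.mean j a') ≤ w})
        fun w hw => hw
      have h1 := (isBigO_refl (fun ε : ℝ => ε ^ q) (𝓝[>] 0)).mul hobs
      simp only [mul_one] at h1
      refine h1.trans (isBigO_of_eventually_le ?_ ?_)
      · filter_upwards [eventually_mem_Ioo] with ε hε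
        exact mul_nonneg (Real.rpow_pos_of_pos hε.1 _).le (g.obsSetProb_nonneg p _ _ _ _)
      · filter_upwards [eventually_mem_Ioo] with ε hε
        refine mul_obsSetProb_le_agentStep hG hε.1 hε.2 fun w hw => ?_
        obtain ⟨hw1, hw2⟩ := hhigh w hw
        set T : Set (AgentState (A j) p.Bin) := {s | s.bench ≠ some (a j, v j)} with hT
        have h2 := Finset.single_le_sum
          (f := T.indicator ((contentState a v j).updateProb p ε (a' j) w))
          (fun y _ => Set.indicator_nonneg
            (fun y _ => updateProb_nonneg hG hε.1 hε.2 _ (a' j) w y) y)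
          (Finset.mem_univ (content b w))
        have hmem : content b w ∈ T := by simp [hT, bench, hb]
        rw [Set.indicator_of_mem hmem] at h2
        refine le_trans ?_ h2
        simp only [contentState, updateProb, ha', Function.update_self, hb, ne_eq,
          not_false_eq_true, if_true, hw2, choice, content.injEq, mul_one,
          false_and, if_false, mul_zero, add_zero]
        refine Real.rpow_le_rpow_of_exponent_ge hε.1 hε.2.le ?_
        -- The benchmark edge is at most `M + δ` and the observed edge at least `M' - δ`, so
        -- monotonicity of `G` bounds the actual acceptance resistance.
        exact (p.G_monotone_left _ hv).trans (p.G_antitone_right _ hw1)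
    · simp only [hj, if_false, Function.update_of_ne hj, Real.rpow_zero]
      exact one_isBigO_agentStep_of_forall hG fun _ _ _ _ => Set.mem_univ _
  · intro y hy hyF
    have := hy i
    rw [Function.update_self] at this
    exact this (hyF i)

/-- By interdependence, an agent with utility below `1 - δ` can, with two experiments, change the
benchmark of another agent. -/
theorem escapes_contentState_of_not_optimal (hinter : g.Interdependent (3 * p.δ))
    {a : ∀ i, A i} {v : I → p.Bin} (hnear : ∀ i, p.bin (g.mean i a) ∈ nearBins p (v i)) {i j₀ : I}
    (hj₀ : j₀ ≠ i) (hopt : g.mean i a < 1 - p.δ) :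
    Escapes (g.ritel p) (fiber a v) 2 (contentState a v) := by
  have hδ := p.δ_pos
  have hvK : (v i : ℕ) < p.K :=
    p.val_lt_of_lower_lt_one (by linarith [lower_le_of_near (g.mean_mem i a).1 (hnear i)])
  obtain ⟨k, hk, a', ha', hgap⟩ := hinter a {i} (Set.singleton_nonempty i)
    (fun h => hj₀ (by simpa using (h ▸ Set.mem_univ j₀ : j₀ ∈ ({i} : Set I))))
  have hki : k ≠ i := hk
  obtain ⟨b, rfl⟩ : ∃ b, a' = Function.update a i b := by
    refine ⟨a' i, funext fun j => ?_⟩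
    by_cases hj : j = i
    · subst hj
      simp
    · rw [Function.update_of_ne hj, ha' j hj]
  have hb : b ≠ a i := by
    rintro rfl
    simp only [Function.update_eq_self, sub_self, abs_zero] at hgap
    linarith
  set a' := Function.update a i b with hadef
  have hak : a' k = a k := Function.update_of_ne hki _ _
  have hM := g.mean_mem k a
  have hM' := g.mean_mem k a'
  -- The experiment of `i` shifts the mean of `k` by at least 3δ. Since the benchmark bin of `k` is
  -- off by at most one, the shifted observation is at least two bins away from it. Seen once it
  -- makes `k` hopeful or watchful, seen twice it ends the benchmark.
  obtain ⟨s₀, V, hs₀, hV, h1, h2⟩ : ∃ (s₀ : AgentState (A k) p.Bin) (V : Set p.Bin),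
      s₀.bench = some (a k, v k) ∧
      ((fun _ : ℝ => (1 : ℝ)) =O[𝓝[>] 0] fun ε => g.obsSetProb p (p.period ε) k a' V) ∧
      (∀ ε, ∀ w ∈ V, ∀ y, (content (a k) (v k)).updateProb p ε (a k) w y ≠ 0 → y = s₀) ∧
      (∀ ε, ∀ w ∈ V, ∀ y, s₀.updateProb p ε (a k) w y ≠ 0 → y.bench ≠ some (a k, v k)) := by
    rcases abs_cases (g.mean k a' - g.mean k a) with ⟨he, _⟩ | ⟨he, _⟩
    · refine ⟨hopeful (a k) (v k), {w | (v k : ℕ) + 2 ≤ w}, rfl,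
        g.one_isBigO_obsSetProb_ge p k a' fun w hw => ?_, fun ε w hw y hy => ?_,
        fun ε w hw y hy => ?_⟩
      · have h3 : p.lower (p.bin (g.mean k a')) ≤ p.lower w := by
          have h2 : ((p.bin (g.mean k a') : p.Bin) : ℕ) + 0 ≤ w := hw
          simpa using p.lower_add_le h2
        have h4 := lt_lower_bin_add (p := p) hM'.2
        have h5 := lower_le_of_near hM.1 (hnear k)
        refine p.add_lt_of_lower_lt (m := 1) ?_
        push_cast
        linarith
      · have hw' : (v k : ℕ) + 2 ≤ w := hw
        simpa [updateProb, hw'] using hy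
      · have hw' : (v k : ℕ) + 2 ≤ w := hw
        simp only [updateProb, hw', if_true, ne_eq, ite_eq_right_iff, one_ne_zero, imp_false,
          not_not] at hy
        subst hy
        simp only [bench, ne_eq, Option.some.injEq, Prod.mk.injEq, true_and]
        intro he
        rw [he] at hw'
        omega
    · refine ⟨watchful (a k) (v k), {w | (w : ℕ) + 2 ≤ v k}, rfl,
        g.one_isBigO_obsSetProb_le p k a' fun w hw => ?_, fun ε w hw y hy => ?_,
        fun ε w hw y hy => ?_⟩
      · have h3 : p.lower w ≤ p.lower (p.bin (g.mean k a')) := by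
          have h2 : (w : ℕ) + 0 ≤ ((p.bin (g.mean k a') : p.Bin) : ℕ) := hw
          simpa using p.lower_add_le h2
        have h4 := p.lower_bin_le hM'.1
        have h5 := lt_of_near hM.2 (hnear k)
        refine p.add_lt_of_lower_lt (m := 1) ?_
        push_cast
        linarith
      · have hw' : (w : ℕ) + 2 ≤ v k := hw
        have hw'' : ¬ (v k : ℕ) + 2 ≤ w := by omega
        simpa [updateProb, hw', hw''] using hy
      · have hw' : (w : ℕ) + 2 ≤ v k := hw
        have hw'' : ¬ (v k : ℕ) + 2 ≤ w := by omega
        simp only [updateProb, hw', hw'', if_true, if_false, ne_eq, ite_eq_right_iff, one_ne_zero,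
          imp_false, not_not] at hy
        subst hy
        simp [bench]
  have hzero : ∑ j : I, ((if j = i then (1 : ℝ) else 0) + if j = i then (0 : ℝ) else 0) = 1 := by
    rw [sum_ite_add_ite_zero, add_zero]
  have hfree : ∀ (x : RitelState A p) (T : ∀ j, Set (AgentState (A j) p.Bin)),
      (∀ j, (fun _ : ℝ => (1 : ℝ)) =O[𝓝[>] 0] fun ε => g.agentStep p ε j (x j) a' (T j)) →
      ∀ j, (fun ε : ℝ => ε ^ (if j = i then (0 : ℝ) else 0)) =O[𝓝[>] 0]
        fun ε => g.agentStep p ε j (x j) a' (T j) := by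
    intro x T h j
    simpa using h j
  have hsecond : ∀ y ∈ fiber a v, y i = content (a i) (v i) → y k = s₀ →
      Escapes (g.ritel p) (fiber a v) 1 y := by
    intro y hy hyi hyk
    rw [← hzero]
    refine Escapes.of_exit (rpow_isBigO_ritel_pi hG a' (Function.update
      (fun _ => Set.univ) k {s | s.bench ≠ some (a k, v k)}) _ _
      (rpow_isBigO_actionProb_experiment hy hyi hvK hb) (hfree _ _ fun j => ?_)) ?_
    · by_cases hj : j = k
      · subst hj
        rw [Function.update_self, hyk]
        refine one_isBigO_agentStep_of_obs hG hV ?_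
        rw [hak]
        exact h2
      · rw [Function.update_of_ne hj]
        exact one_isBigO_agentStep_of_forall hG fun _ _ _ _ => Set.mem_univ _
    · intro z hz hzF
      have := hz k
      rw [Function.update_self] at this
      exact this (hzF k)
  rw [show (2 : ℝ) = 1 + 1 by norm_num]
  -- After the first experiment, agent `i` has either accepted it, which already leaves the fiber,
  -- or is still content with its old benchmark and able to experiment again.
  let T : ∀ j, Set (AgentState (A j) p.Bin) := fun j =>
    {s | (j = i → s.bench = some (a j, v j) → s = content (a j) (v j)) ∧
      ∀ h : j = k, s = h ▸ s₀}
  have hstep := rpow_isBigO_ritel_pi (g := g) hG (x := contentState a v) a' T _ _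
    (rpow_isBigO_actionProb_experiment (fun i => rfl) rfl hvK hb)
    (hfree (contentState a v) T fun j => ?_)
  · rw [hzero] at hstep
    refine Escapes.step _ zero_le_one hstep fun y hy hyF => ?_
    exact hsecond y hyF ((hy i).1 rfl (hyF i)) ((hy k).2 rfl)
  · by_cases hj : j = k
    · subst hj
      refine one_isBigO_agentStep_of_obs hG hV fun ε w hw y hy => ⟨fun h => absurd h hki, fun _ => ?_⟩
      rw [hak] at hy
      exact h1 ε w hw y hy
    · refine one_isBigO_agentStep_of_forall hG fun ε w y hy => ⟨fun h hbench => ?_, fun h => absurd h hj⟩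
      subst h
      simp only [contentState, updateProb, hadef, Function.update_self, hb, ne_eq,
        not_false_eq_true, if_true] at hy
      split_ifs at hy with h3 h4
      · rcases choice_ne_zero hy with rfl | rfl
        · simp [bench, hb] at hbench
        · rfl
      · exact h4
      · exact absurd rfl hy

end RandomGame

/-! ### Masses of the states without and with discontent agents -/

namespace RandomGame

open Asymptotics AgentState

/-- Sum of the resistances of the non-discontent agents. -/
def totalCost {I : Type*} {A : I → Type*} [Fintype I] {p : RitelParams} (x : RitelState A p) : ℝ :=
  ∑ i, (x i).cost p

/-- Sum of the benchmark bins. -/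
def totalLevel {I : Type*} {A : I → Type*} [Fintype I] {p : RitelParams} (x : RitelState A p) : ℕ :=
  ∑ i, (x i).level

variable {I : Type*} {A : I → Type*} [∀ i, Fintype (A i)] [∀ i, DecidableEq (A i)]
  {g : RandomGame I A} {p : RitelParams} [Fintype I] [DecidableEq I]

theorem exists_updateProb_ne_zero {ε : ℝ} {x y : RitelState A p} (h : g.ritel p ε x y ≠ 0) (i : I) :
    ∃ a v, (x i).updateProb p ε a v (y i) ≠ 0 := by
  obtain ⟨a, -, ha⟩ := Finset.exists_ne_zero_of_sum_ne_zero h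
  have h1 := Finset.prod_ne_zero_iff.1 (right_ne_zero_of_mul ha) i (Finset.mem_univ i)
  obtain ⟨v, -, hv⟩ := Finset.exists_ne_zero_of_sum_ne_zero h1
  exact ⟨a i, v, right_ne_zero_of_mul hv⟩

theorem totalCost_le_of_ritel_ne_zero (hF : ∀ v, 0 ≤ p.F (p.lower v)) {ε : ℝ}
    {x y : RitelState A p} (h : g.ritel p ε x y ≠ 0) :
    totalCost y ≤ totalCost x + ∑ i, entryCost p (x i) (y i) := by
  rw [totalCost, totalCost, ← Finset.sum_add_distrib]
  refine Finset.sum_le_sum fun i _ => ?_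
  obtain ⟨a, v, hv⟩ := exists_updateProb_ne_zero h i
  exact cost_le_of_updateProb_ne_zero hF hv

omit [∀ i, Fintype (A i)] [DecidableEq I] in
theorem sum_entryCost_eq_zero {x : RitelState A p} (hx : ∀ i, x i ≠ discontent)
    (y : RitelState A p) : ∑ i, entryCost p (x i) (y i) = 0 :=
  Finset.sum_eq_zero fun i _ => by simp [entryCost, hx i]

theorem level_le_of_ritel_ne_zero {ε : ℝ} {x y : RitelState A p}
    (hy : ∀ i, y i ≠ discontent) (h : g.ritel p ε x y ≠ 0) (i : I) : (x i).level ≤ (y i).level := by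
  obtain ⟨a, v, hv⟩ := exists_updateProb_ne_zero h i
  cases hs : (x i).bench with
  | none => simp [level, hs]
  | some b =>
    obtain ⟨b, w⟩ := b
    rcases bench_of_updateProb_ne_zero hs hv with h | h | ⟨b', w', h, hw⟩
    · exact absurd h (hy i)
    · simp [level, hs, h]
    · simpa [level, hs, h] using hw.le

theorem totalLevel_le_of_ritel_ne_zero {ε : ℝ} {x y : RitelState A p}
    (hy : ∀ i, y i ≠ discontent) (h : g.ritel p ε x y ≠ 0) : totalLevel x ≤ totalLevel y :=
  Finset.sum_le_sum fun i _ => level_le_of_ritel_ne_zero hy h i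

theorem totalLevel_lt_of_ritel_ne_zero {ε : ℝ} {a : ∀ i, A i} {v : I → p.Bin}
    {x y : RitelState A p} (hx : x ∈ fiber a v) (hy : ∀ i, y i ≠ discontent) (hyF : y ∉ fiber a v)
    (h : g.ritel p ε x y ≠ 0) : totalLevel x < totalLevel y := by
  obtain ⟨i, hi⟩ : ∃ i, (y i).bench ≠ some (a i, v i) := by
    by_contra! hc
    exact hyF hc
  refine Finset.sum_lt_sum (fun i _ => level_le_of_ritel_ne_zero hy h i)
    ⟨i, Finset.mem_univ i, ?_⟩
  obtain ⟨c, w, hw⟩ := exists_updateProb_ne_zero h i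
  rcases bench_of_updateProb_ne_zero (hx i) hw with h | h | ⟨b', w', h, hlt⟩
  · exact absurd h (hy i)
  · exact absurd h hi
  · simpa [level, hx i, h] using hlt

variable [∀ i, Nontrivial (A i)]
  (hG : ∀ w v : p.Bin, (w : ℕ) < v → 0 ≤ p.G (p.lower w) (p.lower v))

include hG

/-- Experiments and observation errors are bounded by one here; only departures from discontent are
counted. -/
theorem ritel_isBigO_entryCost (x y : RitelState A p) :
    (fun ε => g.ritel p ε x y) =O[𝓝[>] 0] fun ε : ℝ => ε ^ (∑ i, entryCost p (x i) (y i)) := by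
  unfold ritel
  refine IsBigO.fun_sum fun a _ => ?_
  have e : (fun ε : ℝ => 1 * ∏ i, ε ^ entryCost p (x i) (y i)) =ᶠ[𝓝[>] 0]
      fun ε => ε ^ (∑ i, entryCost p (x i) (y i)) := by
    filter_upwards [self_mem_nhdsWithin] with ε hε
    rw [Real.rpow_sum_of_pos hε, one_mul]
  refine ((prod_actionProb_isBigO_one x a).mul (IsBigO.finsetProd fun i _ => ?_)).trans_eventuallyEq e
  refine isBigO_of_eventually_le ?_ ?_
  · filter_upwards [eventually_mem_Ioo] with ε hε
    exact Finset.sum_nonneg fun v _ => mul_nonneg (g.obsProb_nonneg p _ i a v)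
      (updateProb_nonneg hG hε.1 hε.2 _ _ v _)
  · filter_upwards [eventually_mem_Ioo] with ε hε
    rw [← one_mul (ε ^ entryCost p (x i) (y i)), ← g.sum_obsProb p (p.period ε) i a,
      Finset.sum_mul]
    exact Finset.sum_le_sum fun v _ => mul_le_mul_of_nonneg_left
      (updateProb_le_rpow_entryCost hG hε.1 hε.2 _ _ v _) (g.obsProb_nonneg p _ i a v)

variable (hF : ∀ v, 0 ≤ p.F (p.lower v)) {ν : ℝ → RitelState A p → ℝ}

include hF

/-- The form `w * ε ^ cost` of a bound on masses propagates along transitions, because the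
resistance of a step covers the growth of the cost. -/
theorem flow_isBigO_of_cost {x y : RitelState A p} {w : ℝ → ℝ} {t : ℝ}
    (hx : (fun ε => ν ε x) =O[𝓝[>] 0] fun ε : ℝ => w ε * ε ^ totalCost x)
    (ht : t ≤ totalCost y) :
    (fun ε => ν ε x * g.ritel p ε x y) =O[𝓝[>] 0] fun ε : ℝ => w ε * ε ^ t := by
  by_cases hle : totalCost y ≤ totalCost x + ∑ i, entryCost p (x i) (y i)
  · have h1 := hx.mul (ritel_isBigO_entryCost (g := g) hG x y)
    have e : (fun ε : ℝ => w ε * ε ^ totalCost x * ε ^ (∑ i, entryCost p (x i) (y i))) =ᶠ[𝓝[>] 0]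
        fun ε => w ε * ε ^ (totalCost x + ∑ i, entryCost p (x i) (y i)) := by
      filter_upwards [self_mem_nhdsWithin] with ε hε
      rw [Real.rpow_add hε, mul_assoc]
    exact (h1.trans_eventuallyEq e).trans
      ((isBigO_refl w _).mul (rpow_isBigO_rpow (ht.trans hle)))
  · have : (fun ε => ν ε x * g.ritel p ε x y) = fun _ => 0 := by
      funext ε
      rw [not_imp_comm.1 (totalCost_le_of_ritel_ne_zero hF) hle, mul_zero]
    rw [this]
    exact isBigO_zero _ _

variable (hP : ∀ᶠ ε in 𝓝[>] (0 : ℝ), g.ritel p ε ∈ Matrix.rowStochastic ℝ (RitelState A p))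
  (hν : ∀ᶠ ε in 𝓝[>] (0 : ℝ), IsSubStationary (g.ritel p ε) (ν ε))

include hP hν

/-- Mass of a state with a discontent agent, relative to the state with discontent agents only. -/
theorem mass_isBigO_of_discontent (hinter : g.Interdependent (3 * p.δ)) {x : RitelState A p}
    (hx : ∃ i, x i = discontent) :
    (fun ε => ν ε x) =O[𝓝[>] 0]
      fun ε : ℝ => ν ε (fun _ => discontent) * ε ^ totalCost x := by
  classical
  -- The cost is real valued, so the induction runs on the number of states of smaller cost.
  obtain ⟨n, hn⟩ : ∃ n, (Finset.univ.filter fun y : RitelState A p =>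
    totalCost y < totalCost x).card = n := ⟨_, rfl⟩
  induction n using Nat.strong_induction_on generalizing x with
  | _ n ih =>
  set D : RitelState A p := fun _ => discontent with hD
  have hDcost : totalCost D = 0 := by simp [totalCost, hD, cost, bench]
  have hDD : (fun ε => ν ε D) =O[𝓝[>] 0] fun ε : ℝ => ν ε D * ε ^ totalCost D := by
    simpa [hDcost] using isBigO_refl (fun ε => ν ε D) (𝓝[>] 0)
  by_cases hxD : x = D
  · rw [hxD]
    exact hDD
  -- As `x` leaves `L` freely, its mass is bounded by the inflow of `L`. This comes from D or from
  -- states of smaller cost; a smaller cost cannot rise without a discontent agent, and with one the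
  -- induction applies.
  let L : Set (RitelState A p) := {y | totalCost x ≤ totalCost y ∧ y ≠ D}
  have hDL : D ∉ L := fun h => h.2 rfl
  have hxL : x ∈ L := ⟨le_rfl, hxD⟩
  have hesc := (escapes_of_discontent (g := g) hG hinter hDL hx hxL).mul_rpow_isBigO hP hν hxL
  simp only [Real.rpow_zero, mul_one] at hesc
  refine hesc.trans (outflow_isBigO_of_inflow hP hν fun z hz y hy => ?_)
  by_cases hzD : z = D
  · rw [hzD]
    exact flow_isBigO_of_cost hG hF hDD hy.1
  · have hlt : totalCost z < totalCost x := by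
      by_contra! hc
      exact hz ⟨hc, hzD⟩
    by_cases hzd : ∃ i, z i = discontent
    · refine flow_isBigO_of_cost hG hF (ih _ ?_ hzd rfl) hy.1
      rw [← hn]
      refine Finset.card_lt_card ⟨fun m hm => ?_, fun hsub => ?_⟩
      · simp only [Finset.mem_filter, Finset.mem_univ, true_and] at hm ⊢
        exact hm.trans hlt
      · have := hsub (Finset.mem_filter.2 ⟨Finset.mem_univ z, hlt⟩)
        simp at this
    · push Not at hzd
      have : (fun ε => ν ε z * g.ritel p ε z y) = fun _ => 0 := by
        funext ε
        by_contra hne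
        have h1 := totalCost_le_of_ritel_ne_zero hF (right_ne_zero_of_mul hne)
        rw [sum_entryCost_eq_zero hzd, add_zero] at h1
        exact absurd (hy.1.trans h1) (not_le.2 hlt)
      rw [this]
      exact isBigO_zero _ _

/-- The flow through the states with given benchmarks. -/
theorem outflow_fiber_isBigO (hinter : g.Interdependent (3 * p.δ)) (a : ∀ i, A i) (v : I → p.Bin) :
    outflow (g.ritel p) ν (fiber a v) =O[𝓝[>] 0]
      fun ε : ℝ => ν ε (fun _ => discontent) * ε ^ ∑ i, p.F (p.lower (v i)) := by
  set t := ∑ i, p.F (p.lower (v i)) with ht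
  -- Without discontent agents the total level never falls and the cost never rises. Hence `Y` can
  -- be entered only from states with a discontent agent, where the mass bound is available.
  let Y : Set (RitelState A p) :=
    {y | (∀ i, y i ≠ discontent) ∧ totalLevel y ≤ ∑ i, (v i : ℕ) ∧ t ≤ totalCost y}
  have hlev : ∀ x ∈ fiber a v, totalLevel x = ∑ i, (v i : ℕ) := fun x hx =>
    Finset.sum_congr rfl fun i _ => by simp [level, hx i]
  have hcost : ∀ x ∈ fiber a v, totalCost x = t := fun x hx =>
    Finset.sum_congr rfl fun i _ => by simp [cost, hx i]
  have hact : ∀ x ∈ fiber a v, ∀ i, x i ≠ discontent := fun x hx i h => by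
    have := hx i
    simp [h, bench] at this
  -- Leaving the fiber makes an agent discontent or strictly raises the total level, so it also
  -- leaves `Y`.
  have h1 : outflow (g.ritel p) ν (fiber a v) =O[𝓝[>] 0] outflow (g.ritel p) ν Y := by
    refine outflow_isBigO fun x hx y hy => ?_
    by_cases hyY : y ∈ Y
    · have : (fun ε => ν ε x * g.ritel p ε x y) = fun _ => 0 := by
        funext ε
        by_contra hne
        have h2 := totalLevel_lt_of_ritel_ne_zero hx hyY.1 hy (right_ne_zero_of_mul hne)
        rw [hlev x hx] at h2
        exact absurd hyY.2.1 (not_le.2 h2)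
      rw [this]
      exact isBigO_zero _ _
    · exact flow_isBigO_outflow hP hν ⟨hact x hx, (hlev x hx).le, (hcost x hx).ge⟩ hyY
  refine h1.trans (outflow_isBigO_of_inflow hP hν fun z hz y hy => ?_)
  by_cases hzd : ∃ i, z i = discontent
  · exact flow_isBigO_of_cost hG hF (mass_isBigO_of_discontent hG hF hP hν hinter hzd) hy.2.2
  · push Not at hzd
    have : (fun ε => ν ε z * g.ritel p ε z y) = fun _ => 0 := by
      funext ε
      by_contra hne
      have hne' := right_ne_zero_of_mul hne
      have h2 := totalCost_le_of_ritel_ne_zero hF hne'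
      rw [sum_entryCost_eq_zero hzd, add_zero] at h2
      exact hz ⟨hzd, (totalLevel_le_of_ritel_ne_zero hy.1 hne').trans hy.2.1, hy.2.2.trans h2⟩
    rw [this]
    exact isBigO_zero _ _

/-- Mass of a state that leaves its benchmarks at resistance `r`. -/
theorem mass_isBigO_of_escapes (hinter : g.Interdependent (3 * p.δ)) {a : ∀ i, A i}
    {v : I → p.Bin} {x : RitelState A p} (hx : x ∈ fiber a v) {r : ℝ}
    (h : Escapes (g.ritel p) (fiber a v) r x) :
    (fun ε => ν ε x) =O[𝓝[>] 0]
      fun ε : ℝ => ν ε (fun _ => discontent) * ε ^ (∑ i, p.F (p.lower (v i)) - r) := by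
  have h1 := (h.mul_rpow_isBigO hP hν hx).trans (outflow_fiber_isBigO hG hF hP hν hinter a v)
  have h2 := h1.mul (isBigO_refl (fun ε : ℝ => ε ^ (-r)) (𝓝[>] 0))
  refine (Filter.EventuallyEq.trans_isBigO ?_ h2).trans_eventuallyEq ?_
  · filter_upwards [self_mem_nhdsWithin] with ε hε
    have hε' : (0 : ℝ) < ε := hε
    rw [mul_assoc, ← Real.rpow_add hε', add_neg_cancel, Real.rpow_zero, mul_one]
  · filter_upwards [self_mem_nhdsWithin] with ε hε
    have hε' : (0 : ℝ) < ε := hε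
    rw [mul_assoc, ← Real.rpow_add hε', sub_eq_add_neg]

end RandomGame

/-! ### Mass of the discontent state -/

section Flow

open Asymptotics

variable {X : Type*} [Fintype X] [DecidableEq X] {P : ℝ → Matrix X X ℝ} {ν : ℝ → X → ℝ}

theorem flow_isBigO_inflow (hP : ∀ᶠ ε in 𝓝[>] (0 : ℝ), P ε ∈ Matrix.rowStochastic ℝ X)
    (hν : ∀ᶠ ε in 𝓝[>] (0 : ℝ), IsSubStationary (P ε) (ν ε)) {L : Set X} {x y : X}
    (hx : x ∉ L) (hy : y ∈ L) :
    (fun ε => ν ε x * P ε x y) =O[𝓝[>] 0] outflow P ν L := by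
  refine (flow_isBigO_outflow (L := Lᶜ) hP hν hx (by simpa using hy)).trans_eventuallyEq ?_
  filter_upwards [hP, hν] with ε h1 h2
  rw [outflow_eq_sum_inflow h1 h2 Lᶜ, outflow]
  refine Finset.sum_congr rfl fun x _ => Finset.sum_congr rfl fun y _ => ?_
  by_cases hx : x ∈ L <;> by_cases hy : y ∈ L <;> simp [hx, hy]

omit [DecidableEq X] in
theorem mass_isBigO_one (hν : ∀ᶠ ε in 𝓝[>] (0 : ℝ), IsSubStationary (P ε) (ν ε)) (x : X) :
    (fun ε => ν ε x) =O[𝓝[>] 0] fun _ : ℝ => (1 : ℝ) := by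
  refine isBigO_of_eventually_le ?_ ?_
  · filter_upwards [hν] with ε h using h.nonneg x
  · filter_upwards [hν] with ε h
    exact (Finset.single_le_sum (fun y _ => h.nonneg y) (Finset.mem_univ x)).trans h.sum_le

theorem outflow_nonneg (hP : ∀ᶠ ε in 𝓝[>] (0 : ℝ), P ε ∈ Matrix.rowStochastic ℝ X)
    (hν : ∀ᶠ ε in 𝓝[>] (0 : ℝ), IsSubStationary (P ε) (ν ε)) (L : Set X) :
    ∀ᶠ ε in 𝓝[>] (0 : ℝ), 0 ≤ outflow P ν L ε := by
  filter_upwards [hP, hν] with ε h1 h2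
  refine Finset.sum_nonneg fun x _ => Finset.sum_nonneg fun y _ => ?_
  split_ifs
  · exact mul_nonneg (h2.nonneg x) (Matrix.nonneg_of_mem_rowStochastic h1)
  · exact le_rfl

/-- For small ε the term `ε * f` is absorbed into the left-hand side. -/
theorem isBigO_of_isBigO_add_eps_mul {f u : ℝ → ℝ} (hf : ∀ᶠ ε in 𝓝[>] (0 : ℝ), 0 ≤ f ε)
    (hu : ∀ᶠ ε in 𝓝[>] (0 : ℝ), 0 ≤ u ε) (h : f =O[𝓝[>] 0] fun ε => u ε + ε * f ε) :
    f =O[𝓝[>] 0] u := by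
  obtain ⟨c, hc, hb⟩ := h.exists_pos
  refine IsBigO.of_bound (2 * c) ?_
  have hsmall : ∀ᶠ ε : ℝ in 𝓝[>] 0, ε ∈ Set.Ioo (0 : ℝ) (1 / (2 * c)) :=
    Ioo_mem_nhdsGT (by positivity)
  filter_upwards [hf, hu, hb.bound, hsmall] with ε h1 h2 h3 h4
  rw [Real.norm_of_nonneg h1, Real.norm_of_nonneg (add_nonneg h2 (mul_nonneg h4.1.le h1))] at h3
  rw [Real.norm_of_nonneg h1, Real.norm_of_nonneg h2]
  have h5 : c * ε ≤ 1 / 2 := by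
    have := h4.2.le
    rw [le_div_iff₀ (by positivity)] at this
    linarith
  nlinarith

end Flow

/-! ### Persistence of good benchmarks and the mass of D -/

namespace RandomGame

open Asymptotics AgentState

variable {I : Type*} {A : I → Type*} [∀ i, Fintype (A i)] [∀ i, DecidableEq (A i)]
  {g : RandomGame I A} {p : RitelParams} [Fintype I] [DecidableEq I] [∀ i, Nontrivial (A i)]

omit [DecidableEq I] in
theorem prod_actionProb_isBigO_eps {x : RitelState A p} {a a' : ∀ i, A i}
    (hx : ∀ i, (x i).benchmark = some (a i)) {i : I} (hi : a' i ≠ a i) :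
    (fun ε => ∏ i, (x i).actionProb p ε (a' i)) =O[𝓝[>] 0] fun ε : ℝ => ε := by
  classical
  have h := IsBigO.finsetProd (s := Finset.univ.erase i) fun j _ =>
    actionProb_isBigO_one (x j) (a' j)
  have h1 := (actionProb_isBigO_eps (hx i) hi).mul h
  simp only [Finset.prod_const_one, mul_one] at h1
  refine h1.congr_left fun ε => ?_
  exact Finset.mul_prod_erase Finset.univ (fun i => (x i).actionProb p ε (a' i)) (Finset.mem_univ i)

omit [DecidableEq I] in
theorem prod_actionProb_isBigO_eps_mul_eps {x : RitelState A p} {a a' : ∀ i, A i}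
    (hx : ∀ i, (x i).benchmark = some (a i)) {i j : I} (hij : i ≠ j) (hi : a' i ≠ a i)
    (hj : a' j ≠ a j) :
    (fun ε => ∏ i, (x i).actionProb p ε (a' i)) =O[𝓝[>] 0] fun ε : ℝ => ε * ε := by
  classical
  have h := IsBigO.finsetProd (s := (Finset.univ.erase i).erase j) fun k _ =>
    actionProb_isBigO_one (x k) (a' k)
  have h1 := (actionProb_isBigO_eps (hx i) hi).mul ((actionProb_isBigO_eps (hx j) hj).mul h)
  simp only [Finset.prod_const_one, mul_one] at h1
  refine h1.congr_left fun ε => ?_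
  rw [Finset.mul_prod_erase (Finset.univ.erase i) (fun i => (x i).actionProb p ε (a' i))
      (by simp [hij.symm]),
    Finset.mul_prod_erase Finset.univ (fun i => (x i).actionProb p ε (a' i)) (Finset.mem_univ i)]

omit [DecidableEq I] [Fintype I] [∀ i, Nontrivial (A i)] [∀ i, DecidableEq (A i)] in
theorem sum_indicator_choice {i : I} [DecidableEq (AgentState (A i) p.Bin)]
    (T : Set (AgentState (A i) p.Bin)) {q : ℝ} {s t : AgentState (A i) p.Bin} (hs : s ∈ T)
    (ht : t ∉ T) : ∑ y, T.indicator (choice q s t) y = q := by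
  have e : ∀ y, T.indicator (choice q s t) y = if y = s then q else 0 := by
    intro y
    by_cases hy : y ∈ T
    · have : y ≠ t := fun h => ht (h ▸ hy)
      simp [hy, choice, this]
    · have : y ≠ s := fun h => hy (h ▸ hs)
      simp [hy, this]
  simp [e]

variable (hG : ∀ w v : p.Bin, (w : ℕ) < v → 0 ≤ p.G (p.lower w) (p.lower v))

include hG

omit [∀ i, Nontrivial (A i)] hG in
/-- Upper bound for a transition probability through the move of a single agent. -/
theorem ritel_isBigO_of_coord
    (hP : ∀ᶠ ε in 𝓝[>] (0 : ℝ), g.ritel p ε ∈ Matrix.rowStochastic ℝ (RitelState A p))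
    {x y : RitelState A p} {i : I} {T : Set (AgentState (A i) p.Bin)} (hy : y i ∈ T) {w : ℝ → ℝ}
    (h : ∀ a : ∀ i, A i, (fun ε => (∏ i, (x i).actionProb p ε (a i)) *
      g.agentStep p ε i (x i) a T) =O[𝓝[>] 0] w) :
    (fun ε => g.ritel p ε x y) =O[𝓝[>] 0] w := by
  have h1 : (fun ε => ∑ z, {z : RitelState A p | z i ∈ T}.indicator (g.ritel p ε x) z) =O[𝓝[>] 0]
      w := by
    simp_rw [sum_indicator_ritel_coord]
    exact IsBigO.fun_sum fun a _ => h a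
  refine IsBigO.trans (isBigO_of_eventually_le ?_ ?_) h1
  · filter_upwards [hP] with ε hε using Matrix.nonneg_of_mem_rowStochastic hε
  · filter_upwards [hP] with ε hε
    have := Finset.single_le_sum
      (f := {z : RitelState A p | z i ∈ T}.indicator (g.ritel p ε x))
      (fun z _ => Set.indicator_nonneg (fun z _ => Matrix.nonneg_of_mem_rowStochastic hε) z)
      (Finset.mem_univ y)
    rwa [Set.indicator_of_mem (by exact hy)] at this

/-- With good benchmark bins, all agents become content up to an event of resistance one. -/
theorem ritel_isBigO_eps
    (hP : ∀ᶠ ε in 𝓝[>] (0 : ℝ), g.ritel p ε ∈ Matrix.rowStochastic ℝ (RitelState A p))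
    (hnoise : 1 ≤ 2 * p.τ₀ * p.δ ^ 2) {a : ∀ i, A i} {v : I → p.Bin}
    (hv : ∀ i, g.GoodBin p i a (v i)) {x y : RitelState A p} (hx : x ∈ fiber a v)
    (hy : y ≠ contentState a v) : (fun ε => g.ritel p ε x y) =O[𝓝[>] 0] fun ε : ℝ => ε := by
  obtain ⟨i, hi⟩ := Function.ne_iff.1 hy
  refine ritel_isBigO_of_coord hP (T := {contentState a v i}ᶜ) hi fun a' => ?_
  by_cases ha : a' = a
  · subst ha
    have h1 : (fun ε => g.agentStep p ε i (x i) a' {contentState a' v i}ᶜ) =O[𝓝[>] 0]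
        fun ε : ℝ => 2 * ε := by
      refine isBigO_of_eventually_le ?_ ?_
      · filter_upwards [eventually_mem_Ioo] with ε hε using agentStep_nonneg hG hε.1 hε.2 _ _ _ _
      · filter_upwards [eventually_mem_Ioo] with ε hε
        refine (agentStep_le_obsSetProb hG hε.1 hε.2 (V := (nearBins p (v i))ᶜ)
          fun w hw z hz => ?_).trans (g.obsSetProb_compl_near_le hnoise (hv i) hε.1 hε.2)
        by_contra hne
        exact hz (updateProb_near (hx i) (by simpa using hw) hne)
    simpa using ((prod_actionProb_isBigO_one x a').mul h1).trans
      (by simpa using isBigO_const_mul_self (2 : ℝ) (fun ε : ℝ => ε) (𝓝[>] 0))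
  · obtain ⟨j, hj⟩ := Function.ne_iff.1 ha
    simpa using (prod_actionProb_isBigO_eps (fiber_benchmark hx) hj).mul
      (agentStep_isBigO_one (g := g) hG (x i) a' _)

omit [Fintype I] [∀ i, Nontrivial (A i)] in
/-- Resistance of accepting an experiment. -/
theorem agentStep_experiment_isBigO (hnoise : 1 ≤ 2 * p.τ₀ * p.δ ^ 2) {a : ∀ i, A i}
    {v : I → p.Bin} (hv : ∀ i, g.GoodBin p i a (v i)) {γ : ℝ} (hγ1 : γ ≤ 1) {i : I} {b : A i}
    (hb : b ≠ a i)
    (hγ : g.mean i a < g.mean i (Function.update a i b) →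
      γ ≤ p.G (g.mean i a - p.δ) (g.mean i (Function.update a i b) + p.δ)) :
    (fun ε => g.agentStep p ε i (content (a i) (v i)) (Function.update a i b)
      {s | s.bench ≠ some (a i, v i)}) =O[𝓝[>] 0] fun ε : ℝ => ε ^ max γ 0 := by
  set a' := Function.update a i b with ha'
  have hai : a' i = b := Function.update_self _ _ _
  have hγ0 : max γ 0 ≤ 1 := max_le hγ1 zero_le_one
  unfold agentStep
  refine IsBigO.fun_sum fun w _ => ?_
  have hobs1 : (fun ε => g.obsProb p (p.period ε) i a' w) =O[𝓝[>] 0] fun _ : ℝ => (1 : ℝ) :=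
    isBigO_of_eventually_le (Filter.Eventually.of_forall fun ε => g.obsProb_nonneg p _ i a' w)
      (Filter.Eventually.of_forall fun ε => g.obsProb_le_one p _ i a' w)
  by_cases hw : (v i : ℕ) + 2 ≤ w
  · have e : ∀ ε, ∑ y, {s : AgentState (A i) p.Bin | s.bench ≠ some (a i, v i)}.indicator
        ((content (a i) (v i)).updateProb p ε (a' i) w) y = ε ^ p.G (p.lower (v i)) (p.lower w) := by
      intro ε
      have e1 : (content (a i) (v i)).updateProb p ε (a' i) w =
          choice (ε ^ p.G (p.lower (v i)) (p.lower w)) (content b w) (content (a i) (v i)) := by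
        funext y
        simp [updateProb, hai, hb, hw]
      rw [e1]
      exact sum_indicator_choice _ (by simp [bench, hb]) (by simp [bench])
    simp_rw [e]
    have hG0 : 0 ≤ p.G (p.lower (v i)) (p.lower w) := hG _ _ (by omega)
    -- For an improving experiment with an honest observation, monotonicity compares with `G(M - δ,
    -- M' + δ)`. In all other cases the observed edge is at least `M' + δ`, an error of resistance
    -- one, which suffices because `γ ≤ 1`.
    by_cases hcase : g.mean i a < g.mean i a' ∧ p.lower w ≤ g.mean i a' + p.δ
    · have h1 : γ ≤ p.G (p.lower (v i)) (p.lower w) :=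
        (hγ hcase.1).trans ((p.G_antitone_right _ hcase.2).trans
          (p.G_monotone_left _ (by linarith [(hv i).2])))
      simpa using hobs1.mul (rpow_isBigO_rpow (max_le h1 hG0))
    · have h1 : g.mean i a' + p.δ ≤ p.lower w := by
        by_cases h2 : g.mean i a < g.mean i a'
        · by_contra! h3
          exact hcase ⟨h2, h3.le⟩
        · have h3 := p.lower_add_le (m := 2) hw
          push_cast at h3
          linarith [(hv i).2]
      have h2 : (fun ε => g.obsProb p (p.period ε) i a' w) =O[𝓝[>] 0] fun ε : ℝ => ε ^ (1 : ℝ) := by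
        refine isBigO_of_eventually_le
          (Filter.Eventually.of_forall fun ε => g.obsProb_nonneg p _ i a' w) ?_
        filter_upwards [eventually_mem_Ioo] with ε hε
        rw [Real.rpow_one]
        exact (g.obsProb_le_obsSetProb p _ i a' (Set.mem_singleton w)).trans
          (g.obsSetProb_high_le_eps hnoise i a' (by rintro _ rfl; exact h1) hε.1 hε.2)
      have h3 : (fun ε : ℝ => ε ^ p.G (p.lower (v i)) (p.lower w)) =O[𝓝[>] 0]
          fun _ => (1 : ℝ) := by simpa using rpow_isBigO_rpow hG0
      simpa using (h2.trans (rpow_isBigO_rpow hγ0)).mul h3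
  · have e : ∀ ε, ∑ y, {s : AgentState (A i) p.Bin | s.bench ≠ some (a i, v i)}.indicator
        ((content (a i) (v i)).updateProb p ε (a' i) w) y = 0 := by
      intro ε
      refine Finset.sum_eq_zero fun y _ => ?_
      by_cases hy : y = content (a i) (v i)
      · simp [hy, bench]
      · simp [Set.indicator, updateProb, hai, hb, hw, hy]
    simp_rw [e, mul_zero]
    exact isBigO_zero _ _

/-- Resistance of changing good benchmarks when all agents are content. -/
theorem ritel_contentState_isBigO
    (hP : ∀ᶠ ε in 𝓝[>] (0 : ℝ), g.ritel p ε ∈ Matrix.rowStochastic ℝ (RitelState A p))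
    (hnoise : 1 ≤ 2 * p.τ₀ * p.δ ^ 2) {a : ∀ i, A i} {v : I → p.Bin}
    (hv : ∀ i, g.GoodBin p i a (v i)) {γ : ℝ} (hγ1 : γ ≤ 1)
    (hγ : ∀ i, ∀ b ≠ a i, g.mean i a < g.mean i (Function.update a i b) →
      γ ≤ p.G (g.mean i a - p.δ) (g.mean i (Function.update a i b) + p.δ))
    {y : RitelState A p} (hy : y ∉ fiber a v) :
    (fun ε => g.ritel p ε (contentState a v) y) =O[𝓝[>] 0] fun ε : ℝ => ε ^ (1 + max γ 0) := by
  have hx : contentState a v ∈ fiber a v := fun i => rfl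
  have hγ0 : max γ 0 ≤ 1 := max_le hγ1 zero_le_one
  obtain ⟨i, hi⟩ : ∃ i, (y i).bench ≠ some (a i, v i) := by
    by_contra! hc
    exact hy hc
  have hsplit : (fun ε : ℝ => ε * ε ^ max γ 0) =ᶠ[𝓝[>] 0] fun ε => ε ^ (1 + max γ 0) := by
    filter_upwards [self_mem_nhdsWithin] with ε hε
    have hε' : (0 : ℝ) < ε := hε
    rw [Real.rpow_add hε', Real.rpow_one]
  refine ritel_isBigO_of_coord hP (T := {s | s.bench ≠ some (a i, v i)}) hi fun a' => ?_
  -- A content agent that plays its benchmark action keeps its benchmark. So `i` experiments, and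
  -- then either a second agent experiments too, at total resistance two, or `i` is alone and has to
  -- accept.
  by_cases hai : a' i = a i
  · have h0 : ∀ᶠ ε : ℝ in 𝓝[>] 0, g.agentStep p ε i (contentState a v i) a'
        {s | s.bench ≠ some (a i, v i)} = 0 := by
      filter_upwards [eventually_mem_Ioo] with ε hε
      refine le_antisymm ?_ (agentStep_nonneg hG hε.1 hε.2 _ _ _ _)
      refine (agentStep_le_obsSetProb hG hε.1 hε.2 (V := ∅) fun w _ z hz => ?_).trans
        (by simp [obsSetProb])
      by_contra hne
      simp only [contentState, updateProb, hai, ne_eq, not_true_eq_false, if_false] at hne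
      split_ifs at hne with h1 h2 h3 h4 h5
      all_goals first
        | exact hne rfl
        | (subst_vars; exact hz rfl)
    have e : (fun ε => (∏ i, (contentState a v i).actionProb p ε (a' i)) *
        g.agentStep p ε i (contentState a v i) a' {s | s.bench ≠ some (a i, v i)}) =ᶠ[𝓝[>] 0]
        fun _ => (0 : ℝ) := by
      filter_upwards [h0] with ε hε
      rw [hε, mul_zero]
    exact e.trans_isBigO (isBigO_zero _ _)
  · by_cases hother : ∃ j, i ≠ j ∧ a' j ≠ a j
    · obtain ⟨j, hij, hj⟩ := hother
      have h1 := (prod_actionProb_isBigO_eps_mul_eps (fiber_benchmark hx) hij hai hj).mul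
        (agentStep_isBigO_one (g := g) hG (contentState a v i) a' {s | s.bench ≠ some (a i, v i)})
      simp only [mul_one] at h1
      refine (h1.trans ((isBigO_refl (fun ε : ℝ => ε) (𝓝[>] 0)).mul ?_)).trans_eventuallyEq hsplit
      simpa using rpow_isBigO_rpow hγ0
    · push Not at hother
      have ha' : a' = Function.update a i (a' i) := by
        funext j
        by_cases hj : j = i
        · subst hj
          simp
        · rw [Function.update_of_ne hj, hother j (Ne.symm hj)]
      have h1 := agentStep_experiment_isBigO hG hnoise hv hγ1 hai (hγ i _ hai)
      rw [← ha'] at h1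
      exact ((prod_actionProb_isBigO_eps (fiber_benchmark hx) hai).mul h1).trans_eventuallyEq hsplit

variable (hF : ∀ v, 0 ≤ p.F (p.lower v)) {ν : ℝ → RitelState A p → ℝ}

include hF

/-- From the discontent state, the profile `a` with good benchmark bins is reached at resistance
`∑ i, f i`. -/
theorem rpow_isBigO_ritel_discontent (a : ∀ i, A i) {f : I → ℝ}
    (hf : ∀ i v, g.GoodBin p i a v → p.F (p.lower v) ≤ f i) :
    (fun ε : ℝ => ε ^ ∑ i, f i) =O[𝓝[>] 0] fun ε => ∑ y, {y : RitelState A p |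
      ∀ i, y i ∈ {s | ∃ v, g.GoodBin p i a v ∧ s = content (a i) v}}.indicator
        (g.ritel p ε fun _ => discontent) y := by
  have h := rpow_isBigO_ritel_pi (g := g) hG (x := fun _ => discontent) a
    (fun i => {s | ∃ v, g.GoodBin p i a v ∧ s = content (a i) v}) (fun _ => 0) f
    (fun i => ?_) fun i => ?_
  · simpa using h
  · have h1 := one_isBigO_actionProb (p := p) (s := discontent) (a := a i)
      (fun b hb => by simp [benchmark] at hb)
    simpa using h1
  have hfi : 0 ≤ f i := by
    have hgood : g.GoodBin p i a (p.bin (g.mean i a)) :=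
      ⟨p.lower_bin_le (g.mean_mem i a).1, (lt_lower_bin_add (g.mean_mem i a).2).le⟩
    exact (hF _).trans (hf i _ hgood)
  have h1 := ((isBigO_refl (fun ε : ℝ => ε ^ f i) (𝓝[>] 0)).const_mul_right p.cF_mem.1.ne').mul
    (g.one_isBigO_obsSetProb_good (p := p) i a)
  simp only [mul_one] at h1
  refine h1.trans (isBigO_of_eventually_le ?_ ?_)
  · filter_upwards [eventually_mem_Ioo] with ε hε
    exact mul_nonneg (mul_nonneg p.cF_mem.1.le (Real.rpow_pos_of_pos hε.1 _).le)
      (g.obsSetProb_nonneg p _ _ _ _)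
  · filter_upwards [eventually_mem_Ioo] with ε hε
    refine mul_obsSetProb_le_agentStep hG hε.1 hε.2 fun w hw => ?_
    set T : Set (AgentState (A i) p.Bin) := {s | ∃ v, g.GoodBin p i a v ∧ s = content (a i) v}
    have e : updateProb p ε discontent (a i) w =
        choice (min (ε ^ p.F (p.lower w)) p.cF) (content (a i) w) discontent := rfl
    rw [e, sum_indicator_choice T ⟨w, hw, rfl⟩ (by rintro ⟨_, _, h⟩; simp at h)]
    have h2 : 0 < ε ^ f i := Real.rpow_pos_of_pos hε.1 _
    have h3 : ε ^ f i ≤ 1 := Real.rpow_le_one hε.1.le hε.2.le hfi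
    have h4 : ε ^ f i ≤ ε ^ p.F (p.lower w) :=
      Real.rpow_le_rpow_of_exponent_ge hε.1 hε.2.le (hf i w hw)
    refine le_min ?_ (mul_le_of_le_one_right p.cF_mem.1.le h3)
    exact (mul_le_of_le_one_left h2.le p.cF_mem.2.le).trans h4

/-- The mass of the discontent state is bounded through any action profile. -/
theorem mass_discontent_isBigO
    (hP : ∀ᶠ ε in 𝓝[>] (0 : ℝ), g.ritel p ε ∈ Matrix.rowStochastic ℝ (RitelState A p))
    (hν : ∀ᶠ ε in 𝓝[>] (0 : ℝ), IsSubStationary (g.ritel p ε) (ν ε)) [Nonempty I]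
    (hnoise : 1 ≤ 2 * p.τ₀ * p.δ ^ 2) (a : ∀ i, A i) {f : I → ℝ}
    (hf : ∀ i v, g.GoodBin p i a v → p.F (p.lower v) ≤ f i) {γ : ℝ} (hγ1 : γ ≤ 1)
    (hγ : ∀ i, ∀ b ≠ a i, g.mean i a < g.mean i (Function.update a i b) →
      γ ≤ p.G (g.mean i a - p.δ) (g.mean i (Function.update a i b) + p.δ)) :
    (fun ε => ν ε fun _ => discontent) =O[𝓝[>] 0]
      fun ε : ℝ => ε ^ (1 + max γ 0 - ∑ i, f i) := by
  set D : RitelState A p := fun _ => discontent with hD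
  have hγ0 : max γ 0 ≤ 1 := max_le hγ1 zero_le_one
  -- All good bins are collected because the means may be bin edges, in which case the bin observed
  -- when leaving D is not determined.
  let B : Set (RitelState A p) := {x | ∃ v, (∀ i, g.GoodBin p i a (v i)) ∧ x ∈ fiber a v}
  have hDB : D ∉ B := by
    rintro ⟨v, -, h⟩
    have := h (Classical.arbitrary I)
    simp [hD, bench] at this
  have hin : (fun ε => ν ε D * ε ^ ∑ i, f i) =O[𝓝[>] 0] outflow (g.ritel p) ν B := by
    refine ((isBigO_refl (fun ε => ν ε D) _).mul
      (rpow_isBigO_ritel_discontent (g := g) hG hF a hf)).trans ?_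
    simp_rw [Finset.mul_sum]
    refine IsBigO.fun_sum fun y _ => ?_
    by_cases hy : ∀ i, y i ∈ {s | ∃ v, g.GoodBin p i a v ∧ s = content (a i) v}
    · have hyB : y ∈ B := by
        choose v hv1 hv2 using hy
        exact ⟨v, hv1, fun i => by rw [hv2 i]; rfl⟩
      refine (flow_isBigO_inflow hP hν hDB hyB).congr_left fun ε => ?_
      rw [Set.indicator_of_mem (by exact hy)]
    · refine (isBigO_zero _ _).congr_left fun ε => ?_
      rw [Set.indicator_of_notMem (by exact hy), mul_zero]
  -- The outflow is bounded by itself times ε, plus the wanted term, and the former is then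
  -- absorbed.
  have hout : outflow (g.ritel p) ν B =O[𝓝[>] 0]
      fun ε : ℝ => ε ^ (1 + max γ 0) + ε * outflow (g.ritel p) ν B ε := by
    have hnn := outflow_nonneg hP hν B
    have hl : (fun ε : ℝ => ε ^ (1 + max γ 0)) =O[𝓝[>] 0]
        fun ε : ℝ => ε ^ (1 + max γ 0) + ε * outflow (g.ritel p) ν B ε := by
      refine isBigO_of_eventually_le ?_ ?_
      · filter_upwards [eventually_mem_Ioo] with ε hε using (Real.rpow_pos_of_pos hε.1 _).le
      · filter_upwards [eventually_mem_Ioo, hnn] with ε hε h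
        exact le_add_of_nonneg_right (mul_nonneg hε.1.le h)
    have hr : (fun ε : ℝ => ε * outflow (g.ritel p) ν B ε) =O[𝓝[>] 0]
        fun ε : ℝ => ε ^ (1 + max γ 0) + ε * outflow (g.ritel p) ν B ε := by
      refine isBigO_of_eventually_le ?_ ?_
      · filter_upwards [eventually_mem_Ioo, hnn] with ε hε h using mul_nonneg hε.1.le h
      · filter_upwards [eventually_mem_Ioo] with ε hε
        exact le_add_of_nonneg_left (Real.rpow_pos_of_pos hε.1 _).le
    have hεε : (fun ε : ℝ => ε * ε) =O[𝓝[>] 0] fun ε : ℝ => ε ^ (1 + max γ 0) := by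
      have h2 := rpow_isBigO_rpow (s := 2) (t := 1 + max γ 0) (by linarith)
      refine h2.congr_left fun ε => ?_
      rw [Real.rpow_two, sq]
    refine outflow_isBigO fun x hx y hy => ?_
    obtain ⟨v, hv, hxv⟩ := hx
    have hyv : y ∉ fiber a v := fun h => hy ⟨v, hv, h⟩
    by_cases hxc : x = contentState a v
    · rw [hxc]
      have h1 := (mass_isBigO_one hν (contentState a v)).mul
        (ritel_contentState_isBigO hG hP hnoise hv hγ1 hγ hyv)
      simp only [one_mul] at h1
      exact h1.trans hl
    · have hyc : y ≠ contentState a v := fun h => hyv (h ▸ fun i => rfl)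
      have hPxy := ritel_isBigO_eps hG hP hnoise hv hxv hyc
      -- A state of `B` with an agent that is not content leaves at resistance one only, but it is
      -- also rare: it is reached either from inside `B` at resistance one, giving two in total, or
      -- by the flow into `B`, which equals the outflow.
      have hνx : (fun ε => ν ε x) =ᶠ[𝓝[>] 0] fun ε => ∑ z, ν ε z * g.ritel p ε z x := by
        filter_upwards [hν] with ε h
        conv_lhs => rw [← h.stat]
        rfl
      have h1 : (fun ε => ν ε x * g.ritel p ε x y) =O[𝓝[>] 0]
          fun ε => ∑ z, ν ε z * g.ritel p ε z x * ε := by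
        have := (hνx.isBigO.mul hPxy)
        refine this.congr_right fun ε => ?_
        rw [Finset.sum_mul]
      refine h1.trans (IsBigO.fun_sum fun z _ => ?_)
      by_cases hz : z ∈ B
      · obtain ⟨v', hv', hzv⟩ := hz
        have hxz : x ≠ contentState a v' := by
          intro h
          apply hxc
          have : v' = v := funext fun i => by
            have h1 := hxv i
            rw [h] at h1
            simpa [contentState, bench] using h1
          rw [h, this]
        have h2 := ((mass_isBigO_one hν z).mul (ritel_isBigO_eps hG hP hnoise hv' hzv hxz)).mul
          (isBigO_refl (fun ε : ℝ => ε) (𝓝[>] 0))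
        simp only [one_mul] at h2
        exact (h2.trans hεε).trans hl
      · have h2 := (flow_isBigO_inflow hP hν hz ⟨v, hv, hxv⟩).mul
          (isBigO_refl (fun ε : ℝ => ε) (𝓝[>] 0))
        refine IsBigO.trans ?_ hr
        refine h2.congr_right fun ε => mul_comm _ _
  have hfin := hin.trans (isBigO_of_isBigO_add_eps_mul (outflow_nonneg hP hν B) (by
    filter_upwards [eventually_mem_Ioo] with ε hε using (Real.rpow_pos_of_pos hε.1 _).le) hout)
  have h2 := hfin.mul (isBigO_refl (fun ε : ℝ => ε ^ (-∑ i, f i)) (𝓝[>] 0))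
  refine (Filter.EventuallyEq.trans_isBigO ?_ h2).trans_eventuallyEq ?_
  · filter_upwards [self_mem_nhdsWithin] with ε hε
    have hε' : (0 : ℝ) < ε := hε
    rw [mul_assoc, ← Real.rpow_add hε', add_neg_cancel, Real.rpow_zero, mul_one]
  · filter_upwards [self_mem_nhdsWithin] with ε hε
    have hε' : (0 : ℝ) < ε := hε
    rw [← Real.rpow_add hε', sub_eq_add_neg]

end RandomGame

/-! ### Attracting sets -/

open Asymptotics

theorem tendsto_rpow_nhdsGT_zero {κ : ℝ} (h : 0 < κ) :
    Filter.Tendsto (fun ε : ℝ => ε ^ κ) (𝓝[>] 0) (𝓝 0) := by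
  have h1 := (Real.continuousAt_rpow_const 0 κ (Or.inr h.le)).tendsto
  rw [Real.zero_rpow h.ne'] at h1
  exact h1.mono_left nhdsWithin_le_nhds

/-- A set is attracting if the states outside are negligible under stationary measures, and are
transient when they do not lead to a fixed state with a self-loop. -/
theorem isAttracting_of_negligible {X : Type*} [Fintype X] [DecidableEq X]
    {P : ℝ → Matrix X X ℝ} (hP : ∀ᶠ ε in 𝓝[>] (0 : ℝ), P ε ∈ Matrix.rowStochastic ℝ X) {d : X}
    (hd : ∀ᶠ ε in 𝓝[>] (0 : ℝ), 0 < P ε d d) {S : Set X}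
    (hmass : ∀ x ∉ S, ∀ ν : ℝ → X → ℝ, (∀ᶠ ε in 𝓝[>] (0 : ℝ), IsSubStationary (P ε) (ν ε)) →
      Filter.Tendsto (fun ε => ν ε x) (𝓝[>] 0) (𝓝 0))
    (htrans : ∀ x ∉ S, ∀ᶠ ε in 𝓝[>] (0 : ℝ), x ∈ reachSet (P ε) d ∨
      ∀ μ ∈ stdSimplex ℝ X, Filter.Tendsto (fun k => (μ ᵥ* P ε ^ k) x) Filter.atTop (𝓝 0)) :
    IsAttracting P S := by
  classical
  intro μ hμ
  -- Negligibility along families is made uniform over stationary measures by selecting an offending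
  -- measure wherever one exists. The zero measure, which is admissible, fills the other ε.
  have hunif : ∀ η : ℝ, 0 < η → ∀ x ∉ S, ∀ᶠ ε in 𝓝[>] (0 : ℝ), ∀ ν : X → ℝ,
      IsSubStationary (P ε) ν → ν x < η := by
    intro η hη x hx
    by_contra hcon
    rw [Filter.not_eventually] at hcon
    let ν : ℝ → X → ℝ := fun ε =>
      if h : ∃ ν, IsSubStationary (P ε) ν ∧ η ≤ ν x then h.choose else 0
    have hν : ∀ ε, IsSubStationary (P ε) (ν ε) := by
      intro ε
      by_cases h : ∃ ν, IsSubStationary (P ε) ν ∧ η ≤ ν x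
      · simp only [ν, dif_pos h]
        exact h.choose_spec.1
      · simp only [ν, dif_neg h]
        exact ⟨fun _ => le_rfl, by simp, by simp⟩
    have hlim := hmass x hx ν (Filter.Eventually.of_forall hν)
    refine hcon ((hlim.eventually (eventually_lt_nhds hη)).mono fun ε hε hnot => hnot ?_)
    intro ν' hν'
    by_contra! hge
    have h : ∃ ν, IsSubStationary (P ε) ν ∧ η ≤ ν x := ⟨ν', hν', hge⟩
    have : η ≤ ν ε x := by
      simp only [ν, dif_pos h]
      exact h.choose_spec.2
    linarith
  have hb : ∀ ε, P ε ∈ Matrix.rowStochastic ℝ X → ∀ k,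
      0 ≤ visitProb (P ε) μ S k ∧ visitProb (P ε) μ S k ≤ 1 := by
    intro ε hε k
    obtain ⟨h0, h1⟩ := visitProb_bounds hε hμ k
    refine ⟨Finset.sum_nonneg fun y _ => Set.indicator_nonneg (fun y _ => h0 y) y, ?_⟩
    rw [← h1]
    exact Finset.sum_le_sum fun y _ => Set.indicator_le_self' (fun y _ => h0 y) y
  refine tendsto_order.2 ⟨fun a ha => ?_, fun a ha => ?_⟩
  -- With this bound for each state, the total mass outside `S` stays below `(1 - a) / 2`.
  · obtain ⟨η, hη⟩ : ∃ η, η = (1 - a) / (2 * (Fintype.card X + 1)) := ⟨_, rfl⟩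
    have hc : (0 : ℝ) < Fintype.card X + 1 := by positivity
    have hη0 : 0 < η := by rw [hη]; exact div_pos (by linarith) (by positivity)
    have hall : ∀ᶠ ε in 𝓝[>] (0 : ℝ), ∀ x, x ∉ S → (∀ ν : X → ℝ,
        IsSubStationary (P ε) ν → ν x < η) ∧ (x ∈ reachSet (P ε) d ∨
      ∀ μ ∈ stdSimplex ℝ X, Filter.Tendsto (fun k => (μ ᵥ* P ε ^ k) x) Filter.atTop (𝓝 0)) := by
      refine Filter.eventually_all.2 fun x => ?_
      by_cases hx : x ∈ S
      · exact Filter.Eventually.of_forall fun ε h => absurd hx h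
      · filter_upwards [hunif η hη0 x hx, htrans x hx] with ε h1 h2 _ using ⟨h1, h2⟩
    filter_upwards [hall, hP, hd] with ε h1 h2 h3
    have hk : ∀ᶠ k in Filter.atTop, ∀ x, x ∉ S → (μ ᵥ* P ε ^ k) x < η := by
      refine Filter.eventually_all.2 fun x => ?_
      by_cases hx : x ∈ S
      · exact Filter.Eventually.of_forall fun k h => absurd hx h
      · obtain ⟨ha, hr | ht⟩ := h1 x hx
        · by_contra hcon
          have hfreq : ∃ᶠ k in Filter.atTop, η ≤ (μ ᵥ* P ε ^ k) x := by
            rw [Filter.not_eventually] at hcon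
            exact hcon.mono fun k hk => by
              by_contra! hlt
              exact hk fun _ => hlt
          obtain ⟨ν, hν, hge⟩ := exists_isSubStationary h2 h3 hμ hr hfreq
          exact absurd (ha ν hν) (not_lt.2 hge)
        · filter_upwards [(ht μ hμ).eventually (eventually_lt_nhds hη0)] with k hk _ using hk
    have hge : ∀ᶠ k in Filter.atTop, (1 + a) / 2 ≤ visitProb (P ε) μ S k := by
      filter_upwards [hk] with k hk
      obtain ⟨h0, hs⟩ := visitProb_bounds h2 hμ k
      have e : visitProb (P ε) μ S k = 1 - ∑ x, Sᶜ.indicator (μ ᵥ* P ε ^ k) x := by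
        rw [← hs, visitProb, ← Finset.sum_sub_distrib]
        refine Finset.sum_congr rfl fun x _ => ?_
        by_cases hx : x ∈ S <;> simp [hx]
      have hle : ∑ x, Sᶜ.indicator (μ ᵥ* P ε ^ k) x ≤ ∑ _x : X, η := by
        refine Finset.sum_le_sum fun x _ => ?_
        by_cases hx : x ∈ S
        · simpa [hx] using hη0.le
        · simpa [hx] using (hk x hx).le
      rw [Finset.sum_const, Finset.card_univ, nsmul_eq_mul] at hle
      have h5 : (Fintype.card X + 1) * η = (1 - a) / 2 := by rw [hη]; field_simp
      rw [e]
      nlinarith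
    refine lt_of_lt_of_le (show a < (1 + a) / 2 by linarith) (Filter.le_liminf_of_le
      (Filter.isBoundedUnder_of ⟨1, fun k => (hb ε h2 k).2⟩ :
        Filter.IsBoundedUnder (· ≤ ·) _ _).isCoboundedUnder_ge hge)
  · filter_upwards [hP] with ε hε
    refine lt_of_le_of_lt (Filter.liminf_le_of_le
      (Filter.isBoundedUnder_of ⟨0, fun k => (hb ε hε k).1⟩) fun b hbb => ?_) ha
    obtain ⟨k, hk⟩ := hbb.exists
    exact hk.trans (hb ε hε k).2

/-! ### Attracting sets of the algorithm -/

namespace RandomGame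

open AgentState

variable {I : Type*} {A : I → Type*} [∀ i, Fintype (A i)] [∀ i, DecidableEq (A i)]
  {p : RitelParams} [Fintype I] [DecidableEq I]

/-- The discontent state has mass `O(ε ^ κ)` under all stationary measures. -/
def DiscontentDecay (g : RandomGame I A) (p : RitelParams) (κ : ℝ) : Prop :=
  ∀ ν : ℝ → RitelState A p → ℝ,
    (∀ᶠ ε in 𝓝[>] (0 : ℝ), IsSubStationary (g.ritel p ε) (ν ε)) →
    (fun ε => ν ε fun _ => discontent) =O[𝓝[>] 0] fun ε : ℝ => ε ^ κ

variable {g : RandomGame I A}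

omit [∀ i, Fintype (A i)] [∀ i, DecidableEq (A i)] [Fintype I] [DecidableEq I] in
theorem exists_fiber {x : RitelState A p} (hx : ∀ i, x i ≠ discontent) :
    ∃ (a : ∀ i, A i) (v : I → p.Bin), x ∈ fiber a v := by
  have : ∀ i, ∃ b : A i × p.Bin, (x i).bench = some b := fun i =>
    Option.ne_none_iff_exists'.1 fun h => hx i (bench_eq_none.1 h)
  choose b hb using this
  exact ⟨fun i => (b i).1, fun i => (b i).2, hb⟩

omit [∀ i, DecidableEq (A i)] in
theorem finite_resistances (G : ℝ → ℝ → ℝ) (s ρ : ℝ) (a : ∀ i, A i) :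
    {r : ℝ | ∃ (i : I) (b : A i), b ≠ a i ∧ g.mean i a + ρ < g.mean i (Function.update a i b) ∧
      r = G (g.mean i a - s) (g.mean i (Function.update a i b) + s)}.Finite := by
  refine (Set.finite_range fun q : Σ i, A i =>
    G (g.mean q.1 a - s) (g.mean q.1 (Function.update a q.1 q.2) + s)).subset ?_
  rintro r ⟨i, b, -, -, rfl⟩
  exact ⟨⟨i, b⟩, rfl⟩

omit [∀ i, DecidableEq (A i)] in
theorem one_sub_virtualStability_le (G : ℝ → ℝ → ℝ) (s ρ : ℝ) {a : ∀ i, A i} {i : I} {b : A i}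
    (hb : b ≠ a i) (h : g.mean i a + ρ < g.mean i (Function.update a i b)) :
    1 - g.virtualStability G s ρ a ≤
      G (g.mean i a - s) (g.mean i (Function.update a i b) + s) := by
  rw [virtualStability, sub_sub_cancel]
  exact csInf_le (finite_resistances G s ρ a).bddBelow ⟨i, b, hb, h, rfl⟩

omit [∀ i, DecidableEq (A i)] in
-- Failure of the equilibrium condition makes the finite set of resistances nonempty, so its infimum
-- is attained.
theorem exists_eq_one_sub_virtualStability (G : ℝ → ℝ → ℝ) (s : ℝ) {ρ : ℝ} {a : ∀ i, A i}
    (ha : ¬ g.IsEquilibrium ρ a) :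
    ∃ (i : I) (b : A i), b ≠ a i ∧ g.mean i a + ρ < g.mean i (Function.update a i b) ∧
      1 - g.virtualStability G s ρ a =
        G (g.mean i a - s) (g.mean i (Function.update a i b) + s) := by
  rw [virtualStability, sub_sub_cancel]
  refine Set.Nonempty.csInf_mem ?_ (finite_resistances G s ρ a)
  unfold IsEquilibrium at ha
  push Not at ha
  obtain ⟨i, b, hb, h⟩ := ha
  exact ⟨_, i, b, hb, h, rfl⟩

variable [∀ i, Nontrivial (A i)]
  (hG : ∀ w v : p.Bin, (w : ℕ) < v → 0 ≤ p.G (p.lower w) (p.lower v))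
  (hF : ∀ v, 0 ≤ p.F (p.lower v))
  (hP : ∀ᶠ ε in 𝓝[>] (0 : ℝ), g.ritel p ε ∈ Matrix.rowStochastic ℝ (RitelState A p))

include hG hF hP

/-- A set of states is attracting if the states without discontent agent outside it leave their
benchmarks sufficiently easily. -/
theorem isAttracting_ritel (hinter : g.Interdependent (3 * p.δ)) {S : Set (RitelState A p)} {κ : ℝ}
    (hκ : 0 < κ) (hdecay : DiscontentDecay g p κ)
    (hS : ∀ a v, ∀ x ∈ fiber a v, x ∉ S → ∃ r κ' : ℝ, Escapes (g.ritel p) (fiber a v) r x ∧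
      DiscontentDecay g p κ' ∧ r < κ' + ∑ i, p.F (p.lower (v i))) :
    IsAttracting (g.ritel p) S := by
  classical
  set D : RitelState A p := fun _ => discontent with hD
  -- The self-loop at D, due to `cF < 1`, provides the aperiodicity required for asymptotic
  -- stationarity.
  have hself : ∀ᶠ ε in 𝓝[>] (0 : ℝ), 0 < g.ritel p ε D D := by
    have h1 := one_isBigO_ritel_pi (g := g) hG (x := D) (fun i => Classical.arbitrary (A i))
      (fun _ => {discontent}) (fun i b hb => by simp [hD, benchmark] at hb)
      (fun i => one_isBigO_agentStep_discontent hG rfl)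
    have h2 := eventually_exists_pos_of_isBigO (q := 0) hP (by simpa using h1)
    filter_upwards [h2] with ε hε
    obtain ⟨y, hy, h⟩ := hε
    have : y = D := funext fun i => hy i
    rwa [this] at h
  have hreach : ∀ᶠ ε in 𝓝[>] (0 : ℝ), ∀ x : RitelState A p, (∃ i, x i = discontent) →
      x ∈ reachSet (g.ritel p ε) D := by
    refine Filter.eventually_all.2 fun x => ?_
    by_cases hx : (∃ i, x i = discontent) ∧ x ≠ D
    · have hesc := escapes_of_discontent (g := g) (L := {D}ᶜ) hG hinter (fun h => h rfl) hx.1 hx.2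
      filter_upwards [hesc.exists_path hP hx.2, hP] with ε hε h2 _
      obtain ⟨k, z, -, y, hy, hk, hzy⟩ := hε
      have hyD : y = D := by simpa using hy
      rw [hyD] at hzy
      exact ⟨k + 1, pow_add_pos h2 hk (by simpa using hzy)⟩
    · refine Filter.Eventually.of_forall fun ε h => ?_
      have : x = D := by
        by_contra hne
        exact hx ⟨h, hne⟩
      rw [this]
      exact mem_reachSet_self _ _
  refine isAttracting_of_negligible hP hself (fun x hx ν hν => ?_) fun x hx => ?_
  · by_cases hxd : ∃ i, x i = discontent
    · have h1 := (mass_isBigO_of_discontent hG hF hP hν hinter hxd).trans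
        ((isBigO_refl _ _).mul (rpow_isBigO_rpow (t := 0)
          (Finset.sum_nonneg fun i _ => cost_nonneg hF (x i))))
      simp only [Real.rpow_zero, mul_one] at h1
      exact (h1.trans (hdecay ν hν)).trans_tendsto (tendsto_rpow_nhdsGT_zero hκ)
    · push Not at hxd
      obtain ⟨a, v, hxv⟩ := exists_fiber hxd
      obtain ⟨r, κ', hesc, hdec, hlt⟩ := hS a v x hxv hx
      have h1 := (mass_isBigO_of_escapes hG hF hP hν hinter hxv hesc).trans
        ((hdec ν hν).mul (isBigO_refl _ _))
      have e : (fun ε : ℝ => ε ^ κ' * ε ^ (∑ i, p.F (p.lower (v i)) - r)) =ᶠ[𝓝[>] 0]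
          fun ε => ε ^ (κ' + (∑ i, p.F (p.lower (v i)) - r)) := by
        filter_upwards [self_mem_nhdsWithin] with ε hε
        rw [Real.rpow_add hε]
      exact (h1.trans_eventuallyEq e).trans_tendsto (tendsto_rpow_nhdsGT_zero (by linarith))
  · by_cases hxd : ∃ i, x i = discontent
    · filter_upwards [hreach] with ε hε using Or.inl (hε x hxd)
    · push Not at hxd
      obtain ⟨a, v, hxv⟩ := exists_fiber hxd
      obtain ⟨r, -, hesc, -⟩ := hS a v x hxv hx
      filter_upwards [hesc.exists_path hP hxv, hP, hreach] with ε hε hPε hr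
      by_cases hxR : x ∈ reachSet (g.ritel p ε) D
      · exact Or.inl hxR
      refine Or.inr fun μ hμ => ?_
      obtain ⟨k, z, hz, y, hy, hk, hzy⟩ := hε
      have hlev : ∀ w ∈ fiber a v, totalLevel w = ∑ i, (v i : ℕ) := fun w hw =>
        Finset.sum_congr rfl fun i _ => by simp [level, hw i]
      have hxy : 0 < (g.ritel p ε ^ (k + 1)) x y := pow_add_pos hPε hk (by simpa using hzy)
      have hact : ∀ w, w ∉ reachSet (g.ritel p ε) D → ∀ i, w i ≠ discontent :=
        fun w hw i h => hw (hr w ⟨i, h⟩)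
      have hyR : y ∉ reachSet (g.ritel p ε) D := fun h =>
        hxR (mem_reachSet_of_pow_pos hPε hxy h)
      -- If D cannot be reached from `x`, no agent ever becomes discontent, so the total level never
      -- falls, and it rises when the benchmarks are left.
      refine tendsto_law_zero_of_increasing hPε (W := (reachSet (g.ritel p ε) D)ᶜ)
        (V := fun w => (totalLevel w : ℝ)) (fun w => Nat.cast_nonneg _) (fun w hw w' hww => ?_)
        hμ hxR hxy ?_
      · have hw' : w' ∉ reachSet (g.ritel p ε) D := fun h =>
          hw (mem_reachSet_of_pow_pos hPε (k := 1) (by simpa using hww) h)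
        exact ⟨hw', by exact_mod_cast totalLevel_le_of_ritel_ne_zero (hact w' hw') hww.ne'⟩
      · have h2 := totalLevel_lt_of_ritel_ne_zero hz (hact y hyR) hy hzy.ne'
        rw [hlev z hz, ← hlev x hxv] at h2
        exact_mod_cast h2

end RandomGame

end

/-! ### The main theorem -/

open RandomGame AgentState in
theorem mainTheorem2 {I : Type*} [Fintype I] [DecidableEq I] [Nontrivial I]
    {A : I → Type*} [∀ i, Fintype (A i)] [∀ i, DecidableEq (A i)] [∀ i, Nonempty (A i)]
    (g : RandomGame I A) (p : RitelParams)
    (hinter : g.Interdependent (3 * p.δ))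
    (hbounds : p.ResistanceBounds (Fintype.card I))
    (hnoise : 1 ≤ 2 * p.τ₀ * p.δ ^ 2) :
    ((∃ a, g.IsEquilibrium 0 a) →
      ∀ x ∈ stochasticallyStable (g.ritel p), ∃ a, HasActionProfile x a ∧
        (g.IsOptimal p.δ a ∨
          (g.IsEquilibrium (3 * p.δ) a ∧
            ∀ a', g.IsEquilibrium 0 a' →
              IsMaxOn (g.virtualWelfare p.F 0) {b | g.IsEquilibrium 0 b} a' →
              g.virtualWelfare p.F (-p.δ) a' ≤ g.virtualWelfare p.F p.δ a))) ∧
    ((¬ ∃ a, g.IsEquilibrium 0 a) →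
      ∀ x ∈ stochasticallyStable (g.ritel p), ∃ a, HasActionProfile x a ∧
        (g.IsEquilibrium (3 * p.δ) a ∨
          ∀ a', IsMaxOn (fun b => g.virtualWelfare p.F 0 b - g.virtualStability p.G 0 0 b)
              Set.univ a' →
            g.virtualWelfare p.F (-p.δ) a' - g.virtualStability p.G p.δ 0 a' ≤
              g.virtualWelfare p.F p.δ a -
                g.virtualStability p.G (-p.δ) (3 * p.δ) a)) := by
  have hδ := p.δ_pos
  have hnt : ∀ i, Nontrivial (A i) := by
    intro i
    let a : ∀ i, A i := fun i => Classical.arbitrary _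
    obtain ⟨j, hj⟩ := exists_ne i
    obtain ⟨k, hk, a', ha', h⟩ := hinter a {i} (Set.singleton_nonempty i)
      (fun h => hj (by simpa using (h ▸ Set.mem_univ j : j ∈ ({i} : Set I))))
    refine ⟨a' i, a i, fun he => ?_⟩
    have : a' = a := by
      funext l
      by_cases hl : l = i
      · subst hl; exact he
      · exact ha' l hl
    subst this
    simp only [sub_self, abs_zero] at h
    linarith
  have hP : ∀ᶠ ε in 𝓝[>] (0 : ℝ), g.ritel p ε ∈ Matrix.rowStochastic ℝ (RitelState A p) := by
    filter_upwards [eventually_mem_Ioo] with ε hε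
    exact ritel_rowStochastic g p hinter hbounds hε.1 hε.2
  obtain ⟨F₀, G₀, hF₀, hG₀, hFG⟩ := hbounds
  have hG : ∀ w v : p.Bin, (w : ℕ) < v → 0 ≤ p.G (p.lower w) (p.lower v) := fun w v h =>
    (hG₀ _ _ (p.lower_mem w).1 (p.lower_lt_lower h) (p.lower_mem v).2).1
  have hF : ∀ v, 0 ≤ p.F (p.lower v) := fun v => (hF₀ _ (p.lower_mem v)).1
  have hG₀pos : 0 < G₀ := by
    have := hG₀ 0 1 le_rfl one_pos le_rfl
    linarith [this.1, this.2]
  have hcard : (0 : ℝ) < Fintype.card I := by exact_mod_cast Fintype.card_pos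
  have hF₀nn : 0 ≤ F₀ := by
    have := hF₀ 0 ⟨le_rfl, zero_le_one⟩
    have h2 := this.1.trans this.2
    by_contra! hneg
    exact absurd h2 (not_le.2 (div_neg_of_neg_of_pos hneg hcard))
  have hsumF₀ : ∑ _i : I, F₀ / Fintype.card I = F₀ := by
    rw [Finset.sum_const, Finset.card_univ, nsmul_eq_mul]
    field_simp
  have hcost : ∀ v : I → p.Bin, 0 ≤ ∑ i, p.F (p.lower (v i)) := fun v =>
    Finset.sum_nonneg fun i _ => hF _
  -- Two decay rates for D: the uniform one through `F₀` is comparable with `G₀` and positive,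
  -- whereas the finer one below contains the virtual welfare. The points `M - δ` may be negative,
  -- where the bound by `F₀` is not available.
  have hdecay₀ : ∀ (a : ∀ i, A i) (γ : ℝ), γ ≤ 1 →
      (∀ i, ∀ b ≠ a i, g.mean i a < g.mean i (Function.update a i b) →
        γ ≤ p.G (g.mean i a - p.δ) (g.mean i (Function.update a i b) + p.δ)) →
      DiscontentDecay g p (1 + max γ 0 - F₀) := by
    intro a γ hγ1 hγ ν hν
    rw [← hsumF₀]
    exact mass_discontent_isBigO hG hF hP hν hnoise a
      (fun i v _ => (hF₀ _ (p.lower_mem v)).2) hγ1 hγ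
  have hdecay : ∀ (a : ∀ i, A i) (γ : ℝ), γ ≤ 1 →
      (∀ i, ∀ b ≠ a i, g.mean i a < g.mean i (Function.update a i b) →
        γ ≤ p.G (g.mean i a - p.δ) (g.mean i (Function.update a i b) + p.δ)) →
      DiscontentDecay g p (1 + max γ 0 - ∑ i, p.F (g.mean i a + -p.δ)) := by
    intro a γ hγ1 hγ ν hν
    exact mass_discontent_isBigO hG hF hP hν hnoise a
      (fun i v hv => p.F_antitone (by linarith [hv.2])) hγ1 hγ
  have hnearF : ∀ (a : ∀ i, A i) (v : I → p.Bin),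
      (∀ i, p.bin (g.mean i a) ∈ nearBins p (v i)) →
      ∑ i, p.F (g.mean i a + p.δ) ≤ ∑ i, p.F (p.lower (v i)) := fun a v h =>
    Finset.sum_le_sum fun i _ => p.F_antitone (lower_le_of_near (g.mean_mem i a).1 (h i))
  have hprofile : ∀ {a v} {x : RitelState A p}, x ∈ fiber a v → HasActionProfile x a :=
    fun hx i => fiber_benchmark hx i
  have hGimp : ∀ {a : ∀ i, A i} {i : I} {b : A i},
      g.mean i a + 3 * p.δ < g.mean i (Function.update a i b) →
      0 ≤ p.G (g.mean i a + p.δ) (g.mean i (Function.update a i b) - p.δ) ∧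
      p.G (g.mean i a + p.δ) (g.mean i (Function.update a i b) - p.δ) < G₀ := by
    intro a i b h
    have h1 := g.mean_mem i a
    have h2 := g.mean_mem i (Function.update a i b)
    exact hG₀ _ _ (by linarith [h1.1]) (by linarith) (by linarith [h2.2])
  refine ⟨fun ⟨a₀, ha₀⟩ x hx => ?_, fun hno x hx => ?_⟩
  -- At an equilibrium there is no improving deviation, so the condition on `γ` is vacuous and the
  -- largest admissible value `γ = 1` can be used.
  · have heq : ∀ a, g.IsEquilibrium 0 a → ∀ i, ∀ b ≠ a i,
        g.mean i a < g.mean i (Function.update a i b) →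
        (1 : ℝ) ≤ p.G (g.mean i a - p.δ) (g.mean i (Function.update a i b) + p.δ) := by
      intro a ha i b hb h
      have := ha i b hb
      linarith
    have hd₀ := hdecay₀ a₀ 1 le_rfl (heq a₀ ha₀)
    rw [max_eq_left zero_le_one] at hd₀
    suffices hatt : IsAttracting (g.ritel p) {x | ∃ a,
      HasActionProfile x a ∧ (g.IsOptimal p.δ a ∨ (g.IsEquilibrium (3 * p.δ) a ∧
        ∀ a', g.IsEquilibrium 0 a' →
          IsMaxOn (g.virtualWelfare p.F 0) {b | g.IsEquilibrium 0 b} a' →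
          g.virtualWelfare p.F (-p.δ) a' ≤ g.virtualWelfare p.F p.δ a))} from
      Set.mem_sInter.1 hx _ hatt
    refine isAttracting_ritel hG hF hP hinter (by linarith) hd₀ fun a v y hy hyS => ?_
    by_cases hnear : ∀ i, p.bin (g.mean i a) ∈ nearBins p (v i)
    · by_cases h3 : g.IsEquilibrium (3 * p.δ) a
      · have hopt : ¬ g.IsOptimal p.δ a := fun h => hyS ⟨a, hprofile hy, Or.inl h⟩
        obtain ⟨a', ha', hlt⟩ : ∃ a', g.IsEquilibrium 0 a' ∧
            g.virtualWelfare p.F p.δ a < g.virtualWelfare p.F (-p.δ) a' := by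
          by_contra! hc
          exact hyS ⟨a, hprofile hy, Or.inr ⟨h3, fun a' h _ => hc a' h⟩⟩
        unfold IsOptimal at hopt
        push Not at hopt
        obtain ⟨i, hi⟩ := hopt
        obtain ⟨j, hj⟩ := exists_ne i
        -- Here `κ'` is `2 - ∑ F(Mᵢ(a') - δ)`. As `∑ F(vᵢ⁻) ≥ ∑ F(Mᵢ(a) + δ)`, the required
        -- inequality follows from `hlt`.
        refine ⟨2, _, escapes_of_escapes_contentState hG hnoise hnear zero_le_two
          (escapes_contentState_of_not_optimal hG hinter hnear hj hi) hy,
          hdecay a' 1 le_rfl (heq a' ha'), ?_⟩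
        have := hnearF a v hnear
        unfold virtualWelfare at hlt
        rw [max_eq_left zero_le_one]
        linarith
      · unfold IsEquilibrium at h3
        push Not at h3
        obtain ⟨i, b, hb, himp⟩ := h3
        obtain ⟨hg0, hg1⟩ := hGimp himp
        -- The resistance is below `1 + G₀`, and `1 + G₀ ≤ 2 - F₀` is the hypothesis `F₀ + G₀ ≤ 1`.
        refine ⟨_, _, escapes_of_escapes_contentState hG hnoise hnear (by linarith)
          (escapes_contentState_of_improvement hG (hnear i) hb himp) hy, hd₀, ?_⟩
        linarith [hcost v]
    · push Not at hnear
      obtain ⟨i, hi⟩ := hnear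
      exact ⟨0, _, escapes_of_not_near hG hi hy, hd₀, by linarith [hcost v]⟩
  · push Not at hno
    -- The minimum is some `G(M - δ, M' + δ)`, whose arguments may lie outside `[0, 1]`. By
    -- monotonicity it is at most `G(M, M') < G₀ ≤ 1`.
    have hγ1 : ∀ a, 1 - g.virtualStability p.G p.δ 0 a ≤ 1 := by
      intro a
      obtain ⟨i, b, hb, h, he⟩ := exists_eq_one_sub_virtualStability p.G p.δ (hno a)
      rw [he]
      rw [add_zero] at h
      have h1 := (hG₀ _ _ (g.mean_mem i a).1 h (g.mean_mem i (Function.update a i b)).2).2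
      have h2 := p.G_monotone_left (g.mean i (Function.update a i b) + p.δ)
        (show g.mean i a - p.δ ≤ g.mean i a by linarith)
      have h3 := p.G_antitone_right (g.mean i a)
        (show g.mean i (Function.update a i b) ≤ g.mean i (Function.update a i b) + p.δ by linarith)
      simp only at h2
      linarith
    have hγ : ∀ a : ∀ i, A i, ∀ i, ∀ b ≠ a i, g.mean i a < g.mean i (Function.update a i b) →
        1 - g.virtualStability p.G p.δ 0 a ≤
          p.G (g.mean i a - p.δ) (g.mean i (Function.update a i b) + p.δ) := fun a i b hb h =>
      one_sub_virtualStability_le p.G p.δ 0 hb (by rwa [add_zero])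
    let a₀ : ∀ i, A i := fun i => Classical.arbitrary _
    have hd₀ := hdecay₀ a₀ _ (hγ1 a₀) (hγ a₀)
    have hmax := le_max_right (1 - g.virtualStability p.G p.δ 0 a₀) 0
    suffices hatt : IsAttracting (g.ritel p) {x | ∃ a,
      HasActionProfile x a ∧ (g.IsEquilibrium (3 * p.δ) a ∨
        ∀ a', IsMaxOn (fun b => g.virtualWelfare p.F 0 b - g.virtualStability p.G 0 0 b)
            Set.univ a' →
          g.virtualWelfare p.F (-p.δ) a' - g.virtualStability p.G p.δ 0 a' ≤
            g.virtualWelfare p.F p.δ a - g.virtualStability p.G (-p.δ) (3 * p.δ) a)} from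
      Set.mem_sInter.1 hx _ hatt
    refine isAttracting_ritel hG hF hP hinter (by linarith) hd₀ fun a v y hy hyS => ?_
    by_cases hnear : ∀ i, p.bin (g.mean i a) ∈ nearBins p (v i)
    · have h3 : ¬ g.IsEquilibrium (3 * p.δ) a := fun h => hyS ⟨a, hprofile hy, Or.inl h⟩
      obtain ⟨a', hlt⟩ : ∃ a', g.virtualWelfare p.F p.δ a -
          g.virtualStability p.G (-p.δ) (3 * p.δ) a <
          g.virtualWelfare p.F (-p.δ) a' - g.virtualStability p.G p.δ 0 a' := by
        by_contra! hc
        exact hyS ⟨a, hprofile hy, Or.inr fun a' _ => hc a'⟩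
      obtain ⟨i, b, hb, himp, he⟩ := exists_eq_one_sub_virtualStability p.G (-p.δ) h3
      rw [sub_neg_eq_add, ← sub_eq_add_neg] at he
      obtain ⟨hg0, -⟩ := hGimp himp
      refine ⟨_, _, escapes_of_escapes_contentState hG hnoise hnear (by linarith)
        (escapes_contentState_of_improvement hG (hnear i) hb himp) hy,
        hdecay a' _ (hγ1 a') (hγ a'), ?_⟩
      -- The deviation that attains the minimum makes the resistance `2 - S̃₋(a)`, against a decay
      -- exponent of at least `2 - S̃₊(a') - ∑ F(Mᵢ(a') - δ)`.
      rw [← he]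
      have h4 := hnearF a v hnear
      have h5 := le_max_left (1 - g.virtualStability p.G p.δ 0 a') 0
      unfold virtualWelfare at hlt
      linarith
    · push Not at hnear
      obtain ⟨i, hi⟩ := hnear
      exact ⟨0, _, escapes_of_not_near hG hi hy, hd₀, by linarith [hcost v]⟩
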